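/- Let $L>0$, $T\ge 0$, $\Omega=(0,L)$, $\mathcal J=[0,T]$, and let $r\ge 1$ be an integer. Let $E\in C^1([0,T])$ be a relaxation modulus with $E(0)>0$, let $\nu>-1$ be the Poisson ratio, and let $\varepsilon_{\max}>0$ and positive constants $\underline C_E,\overline C_E,\underline C_G,\overline C_G,M$ be given. Then there is a constant $C>0$, depending only on $L,T,r,E,\nu,\varepsilon_{\max}$ and these five constants, such that the following holds. Let $0<\varepsilon\le\varepsilon_{\max}$ and $\lambda=2(1+\nu)\varepsilon^2$. Let $\hat I,\hat A\in C^r([0,L])$, with all derivatives of order $0,\dots,r$ bounded by $M$ in absolute value, satisfy $$\underline C_E\le E(0)\hat I(x)\le\overline C_E,\qquad \underline C_G\le \frac{E(0)}{2(1+\nu)}\hat A(x)\le\overline C_G\qquad(x\in[0,L]).$$ Let $0=x_0<x_1<\dots<x_n=L$ be any partition, with $h=\max_i(x_i-x_{i-1})$. Let $V_h\subset H^1_0(\Omega)$ be the space of functions that are polynomials of degree at most $r$ on each $(x_{i-1},x_i)$, and $Q_h\subset L^2(\Omega)$ the space of functions that are polynomials of degree at most $r-1$ on each $(x_{i-1},x_i)$.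 Let $q_E\in L^1(\mathcal J;H^r(\Omega))$. Suppose that $(\theta,w,\gamma)\in L^1(\mathcal J;H^1_0(\Omega)\times H^1_0(\Omega)\times L^2(\Omega))$ satisfies, for a.e. $t\in\mathcal J$, $$(\hat I\theta'(t),\eta')+(\gamma(t),\eta-v')=(q_E(t),v)+\int_0^t\frac{\dot E(t-s)}{E(0)}\Big[(\hat I\theta'(s),\eta')+(\gamma(s),\eta-v')\Big]ds,$$ $$(\theta(t)-w'(t),\psi)-\lambda(\gamma(t)/\hat A,\psi)=0$$ for all $\eta,v\in H^1_0(\Omega)$ and $\psi\in L^2(\Omega)$, where $(\cdot,\cdot)$ is the inner product of $L^2(\Omega)$, and that $(\theta_h,w_h,\gamma_h)\in L^1(\mathcal J;V_h\times V_h\times Q_h)$ satisfies, for a.e. $t\in\mathcal J$, the same two equations for all $\eta,v\in V_h$ and $\psi\in Q_h$. Then, with $\|(\eta,v)\|_{\mathbb H}^2=\|\eta'\|_{L^2(\Omega)}^2+\|v'\|_{L^2(\Omega)}^2$, $$\int_0^T\|(\theta,w)-(\theta_h,w_h)\|_{\mathbb H}\,dt+\int_0^T\|\gamma-\gamma_h\|_{L^2(\Omega)}\,dt\le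 C\,h^r\int_0^T\|q_E\|_{H^r(\Omega)}\,dt .$$ In particular $C$ is independent of $h$ and of $\lambda$. -/

import Mathlib

open MeasureTheory Set
open scoped ContDiff

noncomputable section

namespace Timoshenko

/-- Lebesgue measure on the spatial domain `Ω = (0, L)`. -/
abbrev dom (L : ℝ) : Measure ℝ := volume.restrict (Ioo 0 L)

/-- The space `L²(Ω)`. -/
abbrev L2 (L : ℝ) : Type := Lp ℝ 2 (dom L)

/-- `g` is the weak derivative of `u` on `Ω = (0, L)`. -/
def IsWeakDeriv (L : ℝ) (u g : L2 L) : Prop :=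
  ∀ φ : ℝ → ℝ, ContDiff ℝ ∞ φ → HasCompactSupport φ → tsupport φ ⊆ Ioo 0 L →
    ∫ x, u x * deriv φ x ∂(dom L) = - ∫ x, g x * φ x ∂(dom L)

theorem integrable_mul_test {L : ℝ} (u : L2 L) {φ : ℝ → ℝ} (hφ : Continuous φ)
    (hc : HasCompactSupport φ) : Integrable (fun x => u x * φ x) (dom L) := by
  obtain ⟨C, hC⟩ := hc.exists_bound_of_continuous hφ
  exact ((Lp.memLp u).integrable (by norm_num)).mul_bdd (c := C) hφ.aestronglyMeasurable
    (Filter.Eventually.of_forall hC)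

theorem IsWeakDeriv.zero {L : ℝ} : IsWeakDeriv L 0 0 := by
  intro φ _ _ _
  have h (ψ : ℝ → ℝ) : ∫ x, (0 : L2 L) x * ψ x ∂(dom L) = 0 := by
    rw [← integral_zero ℝ ℝ (μ := dom L)]
    refine integral_congr_ae ?_
    filter_upwards [Lp.coeFn_zero ℝ 2 (dom L)] with x hx
    rw [hx]
    simp
  rw [h, h, neg_zero]

theorem IsWeakDeriv.add {L : ℝ} {u g u' g' : L2 L} (h : IsWeakDeriv L u g)
    (h' : IsWeakDeriv L u' g') : IsWeakDeriv L (u + u') (g + g') := by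
  intro φ hφ hc hs
  have key (a b : L2 L) {ψ : ℝ → ℝ} (hψ : Continuous ψ) (hcψ : HasCompactSupport ψ) :
      ∫ x, (a + b : L2 L) x * ψ x ∂(dom L)
        = ∫ x, a x * ψ x ∂(dom L) + ∫ x, b x * ψ x ∂(dom L) := by
    rw [← integral_add (integrable_mul_test a hψ hcψ) (integrable_mul_test b hψ hcψ)]
    refine integral_congr_ae ?_
    filter_upwards [Lp.coeFn_add a b] with x hx
    simp only [hx, Pi.add_apply]
    ring
  rw [key u u' (hφ.continuous_deriv (by simp)) hc.deriv, key g g' hφ.continuous hc,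
    h φ hφ hc hs, h' φ hφ hc hs]
  ring

theorem IsWeakDeriv.smul {L : ℝ} {u g : L2 L} (c : ℝ) (h : IsWeakDeriv L u g) :
    IsWeakDeriv L (c • u) (c • g) := by
  intro φ hφ hc hs
  have key (a : L2 L) (ψ : ℝ → ℝ) :
      ∫ x, (c • a : L2 L) x * ψ x ∂(dom L) = c * ∫ x, a x * ψ x ∂(dom L) := by
    rw [← integral_const_mul]
    refine integral_congr_ae ?_
    filter_upwards [Lp.coeFn_smul c a] with x hx
    simp only [hx, Pi.smul_apply, smul_eq_mul]
    ring
  rw [key, key, h φ hφ hc hs]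
  ring

/-- The Sobolev space `H^k(Ω)`. An element is the tuple `(u, u', …, u^(k))` of a function of
`L²(Ω)` and its weak derivatives up to order `k` (which it determines), so that the inherited norm
is the usual one, `‖u‖² = ∑_{j ≤ k} ‖u^(j)‖²_{L²(Ω)}`. -/
def Hk (L : ℝ) (k : ℕ) : Submodule ℝ (PiLp 2 (fun _ : Fin (k + 1) => L2 L)) where
  carrier := {u | ∀ j : Fin k, IsWeakDeriv L (u j.castSucc) (u j.succ)}
  zero_mem' := fun _ => IsWeakDeriv.zero
  add_mem' := fun hu hv j => (hu j).add (hv j)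
  smul_mem' := fun c _ hu j => (hu j).smul c

/-- An element of `H^k(Ω)`, seen in `L²(Ω)`. -/
def fn {L : ℝ} {k : ℕ} (u : Hk L k) : L2 L := u.1 0

/-- The weak derivative of an element of `H¹(Ω)`. -/
def der {L : ℝ} (u : Hk L 1) : L2 L := u.1 1

/-- `H¹₀(Ω)`: the elements of `H¹(Ω)` whose continuous representative vanishes at `0` and `L`. -/
def H01 (L : ℝ) : Submodule ℝ (Hk L 1) where
  carrier := {u | ∃ f : ℝ → ℝ, ContinuousOn f (Icc 0 L) ∧ (fn u) =ᵐ[dom L] f ∧ f 0 = 0 ∧ f L = 0}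
  zero_mem' := ⟨0, continuousOn_const, Lp.coeFn_zero ℝ 2 (dom L), rfl, rfl⟩
  add_mem' := by
    rintro u v ⟨f, hf, huf, hf0, hfL⟩ ⟨g, hg, hvg, hg0, hgL⟩
    refine ⟨f + g, hf.add hg, ?_, by simp [hf0, hg0], by simp [hfL, hgL]⟩
    exact Filter.EventuallyEq.trans (Lp.coeFn_add (fn u) (fn v)) (huf.add hvg)
  smul_mem' := by
    rintro c u ⟨f, hf, huf, hf0, hfL⟩
    refine ⟨c • f, hf.const_smul c, ?_, by simp [hf0], by simp [hfL]⟩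
    exact (Lp.coeFn_smul c (fn u)).trans (huf.const_smul c)

/-- The norm `‖(η, v)‖² = ‖η'‖²_{L²(Ω)} + ‖v'‖²_{L²(Ω)}` of `ℍ = H¹₀(Ω) × H¹₀(Ω)`. -/
def normH {L : ℝ} (η v : Hk L 1) : ℝ := Real.sqrt (‖der η‖ ^ 2 + ‖der v‖ ^ 2)

/-- A partition `0 = x₀ < x₁ < ⋯ < xₙ = L` of the domain. -/
structure IsMesh (L : ℝ) {n : ℕ} (x : Fin (n + 1) → ℝ) : Prop where
  strictMono : StrictMono x
  first : x 0 = 0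
  last : x (Fin.last n) = L

/-- The mesh size `h = max_i (x_i - x_{i-1})`. -/
def meshSize {n : ℕ} (x : Fin (n + 1) → ℝ) : ℝ := ⨆ i : Fin n, (x i.succ - x i.castSucc)

/-- The functions of `L²(Ω)` that are, on each element of the mesh, polynomials of degree at
most `m`. -/
def piecewisePoly (L : ℝ) {n : ℕ} (x : Fin (n + 1) → ℝ) (m : ℕ) : Submodule ℝ (L2 L) where
  carrier := {f | ∀ i : Fin n, ∃ p : Polynomial ℝ, p.natDegree ≤ m ∧
    ∀ᵐ y ∂(dom L), y ∈ Ioo (x i.castSucc) (x i.succ) → f y = p.eval y}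
  zero_mem' := by
    intro i
    refine ⟨0, by simp, ?_⟩
    filter_upwards [Lp.coeFn_zero ℝ 2 (dom L)] with y hy _
    rw [hy]
    simp
  add_mem' := by
    intro f g hf hg i
    obtain ⟨p, hp, hfp⟩ := hf i
    obtain ⟨q, hq, hgq⟩ := hg i
    refine ⟨p + q, (Polynomial.natDegree_add_le p q).trans (max_le hp hq), ?_⟩
    filter_upwards [Lp.coeFn_add f g, hfp, hgq] with y hy h1 h2 hmem
    rw [hy, Pi.add_apply, h1 hmem, h2 hmem, Polynomial.eval_add]
  smul_mem' := by
    intro c f hf i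
    obtain ⟨p, hp, hfp⟩ := hf i
    refine ⟨c • p, (Polynomial.natDegree_smul_le c p).trans hp, ?_⟩
    filter_upwards [Lp.coeFn_smul c f, hfp] with y hy h1 hmem
    rw [hy, Pi.smul_apply, h1 hmem, Polynomial.eval_smul]

/-- The continuous elements of degree `r`, with the clamped boundary condition:
the `v ∈ H¹₀(Ω)` that are polynomials of degree at most `r` on each element. -/
def Vh (L : ℝ) {n : ℕ} (x : Fin (n + 1) → ℝ) (r : ℕ) : Submodule ℝ (Hk L 1) where
  carrier := {v | v ∈ H01 L ∧ (fn v) ∈ piecewisePoly L x r}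
  zero_mem' := ⟨(H01 L).zero_mem, (piecewisePoly L x r).zero_mem⟩
  add_mem' := fun hu hv =>
    ⟨(H01 L).add_mem hu.1 hv.1, (piecewisePoly L x r).add_mem hu.2 hv.2⟩
  smul_mem' := fun c _ hu =>
    ⟨(H01 L).smul_mem c hu.1, (piecewisePoly L x r).smul_mem c hu.2⟩

/-- The discontinuous elements of degree `r - 1` (used for `r ≥ 1`). -/
def Qh (L : ℝ) {n : ℕ} (x : Fin (n + 1) → ℝ) (r : ℕ) : Submodule ℝ (L2 L) :=
  piecewisePoly L x (r - 1)

/-- The form `a((θ,w);(η,v)) = (Î θ', η')`. -/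
def formA (L : ℝ) (I : ℝ → ℝ) (θ η : Hk L 1) : ℝ :=
  ∫ x, I x * der θ x * der η x ∂(dom L)

/-- The form `b((η,v);γ) = (γ, η - v')`. -/
def formB (L : ℝ) (η v : Hk L 1) (γ : L2 L) : ℝ :=
  ∫ x, γ x * ((fn η) x - der v x) ∂(dom L)

/-- The form `(γ/Â, ψ)`. -/
def formC (L : ℝ) (A : ℝ → ℝ) (γ ψ : L2 L) : ℝ :=
  ∫ x, γ x / A x * ψ x ∂(dom L)

/-- The kernel `k(t,s) = Ė(t-s)/E(0)` of a relaxation modulus `E` on `[0,T]`. -/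
def kern (T : ℝ) (E : ℝ → ℝ) (t s : ℝ) : ℝ := derivWithin E (Icc 0 T) (t - s) / E 0

/-- `(θ, w, γ) ∈ L¹_𝒥(V × V × Q)`, `𝒥 = [0,T]`, solves the mixed viscoelastic Timoshenko problem
with load `q`, tested against `V × V × Q`. The continuous problem is the case
`V = H¹₀(Ω)`, `Q = L²(Ω)`; the semi-discrete one is the case `V = V_h`, `Q = Q_h`. -/
structure IsMixedSolution (L T : ℝ) (E I A : ℝ → ℝ) (lam : ℝ) (q : ℝ → L2 L)
    (V : Submodule ℝ (Hk L 1)) (Q : Submodule ℝ (L2 L))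
    (θ w : ℝ → Hk L 1) (γ : ℝ → L2 L) : Prop where
  integrable_θ : IntegrableOn θ (Icc 0 T)
  integrable_w : IntegrableOn w (Icc 0 T)
  integrable_γ : IntegrableOn γ (Icc 0 T)
  mem : ∀ᵐ t ∂(volume.restrict (Icc 0 T)), θ t ∈ V ∧ w t ∈ V ∧ γ t ∈ Q
  equilibrium : ∀ᵐ t ∂(volume.restrict (Icc 0 T)), ∀ η ∈ V, ∀ v ∈ V,
    formA L I (θ t) η + formB L η v (γ t) =
      (∫ x, q t x * (fn v) x ∂(dom L)) +
        ∫ s in (0 : ℝ)..t, kern T E t s * (formA L I (θ s) η + formB L η v (γ s))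
  shear : ∀ᵐ t ∂(volume.restrict (Icc 0 T)), ∀ ψ ∈ Q,
    formB L (θ t) (w t) ψ - lam * formC L A (γ t) ψ = 0

/-- `f` is of class `C^r` on `[0,L]`, with derivatives up to order `r` bounded by `M`. -/
def SmoothBound (L : ℝ) (r : ℕ) (M : ℝ) (f : ℝ → ℝ) : Prop :=
  ContDiffOn ℝ r f (Icc 0 L) ∧
    ∀ j ≤ r, ∀ x ∈ Icc 0 L, |iteratedDerivWithin j f (Icc 0 L) x| ≤ M

end Timoshenko

end

/-! Time and space separate. The memory term applies one convolution to the whole tested left-hand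
side, in the exact and in the discrete problem alike. Let `p` solve the Volterra equation `p = q + k
* p` in `H^r(Ω)`, with `k` the normalised relaxation rate. The difference between the left-hand side
at time `t` and the load `p t`, both tested, satisfies a homogeneous Volterra equation and hence
vanishes. So for almost every `t` both solutions solve elastic problems with the same load `p t`
(`IsMixedSolution.ae_isStaticMixed`), and Gronwall bounds the `L¹`-in-time norm of `p` by `exp (K *
T)` times that of `q`. A static estimate, uniform in `lam`, is all that remains.

In one dimension `u ↦ u'` identifies `H¹₀` with the mean-zero functions of `L²`, and `V_h` with the
mean-zero functions of `Q_h`. Written for `θ'`, `w'`, `γ`, the exact and discrete problems are one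
problem on a subspace `S`, with `S = ⊤` or `S = Q_h` (`IsStaticSolution`). Equilibrium of forces
fixes `γ` up to a constant `κ`, so what is left is a saddle point problem with a scalar multiplier.
In `saddle_bound` the thickness enters only as a nonnegative term `b * κ ^ 2`, which may be dropped:
there is no locking. This yields quasi-optimality (`static_error`). Integrating the equations
successively shows that `θ'`, `w'`, `γ` have `r` bounded derivatives (`exists_regularity`), and
Taylor polynomials on the elements give the rate `h ^ r`.

The scalar inf-sup condition needs a bounded mean-zero `H ∈ S` with prescribed first moment. If `r ≥
2`, linear functions supply it; if `r = 1`, a step function at a node in the middle half of the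
domain does. If there is no such node then `h ≥ L / 2`, and a bound of `γ_h` by the size of `γ`
suffices. It follows from a sign argument (`norm_discrete_shear_sub_le`). -/

noncomputable section

namespace Timoshenko

open Filter Topology

section Primitives

variable {L : ℝ}

/-! ### Functions of `L²(Ω)` and their primitives -/

theorem inner_eq_integral (f g : L2 L) : inner ℝ f g = ∫ x, f x * g x ∂(dom L) := by
  rw [L2.inner_def]
  refine integral_congr_ae (Eventually.of_forall fun x => ?_)
  simp [mul_comm]

theorem integrable_coeFn (f : L2 L) : Integrable f (dom L) :=
  (Lp.memLp f).integrable (by norm_num)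

theorem integrable_coeFn_mul (f g : L2 L) : Integrable (fun x => f x * g x) (dom L) :=
  (Lp.memLp f).integrable_mul (Lp.memLp g)

/-- The constant function `1`. -/
def one (L : ℝ) : L2 L := (memLp_const (1 : ℝ)).toLp (fun _ => (1 : ℝ))

theorem coeFn_one : one L =ᵐ[dom L] fun _ => (1 : ℝ) := MemLp.coeFn_toLp _

theorem inner_one (f : L2 L) : inner ℝ f (one L) = ∫ x, f x ∂(dom L) := by
  rw [inner_eq_integral]
  refine integral_congr_ae ?_
  filter_upwards [coeFn_one (L := L)] with x hx
  rw [hx, mul_one]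

theorem integral_dom_const (hL : 0 ≤ L) (c : ℝ) : ∫ _, c ∂(dom L) = L * c := by
  simp [Measure.real, hL]

theorem norm_one_sq (hL : 0 ≤ L) : ‖one L‖ ^ 2 = L := by
  rw [← real_inner_self_eq_norm_sq, inner_one, integral_congr_ae coeFn_one,
    integral_dom_const hL, mul_one]

theorem norm_one_eq (hL : 0 ≤ L) : ‖one L‖ = √L := by
  rw [← norm_one_sq hL, Real.sqrt_sq (norm_nonneg _), norm_one_sq hL]

theorem norm_sq_eq_integral (f : L2 L) : ‖f‖ ^ 2 = ∫ x, f x ^ 2 ∂(dom L) := by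
  rw [← real_inner_self_eq_norm_sq, inner_eq_integral]
  simp only [sq]

theorem norm_le_of_ae_bound (hL : 0 ≤ L) {f : L2 L} {K : ℝ} (hK : 0 ≤ K)
    (h : ∀ᵐ x ∂(dom L), |f x| ≤ K) : ‖f‖ ≤ √L * K := by
  have h1 : ‖f‖ ^ 2 ≤ (√L * K) ^ 2 := by
    rw [norm_sq_eq_integral, mul_pow, Real.sq_sqrt hL, ← integral_dom_const hL]
    refine integral_mono_ae (Lp.memLp f).integrable_sq (integrable_const _) ?_
    filter_upwards [h] with x hx
    exact sq_le_sq' (abs_le.1 hx).1 (abs_le.1 hx).2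
  exact (pow_le_pow_iff_left₀ (norm_nonneg _) (by positivity) two_ne_zero).1 h1

theorem integral_abs_le (hL : 0 ≤ L) (f : L2 L) : ∫ x, |f x| ∂(dom L) ≤ √L * ‖f‖ := by
  have h : MemLp (fun x => |f x|) 2 (dom L) := (Lp.memLp f).abs
  have h1 : ∫ x, |f x| ∂(dom L) = inner ℝ (h.toLp _) (one L) := by
    rw [inner_one]
    exact (integral_congr_ae h.coeFn_toLp).symm
  have h2 : ‖h.toLp _‖ = ‖f‖ := by
    rw [Lp.norm_toLp, Lp.norm_def]
    simp only [← Real.norm_eq_abs, eLpNorm_norm]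
  rw [h1]
  refine (real_inner_le_norm _ _).trans ?_
  rw [h2, norm_one_eq hL, mul_comm]

/-- The primitive of `f` on `Ω` that vanishes at `0`. -/
def prim (L : ℝ) (f : ℝ → ℝ) (x : ℝ) : ℝ := ∫ y in (0 : ℝ)..x, f y ∂(dom L)

theorem prim_congr {f g : ℝ → ℝ} (h : f =ᵐ[dom L] g) : prim L f = prim L g := by
  funext x
  exact intervalIntegral.integral_congr_ae (h.mono fun y hy _ => hy)

theorem continuous_prim {f : ℝ → ℝ} (hf : Integrable f (dom L)) : Continuous (prim L f) :=
  hf.continuous_primitive 0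

theorem prim_zero (f : ℝ → ℝ) : prim L f 0 = 0 := intervalIntegral.integral_same

theorem prim_eq_intervalIntegral {f : ℝ → ℝ} {x : ℝ} (hx : x ∈ Icc 0 L) :
    prim L f x = ∫ y in (0 : ℝ)..x, f y := by
  rw [prim, intervalIntegral.integral_of_le hx.1, intervalIntegral.integral_of_le hx.1,
    integral_Ioc_eq_integral_Ioo, integral_Ioc_eq_integral_Ioo,
    Measure.restrict_restrict measurableSet_Ioo,
    inter_eq_left.2 (Ioo_subset_Ioo_right hx.2)]

theorem prim_last (hL : 0 ≤ L) (f : ℝ → ℝ) : prim L f L = ∫ x, f x ∂(dom L) := by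
  rw [prim_eq_intervalIntegral ⟨hL, le_rfl⟩, intervalIntegral.integral_of_le hL,
    integral_Ioc_eq_integral_Ioo]

theorem prim_eq_setIntegral {f : ℝ → ℝ} {x : ℝ} (hx : x ∈ Ioo 0 L) :
    prim L f x = ∫ y in Iic x, f y ∂(dom L) := by
  rw [prim, intervalIntegral.integral_of_le hx.1.le, Measure.restrict_restrict measurableSet_Ioc,
    Measure.restrict_restrict measurableSet_Iic]
  congr 2
  ext y
  simp only [mem_inter_iff, mem_Ioc, mem_Ioo, mem_Iic]
  grind

theorem abs_prim_le {f : ℝ → ℝ} (hf : Integrable f (dom L)) (x : ℝ) :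
    |prim L f x| ≤ ∫ y, |f y| ∂(dom L) := by
  have h := intervalIntegral.norm_integral_le_integral_norm_uIoc (f := f) (a := 0) (b := x)
    (μ := dom L)
  refine h.trans ?_
  exact setIntegral_le_integral hf.norm (Eventually.of_forall fun y => abs_nonneg _)

theorem abs_prim_coeFn_le (hL : 0 ≤ L) (f : L2 L) (x : ℝ) : |prim L f x| ≤ √L * ‖f‖ :=
  (abs_prim_le (integrable_coeFn f) x).trans (integral_abs_le hL f)

/-- Integration by parts for the primitives that vanish at `0`. -/
theorem integral_prim_mul_add {f g : ℝ → ℝ} (hf : Integrable f (dom L))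
    (hg : Integrable g (dom L)) :
    ∫ x, prim L f x * g x ∂(dom L) + ∫ x, f x * prim L g x ∂(dom L)
      = (∫ x, f x ∂(dom L)) * ∫ x, g x ∂(dom L) := by
  -- Fubini: the two terms are the integrals of `f p.1 * g p.2` over the triangle `p.1 ≤ p.2` and
  -- over its complement.
  have hfg : Integrable (fun p : ℝ × ℝ => f p.1 * g p.2) ((dom L).prod (dom L)) := hf.mul_prod hg
  have hS : MeasurableSet {p : ℝ × ℝ | p.1 ≤ p.2} := measurableSet_le measurable_fst measurable_snd
  have key : ∫ x, prim L f x * g x ∂(dom L)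
      = ∫ p in {p : ℝ × ℝ | p.1 ≤ p.2}, f p.1 * g p.2 ∂((dom L).prod (dom L)) := by
    rw [← integral_indicator hS, integral_prod_symm _ (hfg.indicator hS)]
    refine integral_congr_ae ?_
    filter_upwards [ae_restrict_mem measurableSet_Ioo] with y hy
    rw [prim_eq_setIntegral hy, ← integral_indicator measurableSet_Iic, ← integral_mul_const]
    refine integral_congr_ae (Eventually.of_forall fun x => ?_)
    by_cases hxy : x ≤ y <;> simp [indicator, hxy]
  have key' : ∫ x, f x * prim L g x ∂(dom L)
      = ∫ p in {p : ℝ × ℝ | p.1 ≤ p.2}ᶜ, f p.1 * g p.2 ∂((dom L).prod (dom L)) := by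
    rw [← integral_indicator hS.compl, integral_prod _ (hfg.indicator hS.compl)]
    refine integral_congr_ae ?_
    filter_upwards [ae_restrict_mem measurableSet_Ioo] with x hx
    -- The complementary triangle excludes the diagonal, a null set in each slice.
    rw [prim_eq_setIntegral hx, integral_Iic_eq_integral_Iio,
      ← integral_indicator measurableSet_Iio, ← integral_const_mul]
    refine integral_congr_ae (Eventually.of_forall fun y => ?_)
    by_cases hxy : x ≤ y
    · simp [indicator, hxy]
    · simp [indicator, hxy, not_le.1 hxy]
  rw [key, key', integral_add_compl hS hfg, integral_prod_mul]

theorem memLp_prim {f : ℝ → ℝ} (hf : Integrable f (dom L)) : MemLp (prim L f) 2 (dom L) :=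
  MemLp.of_bound (continuous_prim hf).aestronglyMeasurable _
    (Eventually.of_forall fun x => abs_prim_le hf x)

/-- The operator of `L²(Ω)` that maps a function to its primitive. -/
def J (L : ℝ) : L2 L →ₗ[ℝ] L2 L where
  toFun f := (memLp_prim (integrable_coeFn f)).toLp _
  map_add' f g := by
    rw [← MemLp.toLp_add]
    refine MemLp.toLp_congr _ _ (Eventually.of_forall fun x => ?_)
    rw [prim_congr (Lp.coeFn_add f g)]
    exact intervalIntegral.integral_add (integrable_coeFn f).intervalIntegrable
      (integrable_coeFn g).intervalIntegrable
  map_smul' c f := by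
    rw [RingHom.id_apply, ← MemLp.toLp_const_smul]
    refine MemLp.toLp_congr _ _ (Eventually.of_forall fun x => ?_)
    rw [prim_congr (Lp.coeFn_smul c f)]
    exact intervalIntegral.integral_smul c _

theorem coeFn_J (f : L2 L) : J L f =ᵐ[dom L] prim L f :=
  (memLp_prim (integrable_coeFn f)).coeFn_toLp

theorem norm_J_le (hL : 0 ≤ L) (f : L2 L) : ‖J L f‖ ≤ L * ‖f‖ := by
  have h : ‖J L f‖ ≤ √L * (√L * ‖f‖) := by
    refine norm_le_of_ae_bound hL (by positivity) ?_
    filter_upwards [coeFn_J f] with x hx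
    rw [hx]
    exact abs_prim_coeFn_le hL f x
  rwa [← mul_assoc, Real.mul_self_sqrt hL] at h

/-- `J` is skew-adjoint up to a rank-one term, which disappears as soon as one argument has mean
zero. Most later integrations by parts are this identity. -/
theorem inner_J_add (f g : L2 L) :
    inner ℝ (J L f) g + inner ℝ f (J L g) = inner ℝ f (one L) * inner ℝ g (one L) := by
  rw [inner_one, inner_one, ← integral_prim_mul_add (integrable_coeFn f) (integrable_coeFn g),
    inner_eq_integral, inner_eq_integral]
  congr 1
  · refine integral_congr_ae ?_
    filter_upwards [coeFn_J f] with x hx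
    rw [hx]
  · refine integral_congr_ae ?_
    filter_upwards [coeFn_J g] with x hx
    rw [hx]

/-- Multiplication by `a`, as a map of `L²(Ω)`; it is used for functions `a` that are continuous on
`[0, L]`. -/
def mulL (L : ℝ) (a : ℝ → ℝ) (f : L2 L) : L2 L :=
  open Classical in if h : MemLp (fun x => a x * f x) 2 (dom L) then h.toLp _ else 0

theorem memLp_mul {a : ℝ → ℝ} (ha : ContinuousOn a (Icc 0 L)) (f : L2 L) :
    MemLp (fun x => a x * f x) 2 (dom L) := by
  obtain ⟨K, hK⟩ := isCompact_Icc.exists_bound_of_continuousOn ha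
  have ham : AEStronglyMeasurable a (dom L) :=
    (ha.mono Ioo_subset_Icc_self).aestronglyMeasurable measurableSet_Ioo
  refine MemLp.of_le_mul (c := K) (Lp.memLp f) (ham.mul (Lp.aestronglyMeasurable f)) ?_
  filter_upwards [ae_restrict_mem measurableSet_Ioo] with x hx
  rw [norm_mul]
  exact mul_le_mul_of_nonneg_right (hK x (Ioo_subset_Icc_self hx)) (norm_nonneg _)

theorem coeFn_mulL {a : ℝ → ℝ} (ha : ContinuousOn a (Icc 0 L)) (f : L2 L) :
    mulL L a f =ᵐ[dom L] fun x => a x * f x := by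
  rw [mulL, dif_pos (memLp_mul ha f)]
  exact MemLp.coeFn_toLp _

theorem inner_mulL {a : ℝ → ℝ} (ha : ContinuousOn a (Icc 0 L)) (f g : L2 L) :
    inner ℝ (mulL L a f) g = ∫ x, a x * f x * g x ∂(dom L) := by
  rw [inner_eq_integral]
  refine integral_congr_ae ?_
  filter_upwards [coeFn_mulL ha f] with x hx
  rw [hx]

theorem mulL_add {a : ℝ → ℝ} (ha : ContinuousOn a (Icc 0 L)) (f g : L2 L) :
    mulL L a (f + g) = mulL L a f + mulL L a g := by
  refine Lp.ext ?_
  filter_upwards [coeFn_mulL ha (f + g), coeFn_mulL ha f, coeFn_mulL ha g, Lp.coeFn_add f g,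
    Lp.coeFn_add (mulL L a f) (mulL L a g)] with x h1 h2 h3 h4 h5
  rw [h1, h5, Pi.add_apply, h2, h3, h4, Pi.add_apply, mul_add]

theorem mulL_smul {a : ℝ → ℝ} (ha : ContinuousOn a (Icc 0 L)) (c : ℝ) (f : L2 L) :
    mulL L a (c • f) = c • mulL L a f := by
  refine Lp.ext ?_
  filter_upwards [coeFn_mulL ha (c • f), coeFn_mulL ha f, Lp.coeFn_smul c f,
    Lp.coeFn_smul c (mulL L a f)] with x h1 h2 h3 h4
  rw [h1, h4, Pi.smul_apply, h2, h3, Pi.smul_apply, smul_eq_mul, smul_eq_mul]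
  ring

/-- Multiplication by a continuous function, as a linear map of `L²(Ω)`. -/
def mulLin {a : ℝ → ℝ} (ha : ContinuousOn a (Icc 0 L)) : L2 L →ₗ[ℝ] L2 L where
  toFun := mulL L a
  map_add' := mulL_add ha
  map_smul' := mulL_smul ha

theorem norm_mulL_le {a : ℝ → ℝ} (ha : ContinuousOn a (Icc 0 L)) {K : ℝ}
    (hK : ∀ x ∈ Icc 0 L, |a x| ≤ K) (f : L2 L) : ‖mulL L a f‖ ≤ K * ‖f‖ := by
  refine Lp.norm_le_mul_norm_of_ae_le_mul ?_
  filter_upwards [coeFn_mulL ha f, ae_restrict_mem measurableSet_Ioo] with x hx hm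
  rw [hx, norm_mul]
  exact mul_le_mul_of_nonneg_right (hK x (Ioo_subset_Icc_self hm)) (norm_nonneg _)

theorem le_inner_mulL_self {a : ℝ → ℝ} (ha : ContinuousOn a (Icc 0 L)) {c : ℝ}
    (hc : ∀ x ∈ Icc 0 L, c ≤ a x) (f : L2 L) : c * ‖f‖ ^ 2 ≤ inner ℝ (mulL L a f) f := by
  rw [inner_mulL ha, norm_sq_eq_integral, ← integral_const_mul]
  refine integral_mono_ae ((Lp.memLp f).integrable_sq.const_mul c) ?_ ?_
  · refine (integrable_coeFn_mul (mulL L a f) f).congr ?_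
    filter_upwards [coeFn_mulL ha f] with x hx
    rw [hx]
  · filter_upwards [ae_restrict_mem measurableSet_Ioo] with x hm
    have := hc x (Ioo_subset_Icc_self hm)
    nlinarith [sq_nonneg (f x)]

end Primitives

section WeakDerivatives

variable {L : ℝ}

/-! ### Weak derivatives in one dimension -/

theorem integral_dom_of_tsupport_subset {φ : ℝ → ℝ} (hs : tsupport φ ⊆ Ioo 0 L) (f : ℝ → ℝ) :
    ∫ x, f x * φ x ∂(dom L) = ∫ x, f x * φ x := by
  refine setIntegral_eq_integral_of_forall_compl_eq_zero fun x hx => ?_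
  rw [image_eq_zero_of_notMem_tsupport fun h => hx (hs h), mul_zero]

theorem ae_eq_zero_of_forall_test {a b : ℝ} {f : ℝ → ℝ} (hf : IntegrableOn f (Ioo a b))
    (h : ∀ φ : ℝ → ℝ, ContDiff ℝ ∞ φ → HasCompactSupport φ → tsupport φ ⊆ Ioo a b →
      ∫ x, f x * φ x = 0) : ∀ᵐ x, x ∈ Ioo a b → f x = 0 := by
  refine IsOpen.ae_eq_zero_of_integral_contDiff_smul_eq_zero isOpen_Ioo
    hf.locallyIntegrableOn fun φ hφ hc hs => ?_
  simp only [smul_eq_mul, mul_comm (φ _)]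
  exact h φ hφ hc hs

theorem prim_deriv_of_tsupport_subset {φ : ℝ → ℝ} (hφ : ContDiff ℝ ∞ φ)
    (hs : tsupport φ ⊆ Ioo 0 L) {x : ℝ} (hx : x ∈ Icc 0 L) : prim L (deriv φ) x = φ x := by
  have h0 : φ 0 = 0 := image_eq_zero_of_notMem_tsupport fun h => lt_irrefl _ (hs h).1
  rw [prim_eq_intervalIntegral hx, intervalIntegral.integral_deriv_eq_sub, h0, sub_zero]
  · exact fun y _ => (hφ.differentiable (by simp)).differentiableAt
  · exact (hφ.continuous_deriv (by simp)).intervalIntegrable _ _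

theorem isWeakDeriv_J (g : L2 L) (c : ℝ) : IsWeakDeriv L (J L g + c • one L) g := by
  intro φ hφ hc hs
  have hφ' : Integrable (deriv φ) (dom L) :=
    ((hφ.continuous_deriv (by simp)).integrable_of_hasCompactSupport hc.deriv).restrict
  by_cases hL : 0 ≤ L
  · have hz : ∫ x, deriv φ x ∂(dom L) = 0 := by
      rw [← prim_last hL, prim_deriv_of_tsupport_subset hφ hs ⟨hL, le_rfl⟩]
      exact image_eq_zero_of_notMem_tsupport fun h => lt_irrefl _ (hs h).2
    have key := integral_prim_mul_add (integrable_coeFn g) hφ'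
    rw [hz, mul_zero] at key
    have h1 : ∫ x, g x * prim L (deriv φ) x ∂(dom L) = ∫ x, g x * φ x ∂(dom L) := by
      refine integral_congr_ae ?_
      filter_upwards [ae_restrict_mem measurableSet_Ioo] with x hx
      rw [prim_deriv_of_tsupport_subset hφ hs (Ioo_subset_Icc_self hx)]
    have h2 : ∫ x, (J L g + c • one L : L2 L) x * deriv φ x ∂(dom L)
        = ∫ x, (prim L g x * deriv φ x + c * deriv φ x) ∂(dom L) := by
      refine integral_congr_ae ?_
      filter_upwards [Lp.coeFn_add (J L g) (c • one L), Lp.coeFn_smul c (one L), coeFn_one,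
        coeFn_J g] with x h3 h4 h5 h6
      rw [h3, Pi.add_apply, h4, Pi.smul_apply, h5, h6, smul_eq_mul, mul_one, add_mul]
    rw [h2, integral_add, integral_const_mul, hz, ← h1]
    · linarith
    · refine hφ'.bdd_mul (c := ∫ y, |g y| ∂(dom L))
        (continuous_prim (integrable_coeFn g)).aestronglyMeasurable ?_
      exact Eventually.of_forall (abs_prim_le (integrable_coeFn g))
    · exact hφ'.const_mul c
  · simp [dom, Ioo_eq_empty_of_le (not_le.1 hL).le]

/-- Mean zero makes the primitive started at the left end of the support vanish again beyond its
right end. -/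
theorem exists_test_primitive {ψ : ℝ → ℝ} (hψ : ContDiff ℝ ∞ ψ)
    (hc : HasCompactSupport ψ) (hs : tsupport ψ ⊆ Ioo 0 L) (hz : ∫ x, ψ x = 0) :
    ∃ φ : ℝ → ℝ, ContDiff ℝ ∞ φ ∧ HasCompactSupport φ ∧ tsupport φ ⊆ Ioo 0 L ∧ deriv φ = ψ := by
  rcases (tsupport ψ).eq_empty_or_nonempty with he | hne
  · refine ⟨0, contDiff_const, HasCompactSupport.zero, by simp [tsupport], ?_⟩
    rw [tsupport_eq_empty_iff] at he
    rw [he]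
    exact deriv_zero
  obtain ⟨a, ha, hal⟩ := hc.isCompact.exists_isLeast hne
  obtain ⟨b, hb, hbl⟩ := hc.isCompact.exists_isGreatest hne
  have hout : ∀ x, x ∉ Icc a b → ψ x = 0 := fun x hx =>
    image_eq_zero_of_notMem_tsupport fun h => hx ⟨hal h, hbl h⟩
  have hint : Integrable ψ := hψ.continuous.integrable_of_hasCompactSupport hc
  have hderiv : ∀ x, HasDerivAt (fun x => ∫ y in a..x, ψ y) (ψ x) x := fun x =>
    intervalIntegral.integral_hasDerivAt_right (hψ.continuous.intervalIntegrable _ _)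
      (hψ.continuous.stronglyMeasurableAtFilter _ _) hψ.continuous.continuousAt
  have hd : deriv (fun x => ∫ y in a..x, ψ y) = ψ := funext fun x => (hderiv x).deriv
  have hsupp : tsupport (fun x => ∫ y in a..x, ψ y) ⊆ Icc a b := by
    refine closure_minimal (fun x hx => ?_) isClosed_Icc
    by_contra hxab
    refine hx ?_
    rcases lt_or_ge x a with hxa | hxa
    · change ∫ y in a..x, ψ y = 0
      rw [intervalIntegral.integral_symm, intervalIntegral.integral_of_le hxa.le,
        integral_Ioc_eq_integral_Ioo, setIntegral_eq_zero_of_forall_eq_zero, neg_zero]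
      exact fun y hy => hout y fun h => absurd h.1 (not_le.2 hy.2)
    · have hxb : b < x := by
        by_contra hxb
        exact hxab ⟨hxa, not_lt.1 hxb⟩
      change ∫ y in a..x, ψ y = 0
      rw [intervalIntegral.integral_of_le hxa, ← integral_Icc_eq_integral_Ioc,
        setIntegral_eq_integral_of_forall_compl_eq_zero, hz]
      exact fun y hy => hout y fun h => hy ⟨h.1, h.2.trans hxb.le⟩
  refine ⟨fun x => ∫ y in a..x, ψ y, ?_, ?_, ?_, hd⟩
  · rw [contDiff_infty_iff_deriv, hd]
    exact ⟨fun x => (hderiv x).differentiableAt, hψ⟩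
  · exact isCompact_Icc.of_isClosed_subset (isClosed_tsupport _) hsupp
  · exact hsupp.trans (Icc_subset_Ioo (hs ha).1 (hs hb).2)

theorem exists_test_integral_eq_one (hL : 0 < L) :
    ∃ χ : ℝ → ℝ, ContDiff ℝ ∞ χ ∧ HasCompactSupport χ ∧ tsupport χ ⊆ Ioo 0 L ∧ ∫ x, χ x = 1 := by
  let f : ContDiffBump (L / 2) := ⟨L / 8, L / 4, by linarith, by linarith⟩
  refine ⟨f.normed volume, f.contDiff_normed, f.hasCompactSupport_normed, ?_, f.integral_normed⟩
  rw [f.tsupport_normed_eq, Real.closedBall_eq_Icc]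
  refine Icc_subset_Ioo ?_ ?_ <;> simp only [f] <;> linarith

/-- The du Bois-Reymond lemma. `d = u - J L g` annihilates derivatives of test functions. For any
test function `ψ`, the function `ψ - (∫ ψ) χ` has mean zero and so is such a derivative; hence `d -
∫ d χ` annihilates every `ψ`. -/
theorem IsWeakDeriv.exists_eq (hL : 0 < L) {u g : L2 L} (h : IsWeakDeriv L u g) :
    ∃ c : ℝ, u = J L g + c • one L := by
  obtain ⟨χ, hχ, hχc, hχs, hχ1⟩ := exists_test_integral_eq_one hL
  set d : L2 L := u - J L g with hd
  have hd0 : ∀ φ : ℝ → ℝ, ContDiff ℝ ∞ φ → HasCompactSupport φ → tsupport φ ⊆ Ioo 0 L →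
      ∫ x, d x * deriv φ x ∂(dom L) = 0 := by
    have : IsWeakDeriv L d 0 := by
      have h1 := h.add ((isWeakDeriv_J g 0).smul (-1))
      have h2 : u + (-1 : ℝ) • (J L g + (0 : ℝ) • one L) = d := by rw [hd]; module
      have h3 : g + (-1 : ℝ) • g = 0 := by module
      rwa [h2, h3] at h1
    intro φ hφ hc hs
    rw [this φ hφ hc hs, neg_eq_zero]
    refine integral_eq_zero_of_ae ?_
    filter_upwards [Lp.coeFn_zero ℝ 2 (dom L)] with x hx
    rw [hx]
    simp
  refine ⟨∫ x, d x * χ x, ?_⟩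
  set c := ∫ x, d x * χ x with hcdef
  have hdint : IntegrableOn d (Ioo 0 L) := integrable_coeFn d
  have hae : ∀ᵐ x, x ∈ Ioo 0 L → d x - c = 0 := by
    refine ae_eq_zero_of_forall_test (hdint.sub (integrable_const _)) fun ψ hψ hc hs => ?_
    have hψi : Integrable ψ := hψ.continuous.integrable_of_hasCompactSupport hc
    have hχi : Integrable χ := hχ.continuous.integrable_of_hasCompactSupport hχc
    have hsub : tsupport (fun x => ψ x - (∫ y, ψ y) * χ x) ⊆ Ioo 0 L := by
      refine (tsupport_sub _ _).trans (union_subset hs ?_)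
      exact (tsupport_mul_subset_right).trans hχs
    obtain ⟨φ, hφ, hφc, hφs, hφd⟩ := exists_test_primitive
      (ψ := fun x => ψ x - (∫ y, ψ y) * χ x) (hψ.sub (contDiff_const.mul hχ))
      (hc.sub hχc.mul_left) hsub (by
        rw [integral_sub hψi (hχi.const_mul _), integral_const_mul, hχ1, mul_one, sub_self])
    have h1 := hd0 φ hφ hφc hφs
    rw [hφd, integral_dom_of_tsupport_subset hsub] at h1
    have hi1 : Integrable (fun x => d x * ψ x) := by
      have := integrable_mul_test d hψ.continuous hc
      rwa [← IntegrableOn, integrableOn_iff_integrable_of_support_subset] at this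
      exact fun x hx => hs (subset_tsupport _ (right_ne_zero_of_mul hx))
    have hi2 : Integrable (fun x => d x * χ x) := by
      have := integrable_mul_test d hχ.continuous hχc
      rwa [← IntegrableOn, integrableOn_iff_integrable_of_support_subset] at this
      exact fun x hx => hχs (subset_tsupport _ (right_ne_zero_of_mul hx))
    have h2 : ∫ x, d x * (ψ x - (∫ y, ψ y) * χ x)
        = (∫ x, d x * ψ x) - (∫ y, ψ y) * c := by
      rw [hcdef, ← integral_const_mul, ← integral_sub hi1 (hi2.const_mul _)]
      congr 1
      funext x
      ring
    simp only [sub_mul]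
    rw [integral_sub hi1 (hψi.const_mul c), integral_const_mul]
    linarith
  refine Lp.ext ?_
  have hae' : ∀ᵐ x ∂(dom L), d x - c = 0 := (ae_restrict_iff' measurableSet_Ioo).2 hae
  filter_upwards [hae', Lp.coeFn_add (J L g) (c • one L), Lp.coeFn_smul c (one L), coeFn_one,
    Lp.coeFn_sub u (J L g)] with x h1 h2 h3 h4 h5
  rw [h2, Pi.add_apply, h3, Pi.smul_apply, h4, smul_eq_mul, mul_one]
  rw [hd, h5, Pi.sub_apply] at h1
  linarith

theorem isWeakDeriv_der (u : Hk L 1) : IsWeakDeriv L (fn u) (der u) := u.2 0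

theorem ae_eq_prim_add_const (g : L2 L) (c : ℝ) :
    (J L g + c • one L : L2 L) =ᵐ[dom L] fun x => prim L g x + c := by
  filter_upwards [Lp.coeFn_add (J L g) (c • one L), Lp.coeFn_smul c (one L), coeFn_one,
    coeFn_J g] with x h3 h4 h5 h6
  rw [h3, Pi.add_apply, h4, Pi.smul_apply, h5, h6, smul_eq_mul, mul_one]

theorem eqOn_Icc_of_ae_eq (hL : 0 < L) {f g : ℝ → ℝ} (hf : ContinuousOn f (Icc 0 L))
    (hg : ContinuousOn g (Icc 0 L)) (h : f =ᵐ[dom L] g) : EqOn f g (Icc 0 L) := by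
  have h' : f =ᵐ[volume.restrict (Icc 0 L)] g := by
    rwa [dom, restrict_Ioo_eq_restrict_Icc] at h
  exact Measure.eqOn_Icc_of_ae_eq volume hL.ne h' hf hg

/-- The continuous representative is the primitive of the derivative plus a constant. Its value at
`0` is that constant, and its value at `L` then is the mean condition. This removes `H¹₀` in favour
of mean-zero functions of `L²`. -/
theorem mem_H01_iff (hL : 0 < L) (u : Hk L 1) :
    u ∈ H01 L ↔ fn u = J L (der u) ∧ inner ℝ (der u) (one L) = 0 := by
  have hcont : Continuous (prim L (der u)) := continuous_prim (integrable_coeFn _)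
  constructor
  · rintro ⟨f, hf, huf, hf0, hfL⟩
    obtain ⟨c, hc⟩ := (isWeakDeriv_der u).exists_eq hL
    have hae : f =ᵐ[dom L] fun x => prim L (der u) x + c := by
      refine huf.symm.trans ?_
      rw [hc]
      exact ae_eq_prim_add_const _ _
    have heq := eqOn_Icc_of_ae_eq hL hf (hcont.add continuous_const).continuousOn hae
    have h0 := heq ⟨le_rfl, hL.le⟩
    have h1 := heq ⟨hL.le, le_rfl⟩
    simp only [hf0, Pi.add_apply, prim_zero, zero_add] at h0
    subst h0
    simp only [hfL, Pi.add_apply, add_zero, prim_last hL.le] at h1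
    rw [inner_one]
    exact ⟨by rw [hc, zero_smul, add_zero], h1.symm⟩
  · rintro ⟨h1, h2⟩
    refine ⟨prim L (der u), hcont.continuousOn, ?_, prim_zero _, ?_⟩
    · rw [h1]
      exact coeFn_J _
    · rw [prim_last hL.le, ← inner_one, h2]

/-- Every function of mean zero is the derivative of an element of `H¹₀(Ω)`. -/
theorem exists_mem_H01 (hL : 0 < L) {g : L2 L} (hg : inner ℝ g (one L) = 0) :
    ∃ u ∈ H01 L, der u = g ∧ fn u = J L g := by
  have hw : IsWeakDeriv L (J L g) g := by
    have := isWeakDeriv_J g 0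
    rwa [zero_smul, add_zero] at this
  let u : Hk L 1 := ⟨WithLp.toLp 2 ![J L g, g], fun j => by
    fin_cases j
    exact hw⟩
  have hd : der u = g := rfl
  have hf : fn u = J L g := rfl
  refine ⟨u, (mem_H01_iff hL u).2 ?_, hd, hf⟩
  rw [hd, hf]
  exact ⟨rfl, hg⟩

theorem exists_derivative_eq (q : Polynomial ℝ) {m : ℕ} (hq : q.natDegree ≤ m) :
    ∃ p : Polynomial ℝ, p.natDegree ≤ m + 1 ∧ p.derivative = q := by
  refine ⟨∑ i ∈ Finset.range (m + 1), Polynomial.C (q.coeff i / (i + 1)) * Polynomial.X ^ (i + 1),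
    ?_, ?_⟩
  · refine Polynomial.natDegree_sum_le_of_forall_le _ _ fun i hi => ?_
    refine (Polynomial.natDegree_C_mul_X_pow_le _ _).trans ?_
    have := Finset.mem_range.1 hi
    omega
  · rw [Polynomial.derivative_sum]
    conv_rhs => rw [q.as_sum_range_C_mul_X_pow' (Nat.lt_succ_of_le hq)]
    refine Finset.sum_congr rfl fun i _ => ?_
    rw [Polynomial.derivative_C_mul_X_pow]
    have : (i : ℝ) + 1 ≠ 0 := by positivity
    simp [this]

/-- Test functions supported in one element identify the weak derivative there with the derivative
of the polynomial. With the converse `mem_Vh_of_der_mem`, differentiation maps `V_h` onto the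
mean-zero part of `Q_h`. -/
theorem der_mem_of_mem_Vh {n : ℕ} {x : Fin (n + 1) → ℝ} (hx : IsMesh L x) {r : ℕ} {v : Hk L 1}
    (hv : v ∈ Vh L x r) : der v ∈ Qh L x r := by
  intro i
  obtain ⟨p, hp, hvp⟩ := hv.2 i
  have ha : 0 ≤ x i.castSucc := hx.first ▸ hx.strictMono.monotone (Fin.zero_le _)
  have hb : x i.succ ≤ L := hx.last ▸ hx.strictMono.monotone (Fin.le_last _)
  have hsub : Ioo (x i.castSucc) (x i.succ) ⊆ Ioo 0 L := Ioo_subset_Ioo ha hb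
  refine ⟨p.derivative, (p.natDegree_derivative_le).trans (by omega), ?_⟩
  have hvp' := (ae_restrict_iff' measurableSet_Ioo).1 hvp
  have hdint : IntegrableOn (der v) (Ioo 0 L) := integrable_coeFn _
  have hpint : ∀ s : Polynomial ℝ, IntegrableOn (fun y => s.eval y)
      (Ioo (x i.castSucc) (x i.succ)) := fun s =>
    (s.continuous.continuousOn.integrableOn_Icc).mono_set Ioo_subset_Icc_self
  have key : ∀ᵐ y, y ∈ Ioo (x i.castSucc) (x i.succ) → der v y - p.derivative.eval y = 0 := by
    refine ae_eq_zero_of_forall_test ((hdint.mono_set hsub).sub (hpint _))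
      fun φ hφ hc hs => ?_
    have hw := isWeakDeriv_der v φ hφ hc (hs.trans hsub)
    rw [integral_dom_of_tsupport_subset (hs.trans hsub),
      integral_dom_of_tsupport_subset (tsupport_deriv_subset.trans (hs.trans hsub))] at hw
    have hpφ : ∀ (s : Polynomial ℝ) {ψ : ℝ → ℝ}, Continuous ψ → HasCompactSupport ψ →
        Integrable (fun y => s.eval y * ψ y) := fun s ψ hψ hcψ =>
      (s.continuous.mul hψ).integrable_of_hasCompactSupport hcψ.mul_left
    have hφ' : Continuous (deriv φ) := hφ.continuous_deriv (by simp)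
    have h1 := integral_mul_deriv_eq_deriv_mul_of_integrable (u := fun y => p.eval y)
      (u' := fun y => p.derivative.eval y) (v := φ) (v' := deriv φ)
      (fun y _ => p.hasDerivAt y)
      (fun y _ => ((hφ.differentiable (by simp)) y).hasDerivAt)
      (hpφ p hφ' hc.deriv) (hpφ _ hφ.continuous hc) (hpφ p hφ.continuous hc)
    have h2 : ∫ y, fn v y * deriv φ y = ∫ y, p.eval y * deriv φ y := by
      refine integral_congr_ae ?_
      filter_upwards [hvp'] with y hy
      by_cases hm : y ∈ Ioo (x i.castSucc) (x i.succ)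
      · simp only [hy (hsub hm) hm]
      · simp only [image_eq_zero_of_notMem_tsupport
          (fun h => hm (hs (tsupport_deriv_subset h))), mul_zero]
    have hi1 : Integrable (fun y => der v y * φ y) := by
      have := integrable_mul_test (der v) hφ.continuous hc
      rwa [← IntegrableOn, integrableOn_iff_integrable_of_support_subset] at this
      exact fun y hy => hsub (hs (subset_tsupport _ (right_ne_zero_of_mul hy)))
    simp only [sub_mul]
    rw [integral_sub hi1 (hpφ _ hφ.continuous hc)]
    linarith
  refine ae_restrict_of_ae ?_
  filter_upwards [key] with y hy hm
  linarith [hy hm]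

theorem mem_Vh_of_der_mem (hL : 0 < L) {n : ℕ} {x : Fin (n + 1) → ℝ} (hx : IsMesh L x) {r : ℕ}
    (hr : 1 ≤ r) {v : Hk L 1} (hv : v ∈ H01 L) (hd : der v ∈ Qh L x r) : v ∈ Vh L x r := by
  refine ⟨hv, fun i => ?_⟩
  obtain ⟨q, hq, hdq⟩ := hd i
  obtain ⟨p, hp, hpq⟩ := exists_derivative_eq q hq
  set a := x i.castSucc
  set b := x i.succ
  have ha : 0 ≤ a := hx.first ▸ hx.strictMono.monotone (Fin.zero_le _)
  have hb : b ≤ L := hx.last ▸ hx.strictMono.monotone (Fin.le_last _)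
  have hab : a < b := hx.strictMono i.castSucc_lt_succ
  have hdq' := (ae_restrict_iff' measurableSet_Ioo).1 hdq
  -- The constant matches the antiderivative with the primitive of `der v` at the left node;
  -- continuity across nodes is already part of `v ∈ H01 L`.
  refine ⟨p + Polynomial.C (prim L (der v) a - p.eval a), ?_, ?_⟩
  · rw [Polynomial.natDegree_add_C]
    omega
  have hI : ∀ c d : ℝ, IntervalIntegrable (der v) (dom L) c d := fun c d =>
    (integrable_coeFn _).intervalIntegrable
  rw [((mem_H01_iff hL v).1 hv).1]
  filter_upwards [coeFn_J (der v)] with y hy hm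
  have h1 : prim L (der v) y - prim L (der v) a = p.eval y - p.eval a := by
    have h2 : ∫ z in a..y, q.eval z = p.eval y - p.eval a := by
      refine intervalIntegral.integral_eq_sub_of_hasDerivAt (f := fun z => p.eval z)
        (fun z _ => ?_) (q.continuous.intervalIntegrable _ _)
      rw [← hpq]
      exact p.hasDerivAt z
    rw [prim, prim, intervalIntegral.integral_interval_sub_left (hI _ _) (hI _ _), ← h2,
      intervalIntegral.integral_of_le hm.1.le, intervalIntegral.integral_of_le hm.1.le,
      integral_Ioc_eq_integral_Ioo, integral_Ioc_eq_integral_Ioo,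
      Measure.restrict_restrict measurableSet_Ioo,
      inter_eq_left.2 (Ioo_subset_Ioo ha (hm.2.le.trans hb))]
    refine setIntegral_congr_ae measurableSet_Ioo ?_
    filter_upwards [hdq'] with z hz hzm
    exact hz ⟨ha.trans_lt hzm.1, (hzm.2.trans hm.2).trans_le hb⟩ ⟨hzm.1, hzm.2.trans hm.2⟩
  rw [hy, Polynomial.eval_add, Polynomial.eval_C]
  linarith

end WeakDerivatives

section BoundedDerivatives

variable {L : ℝ}

/-! ### Functions with bounded derivatives -/

section SmoothBound

variable {f g : ℝ → ℝ} {n : ℕ} {K K' : ℝ}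

theorem SmoothBound.congr (h : SmoothBound L n K f) (hfg : EqOn g f (Icc 0 L)) :
    SmoothBound L n K g :=
  ⟨h.1.congr hfg, fun j hj x hx => by
    rw [iteratedDerivWithin_congr hfg hx]
    exact h.2 j hj x hx⟩

theorem SmoothBound.mono (h : SmoothBound L n K f) (hK : K ≤ K') : SmoothBound L n K' f :=
  ⟨h.1, fun j hj x hx => (h.2 j hj x hx).trans hK⟩

theorem SmoothBound.of_le {m : ℕ} (h : SmoothBound L n K f) (hm : m ≤ n) : SmoothBound L m K f :=
  ⟨h.1.of_le (by exact_mod_cast hm), fun j hj => h.2 j (hj.trans hm)⟩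

theorem SmoothBound.abs_le (h : SmoothBound L n K f) {x : ℝ} (hx : x ∈ Icc 0 L) : |f x| ≤ K := by
  simpa using h.2 0 (Nat.zero_le _) x hx

theorem SmoothBound.continuousOn (h : SmoothBound L n K f) : ContinuousOn f (Icc 0 L) :=
  h.1.continuousOn

theorem SmoothBound.nonneg (hL : 0 < L) (h : SmoothBound L n K f) : 0 ≤ K :=
  (abs_nonneg _).trans (h.abs_le (left_mem_Icc.2 hL.le))

theorem smoothBound_zero (hf : ContinuousOn f (Icc 0 L)) (hK : ∀ x ∈ Icc 0 L, |f x| ≤ K) :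
    SmoothBound L 0 K f :=
  ⟨by simpa using hf, fun j hj x hx => by
    obtain rfl : j = 0 := by omega
    simpa using hK x hx⟩

/-- The closure properties below peel off one derivative at a time with this equivalence. -/
theorem smoothBound_succ_iff (hL : 0 < L) : SmoothBound L (n + 1) K f ↔
    (∀ x ∈ Icc 0 L, |f x| ≤ K) ∧ DifferentiableOn ℝ f (Icc 0 L) ∧
      SmoothBound L n K (derivWithin f (Icc 0 L)) := by
  have hu := uniqueDiffOn_Icc hL
  unfold SmoothBound
  rw [Nat.cast_add, Nat.cast_one, contDiffOn_succ_iff_derivWithin hu]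
  constructor
  · rintro ⟨⟨hd, -, hc⟩, hb⟩
    refine ⟨fun x hx => by simpa using hb 0 (Nat.zero_le _) x hx, hd, hc, fun j hj x hx => ?_⟩
    rw [← iteratedDerivWithin_succ']
    exact hb (j + 1) (by omega) x hx
  · rintro ⟨h0, hd, hc, hb⟩
    refine ⟨⟨hd, by simp, hc⟩, fun j hj x hx => ?_⟩
    rcases j with _ | j
    · simpa using h0 x hx
    · rw [iteratedDerivWithin_succ']
      exact hb j (by omega) x hx

theorem smoothBound_succ_of_hasDerivWithinAt (hL : 0 < L) {f' : ℝ → ℝ}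
    (h0 : ∀ x ∈ Icc 0 L, |f x| ≤ K)
    (hd : ∀ x ∈ Icc 0 L, HasDerivWithinAt f (f' x) (Icc 0 L) x) (h : SmoothBound L n K f') :
    SmoothBound L (n + 1) K f :=
  (smoothBound_succ_iff hL).2 ⟨h0, fun x hx => (hd x hx).differentiableWithinAt,
    h.congr fun x hx => (hd x hx).derivWithin (uniqueDiffOn_Icc hL x hx)⟩

theorem smoothBound_const (hL : 0 < L) (c : ℝ) : ∀ n, SmoothBound L n |c| (fun _ => c) := by
  have h0 : ∀ n, SmoothBound L n 0 (fun _ => (0 : ℝ)) := by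
    intro n
    induction n with
    | zero => exact smoothBound_zero continuousOn_const (by simp)
    | succ n ih =>
      exact smoothBound_succ_of_hasDerivWithinAt hL (by simp)
        (fun x _ => hasDerivWithinAt_const x _ (0 : ℝ)) ih
  rintro (_ | n)
  · exact smoothBound_zero continuousOn_const (by simp)
  · exact smoothBound_succ_of_hasDerivWithinAt hL (by simp)
      (fun x _ => hasDerivWithinAt_const x _ c) ((h0 n).mono (abs_nonneg c))

theorem SmoothBound.add (hL : 0 < L) (hf : SmoothBound L n K f) (hg : SmoothBound L n K' g) :
    SmoothBound L n (K + K') (fun x => f x + g x) := by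
  induction n generalizing f g with
  | zero =>
    exact smoothBound_zero (hf.continuousOn.add hg.continuousOn) fun x hx =>
      (abs_add_le _ _).trans (add_le_add (hf.abs_le hx) (hg.abs_le hx))
  | succ n ih =>
    obtain ⟨hf0, hfd, hf'⟩ := (smoothBound_succ_iff hL).1 hf
    obtain ⟨hg0, hgd, hg'⟩ := (smoothBound_succ_iff hL).1 hg
    refine smoothBound_succ_of_hasDerivWithinAt hL (fun x hx =>
      (abs_add_le _ _).trans (add_le_add (hf0 x hx) (hg0 x hx))) (fun x hx => ?_) (ih hf' hg')
    exact (hfd x hx).hasDerivWithinAt.add (hgd x hx).hasDerivWithinAt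

/-- The product rule produces two products of one order less, so the constant doubles with each
order. -/
theorem SmoothBound.mul (hL : 0 < L) (hf : SmoothBound L n K f) (hg : SmoothBound L n K' g) :
    SmoothBound L n (2 ^ n * (K * K')) (fun x => f x * g x) := by
  have hK := hf.nonneg hL
  have hK' := hg.nonneg hL
  have hb : ∀ x ∈ Icc 0 L, |f x * g x| ≤ K * K' := fun x hx => by
    rw [abs_mul]
    exact mul_le_mul (hf.abs_le hx) (hg.abs_le hx) (abs_nonneg _) hK
  induction n generalizing f g with
  | zero =>
    exact (smoothBound_zero (hf.continuousOn.mul hg.continuousOn) hb).mono (by simp)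
  | succ n ih =>
    obtain ⟨hf0, hfd, hf'⟩ := (smoothBound_succ_iff hL).1 hf
    obtain ⟨hg0, hgd, hg'⟩ := (smoothBound_succ_iff hL).1 hg
    refine smoothBound_succ_of_hasDerivWithinAt hL (fun x hx => (hb x hx).trans ?_)
      (fun x hx => (hfd x hx).hasDerivWithinAt.mul (hgd x hx).hasDerivWithinAt) ?_
    · exact le_mul_of_one_le_left (by positivity) (one_le_pow₀ (by norm_num))
    · have hbb : ∀ {u v : ℝ → ℝ}, SmoothBound L n K u → SmoothBound L n K' v →
          ∀ x ∈ Icc 0 L, |u x * v x| ≤ K * K' := fun hu hv x hx => by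
        rw [abs_mul]
        exact mul_le_mul (hu.abs_le hx) (hv.abs_le hx) (abs_nonneg _) hK
      have hfn := hf.of_le n.le_succ
      have hgn := hg.of_le n.le_succ
      refine ((ih hf' hgn (hbb hf' hgn)).add hL (ih hfn hg' (hbb hfn hg'))).mono (le_of_eq ?_)
      ring

/-- Induction on `(1/f)' = -f' (1/f)²`, whose right-hand side needs `1/f` only to one order less.
`K` is chosen before `f`, which makes the final constant uniform in the coefficients. -/
theorem exists_smoothBound_inv (hL : 0 < L) (n : ℕ) (M c : ℝ) (hc : 0 < c) :
    ∃ K, 0 ≤ K ∧ ∀ f : ℝ → ℝ, SmoothBound L n M f → (∀ x ∈ Icc 0 L, c ≤ f x) →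
      SmoothBound L n K (fun x => (f x)⁻¹) := by
  have hb : ∀ f : ℝ → ℝ, (∀ x ∈ Icc 0 L, c ≤ f x) → ∀ x ∈ Icc 0 L, |(f x)⁻¹| ≤ c⁻¹ := by
    intro f hf x hx
    rw [abs_inv]
    exact inv_anti₀ hc ((hf x hx).trans (le_abs_self _))
  induction n with
  | zero =>
    refine ⟨c⁻¹, by positivity, fun f hf hfc => smoothBound_zero ?_ (hb f hfc)⟩
    exact hf.continuousOn.inv₀ fun x hx => (hc.trans_le (hfc x hx)).ne'
  | succ n ih =>
    obtain ⟨K, hK, h⟩ := ih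
    refine ⟨max c⁻¹ (2 ^ n * (|-1| * (2 ^ n * (M * (2 ^ n * (K * K)))))),
      le_max_of_le_left (by positivity), fun f hf hfc => ?_⟩
    obtain ⟨-, hfd, hf'⟩ := (smoothBound_succ_iff hL).1 hf
    have hi := h f (hf.of_le n.le_succ) hfc
    refine smoothBound_succ_of_hasDerivWithinAt hL
      (f' := fun x => -1 * (derivWithin f (Icc 0 L) x * ((f x)⁻¹ * (f x)⁻¹)))
      (fun x hx => (hb f hfc x hx).trans (le_max_left _ _)) (fun x hx => ?_) ?_
    · have hd := (hfd x hx).hasDerivWithinAt.fun_inv (hc.trans_le (hfc x hx)).ne'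
      have he : -1 * (derivWithin f (Icc 0 L) x * ((f x)⁻¹ * (f x)⁻¹))
          = -derivWithin f (Icc 0 L) x / f x ^ 2 := by
        rw [div_eq_mul_inv, sq, mul_inv]
        ring
      rw [he]
      exact hd
    · exact ((smoothBound_const hL (-1) n).mul hL (hf'.mul hL (hi.mul hL hi))).mono
        (le_max_right _ _)

theorem hasDerivWithinAt_prim (hf : ContinuousOn f (Icc 0 L)) {x : ℝ}
    (hx : x ∈ Icc 0 L) : HasDerivWithinAt (prim L f) (f x) (Icc 0 L) x := by
  have hI : IntervalIntegrable f volume 0 x :=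
    (hf.mono (by rw [uIcc_of_le hx.1]; exact Icc_subset_Icc_right hx.2)).intervalIntegrable
  have : Fact (x ∈ Icc 0 L) := ⟨hx⟩
  have hd := intervalIntegral.integral_hasDerivWithinAt_right hI (s := Icc 0 L) (t := Icc 0 L)
    (hf.stronglyMeasurableAtFilter_nhdsWithin measurableSet_Icc x) (hf x hx)
  exact hd.congr (fun y hy => prim_eq_intervalIntegral hy) (prim_eq_intervalIntegral hx)

/-- In the factor `L + 1`, the `L` accounts for the values of the primitive and the `1` for its
derivatives. -/
theorem SmoothBound.prim (hL : 0 < L) (hf : SmoothBound L n K f) :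
    SmoothBound L (n + 1) ((L + 1) * K) (prim L f) := by
  have hK := hf.nonneg hL
  have hint : Integrable f (dom L) :=
    (hf.continuousOn.integrableOn_Icc).mono_set Ioo_subset_Icc_self
  refine smoothBound_succ_of_hasDerivWithinAt hL (fun x hx => ?_)
    (fun x hx => hasDerivWithinAt_prim hf.continuousOn hx) (hf.mono (by nlinarith))
  refine (abs_prim_le hint x).trans ?_
  have h : ∫ y, |f y| ∂(dom L) ≤ ∫ _, K ∂(dom L) := by
    refine integral_mono_ae hint.abs (integrable_const _) ?_
    filter_upwards [ae_restrict_mem measurableSet_Ioo] with y hy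
    exact hf.abs_le (Ioo_subset_Icc_self hy)
  rw [integral_dom_const hL.le] at h
  nlinarith

end SmoothBound

/-- `u` has a representative whose derivatives up to order `n` are bounded by `K`. -/
def HasSmoothRep (L : ℝ) (n : ℕ) (K : ℝ) (u : L2 L) : Prop :=
  ∃ f : ℝ → ℝ, SmoothBound L n K f ∧ u =ᵐ[dom L] f

section HasSmoothRep

variable {u v : L2 L} {n : ℕ} {K K' : ℝ}

theorem HasSmoothRep.mono (h : HasSmoothRep L n K u) (hK : K ≤ K') : HasSmoothRep L n K' u := by
  obtain ⟨f, hf, huf⟩ := h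
  exact ⟨f, hf.mono hK, huf⟩

theorem HasSmoothRep.of_le {m : ℕ} (h : HasSmoothRep L n K u) (hm : m ≤ n) :
    HasSmoothRep L m K u := by
  obtain ⟨f, hf, huf⟩ := h
  exact ⟨f, hf.of_le hm, huf⟩

theorem HasSmoothRep.add (hL : 0 < L) (hu : HasSmoothRep L n K u) (hv : HasSmoothRep L n K' v) :
    HasSmoothRep L n (K + K') (u + v) := by
  obtain ⟨f, hf, huf⟩ := hu
  obtain ⟨g, hg, hvg⟩ := hv
  exact ⟨_, hf.add hL hg, (Lp.coeFn_add u v).trans (huf.add hvg)⟩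

theorem hasSmoothRep_smul_one (hL : 0 < L) (c : ℝ) (n : ℕ) : HasSmoothRep L n |c| (c • one L) := by
  refine ⟨_, smoothBound_const hL c n, ?_⟩
  filter_upwards [Lp.coeFn_smul c (one L), coeFn_one] with x h1 h2
  rw [h1, Pi.smul_apply, h2, smul_eq_mul, mul_one]

theorem HasSmoothRep.smul (hL : 0 < L) (c : ℝ) (hu : HasSmoothRep L n K u) :
    HasSmoothRep L n (2 ^ n * (|c| * K)) (c • u) := by
  obtain ⟨f, hf, huf⟩ := hu
  exact ⟨_, (smoothBound_const hL c n).mul hL hf, (Lp.coeFn_smul c u).trans (huf.const_smul c)⟩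

theorem HasSmoothRep.mulL (hL : 0 < L) {a : ℝ → ℝ} (ha : SmoothBound L n K' a)
    (hu : HasSmoothRep L n K u) : HasSmoothRep L n (2 ^ n * (K' * K)) (mulL L a u) := by
  obtain ⟨f, hf, huf⟩ := hu
  refine ⟨_, ha.mul hL hf, ?_⟩
  filter_upwards [coeFn_mulL ha.continuousOn u, huf] with x h1 h2
  rw [h1, h2]

theorem HasSmoothRep.J (hL : 0 < L) (hu : HasSmoothRep L n K u) :
    HasSmoothRep L (n + 1) ((L + 1) * K) (J L u) := by
  obtain ⟨f, hf, huf⟩ := hu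
  refine ⟨_, hf.prim hL, (coeFn_J u).trans ?_⟩
  rw [prim_congr huf]

theorem hasSmoothRep_J_zero (hL : 0 < L) (g : L2 L) :
    HasSmoothRep L 0 (√L * ‖g‖) (J L g) :=
  ⟨prim L g, smoothBound_zero (continuous_prim (integrable_coeFn g)).continuousOn
    fun x _ => abs_prim_coeFn_le hL.le g x, coeFn_J g⟩

end HasSmoothRep

end BoundedDerivatives

section Approximation

variable {L : ℝ} {n : ℕ} {x : Fin (n + 1) → ℝ}

/-! ### Piecewise polynomial approximation -/

theorem IsMesh.castSucc_lt_succ (hx : IsMesh L x) (i : Fin n) : x i.castSucc < x i.succ :=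
  hx.strictMono i.castSucc_lt_succ

theorem IsMesh.nonneg (hx : IsMesh L x) (i : Fin (n + 1)) : 0 ≤ x i :=
  hx.first ▸ hx.strictMono.monotone (Fin.zero_le _)

theorem IsMesh.le_length (hx : IsMesh L x) (i : Fin (n + 1)) : x i ≤ L :=
  hx.last ▸ hx.strictMono.monotone (Fin.le_last _)

theorem IsMesh.element_subset (hx : IsMesh L x) (i : Fin n) :
    Icc (x i.castSucc) (x i.succ) ⊆ Icc 0 L :=
  Icc_subset_Icc (hx.nonneg _) (hx.le_length _)

theorem IsMesh.eq_of_mem (hx : IsMesh L x) {i j : Fin n} {y : ℝ}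
    (hi : y ∈ Ioo (x i.castSucc) (x i.succ)) (hj : y ∈ Ioo (x j.castSucc) (x j.succ)) : i = j := by
  rcases lt_trichotomy i j with h | h | h
  · have := hx.strictMono.monotone (show i.succ ≤ j.castSucc from h)
    exact absurd (hi.2.trans_le this) (not_lt.2 hj.1.le)
  · exact h
  · have := hx.strictMono.monotone (show j.succ ≤ i.castSucc from h)
    exact absurd (hj.2.trans_le this) (not_lt.2 hi.1.le)

theorem IsMesh.ae_exists_mem (hx : IsMesh L x) :
    ∀ᵐ y ∂(dom L), ∃ i : Fin n, y ∈ Ioo (x i.castSucc) (x i.succ) := by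
  have hnull : ∀ᵐ y ∂(dom L), y ∉ range x :=
    (finite_range x).countable.ae_notMem _
  filter_upwards [hnull, ae_restrict_mem measurableSet_Ioo] with y hy hm
  by_contra! hne
  -- If `y` missed every element, induction along the nodes would place all of them, even `L`, to
  -- the left of `y`.
  have hall : ∀ k : Fin (n + 1), x k < y := by
    intro k
    induction k using Fin.induction with
    | zero => rw [hx.first]; exact hm.1
    | succ i ih =>
      by_contra h
      exact hne i ⟨ih, lt_of_le_of_ne (not_lt.1 h) fun he => hy ⟨_, he.symm⟩⟩
  exact absurd (hall (Fin.last n)) (by rw [hx.last]; exact not_lt.2 hm.2.le)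

theorem le_meshSize (x : Fin (n + 1) → ℝ) (i : Fin n) : x i.succ - x i.castSucc ≤ meshSize x :=
  le_ciSup (f := fun i : Fin n => x i.succ - x i.castSucc) (finite_range _).bddAbove i

theorem IsMesh.meshSize_nonneg (hx : IsMesh L x) : 0 ≤ meshSize x :=
  Real.iSup_nonneg fun i => sub_nonneg.2 (hx.castSucc_lt_succ i).le

theorem exists_piecewisePoly (hx : IsMesh L x) {m : ℕ} (P : Fin n → Polynomial ℝ)
    (hP : ∀ i, (P i).natDegree ≤ m) : ∃ p ∈ piecewisePoly L x m,
      ∀ᵐ y ∂(dom L), ∀ i, y ∈ Ioo (x i.castSucc) (x i.succ) → p y = (P i).eval y := by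
  set f : ℝ → ℝ := fun y =>
    ∑ i, (Ioo (x i.castSucc) (x i.succ)).indicator (fun z => (P i).eval z) y with hf
  have hm : MemLp f 2 (dom L) := by
    refine memLp_finsetSum _ fun i _ => MemLp.indicator measurableSet_Ioo ?_
    obtain ⟨C, hC⟩ := isCompact_Icc.exists_bound_of_continuousOn (s := Icc 0 L)
      (P i).continuous.continuousOn
    refine MemLp.of_bound (P i).continuous.aestronglyMeasurable C ?_
    filter_upwards [ae_restrict_mem measurableSet_Ioo] with y hy
    exact hC y (Ioo_subset_Icc_self hy)
  have key : ∀ᵐ y ∂(dom L), ∀ i, y ∈ Ioo (x i.castSucc) (x i.succ) →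
      hm.toLp f y = (P i).eval y := by
    filter_upwards [hm.coeFn_toLp] with y hy i hi
    rw [hy, hf]
    simp only
    rw [Finset.sum_eq_single i, indicator_of_mem hi]
    · intro j _ hji
      exact indicator_of_notMem (fun hj => hji (hx.eq_of_mem hj hi)) _
    · simp
  exact ⟨hm.toLp f, fun i => ⟨P i, hP i, key.mono fun y hy => hy i⟩, key⟩

/-- Taylor expansion at the left end of the element; the gain `1 / m!` in the remainder is thrown
away. -/
theorem exists_taylor_polynomial {a b K : ℝ} {m : ℕ} {f : ℝ → ℝ} (hab : a < b) (ha : 0 ≤ a)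
    (hb : b ≤ L) (hf : SmoothBound L (m + 1) K f) : ∃ p : Polynomial ℝ, p.natDegree ≤ m ∧
      ∀ y ∈ Icc a b, |f y - p.eval y| ≤ K * (b - a) ^ (m + 1) := by
  have hL : 0 < L := by linarith
  have hsub : Icc a b ⊆ Icc 0 L := Icc_subset_Icc ha hb
  have hcd : ContDiffOn ℝ (m + 1) f (Icc 0 L) := by exact_mod_cast hf.1
  refine ⟨∑ k ∈ Finset.range (m + 1), Polynomial.C (((k.factorial : ℝ))⁻¹ *
    iteratedDerivWithin k f (Icc a b) a) * (Polynomial.X - Polynomial.C a) ^ k, ?_, ?_⟩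
  · refine Polynomial.natDegree_sum_le_of_forall_le _ _ fun k hk => ?_
    refine (Polynomial.natDegree_C_mul_le _ _).trans ?_
    refine (Polynomial.natDegree_pow_le).trans ?_
    rw [Polynomial.natDegree_X_sub_C, mul_one]
    exact Nat.lt_succ_iff.1 (Finset.mem_range.1 hk)
  · intro y hy
    -- Taylor's theorem asks for derivatives within the element, `SmoothBound` provides them within
    -- `Icc 0 L`; on the element the two agree.
    have hbd : ∀ z ∈ Icc a b, ‖iteratedDerivWithin (m + 1) f (Icc a b) z‖ ≤ K := by
      intro z hz
      rw [iteratedDerivWithin, iteratedFDerivWithin_subset hsub (uniqueDiffOn_Icc hab)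
        (uniqueDiffOn_Icc hL) hcd hz]
      exact hf.2 (m + 1) le_rfl z (hsub hz)
    have ht := taylor_mean_remainder_bound hab.le (hcd.mono hsub) hy hbd
    rw [taylor_within_apply] at ht
    have hev : Polynomial.eval y (∑ k ∈ Finset.range (m + 1), Polynomial.C (((k.factorial : ℝ))⁻¹ *
        iteratedDerivWithin k f (Icc a b) a) * (Polynomial.X - Polynomial.C a) ^ k)
        = ∑ k ∈ Finset.range (m + 1), (((k.factorial : ℝ))⁻¹ * (y - a) ^ k) •
          iteratedDerivWithin k f (Icc a b) a := by
      rw [Polynomial.eval_finsetSum]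
      refine Finset.sum_congr rfl fun k _ => ?_
      simp only [Polynomial.eval_mul, Polynomial.eval_C, Polynomial.eval_pow, Polynomial.eval_sub,
        Polynomial.eval_X, smul_eq_mul]
      ring
    rw [hev]
    refine ht.trans ?_
    have hK := hf.nonneg hL
    have h0 : 0 ≤ y - a := sub_nonneg.2 hy.1
    refine (div_le_self (by positivity) (Nat.one_le_cast.2 (Nat.factorial_pos m))).trans ?_
    gcongr
    exact hy.2

/-- Approximation by discontinuous elements. -/
theorem exists_mem_Qh_approx (hL : 0 < L) (hx : IsMesh L x) {r : ℕ} (hr : 1 ≤ r) {K : ℝ}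
    {u : L2 L} (hu : HasSmoothRep L r K u) :
    ∃ p ∈ Qh L x r, ‖u - p‖ ≤ √L * (K * meshSize x ^ r) := by
  obtain ⟨m, rfl⟩ : ∃ m, r = m + 1 := ⟨r - 1, by omega⟩
  obtain ⟨f, hf, huf⟩ := hu
  have hK := hf.nonneg hL
  have hh := hx.meshSize_nonneg
  choose P hP hPf using fun i : Fin n => exists_taylor_polynomial (hx.castSucc_lt_succ i)
    (hx.nonneg _) (hx.le_length _) hf
  obtain ⟨p, hp, hpP⟩ := exists_piecewisePoly hx P hP
  refine ⟨p, hp, norm_le_of_ae_bound hL.le (by positivity) ?_⟩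
  filter_upwards [huf, hpP, Lp.coeFn_sub u p, hx.ae_exists_mem] with y h1 h2 h3 ⟨i, hi⟩
  rw [h3, Pi.sub_apply, h1, h2 i hi]
  refine (hPf i y (Ioo_subset_Icc_self hi)).trans ?_
  have h0 := (hx.castSucc_lt_succ i).le
  gcongr
  exact le_meshSize x i

end Approximation

section Static

variable {L : ℝ}

/-! ### The static problem in terms of derivatives -/

/-- The static mixed problem for the derivatives `Θ = θ'`, `W = w'` and for `γ`, tested against the
subspace `S` of `L²(Ω)`; `a` stands for `1/Â`. -/
structure IsStaticSolution (L : ℝ) (I a : ℝ → ℝ) (lam : ℝ) (q : L2 L) (S : Submodule ℝ (L2 L))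
    (Θ W γ : L2 L) : Prop where
  mem_Θ : Θ ∈ S
  mem_W : W ∈ S
  mem_γ : γ ∈ S
  mean_Θ : inner ℝ Θ (one L) = 0
  mean_W : inner ℝ W (one L) = 0
  moment : ∀ H ∈ S, inner ℝ H (one L) = 0 → inner ℝ (mulL L I Θ) H + inner ℝ γ (J L H) = 0
  force : ∀ V ∈ S, inner ℝ V (one L) = 0 → -inner ℝ γ V = inner ℝ q (J L V)
  shear : ∀ ψ ∈ S, inner ℝ (J L Θ - W) ψ = lam * inner ℝ (mulL L a γ) ψ

/-- The function `f` minus its mean. -/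
def meanFree (f : L2 L) : L2 L := f - (inner ℝ f (one L) / L) • one L

theorem inner_one_one (hL : 0 ≤ L) : inner ℝ (one L) (one L) = L := by
  rw [real_inner_self_eq_norm_sq, norm_one_sq hL]

theorem inner_meanFree_one (hL : 0 < L) (f : L2 L) : inner ℝ (meanFree f) (one L) = 0 := by
  rw [meanFree, inner_sub_left, real_inner_smul_left, inner_one_one hL.le,
    div_mul_cancel₀ _ hL.ne', sub_self]

/-- `meanFree` is the orthogonal projection onto the complement of the constants. -/
theorem inner_meanFree_self (hL : 0 < L) (f : L2 L) :
    inner ℝ f (meanFree f) = ‖meanFree f‖ ^ 2 := by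
  have h : inner ℝ (one L) (meanFree f) = 0 := by
    rw [real_inner_comm]
    exact inner_meanFree_one hL f
  have hf : f = meanFree f + (inner ℝ f (one L) / L) • one L := by rw [meanFree]; abel
  have := congrArg (fun g => inner ℝ g (meanFree f)) hf
  simp only [inner_add_left, real_inner_smul_left, h, mul_zero, add_zero] at this
  rw [this, real_inner_self_eq_norm_sq]

theorem le_of_sq_le_mul_self {X δ : ℝ} (hδ : 0 ≤ δ) (h : X ^ 2 ≤ δ * X) : X ≤ δ := by
  by_contra hX
  have h1 : 0 < X := hδ.trans_lt (not_le.1 hX)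
  nlinarith

theorem norm_meanFree_le (hL : 0 < L) (f : L2 L) : ‖meanFree f‖ ≤ ‖f‖ := by
  have h1 := inner_meanFree_self hL f
  have h2 := real_inner_le_norm f (meanFree f)
  exact le_of_sq_le_mul_self (norm_nonneg f) (h1 ▸ h2)

theorem meanFree_eq_self {f : L2 L} (h : inner ℝ f (one L) = 0) : meanFree f = f := by
  rw [meanFree, h, zero_div, zero_smul, sub_zero]

theorem meanFree_sub (f g : L2 L) : meanFree (f - g) = meanFree f - meanFree g := by
  simp only [meanFree, inner_sub_left, sub_div, sub_smul]
  abel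

theorem meanFree_mem {S : Submodule ℝ (L2 L)} (h1 : one L ∈ S) {f : L2 L} (hf : f ∈ S) :
    meanFree f ∈ S := S.sub_mem hf (S.smul_mem _ h1)

theorem abs_inner_le (f g : L2 L) : |inner ℝ f g| ≤ ‖f‖ * ‖g‖ := abs_real_inner_le_norm f g

/-- When `D ≤ X`, the second hypothesis gives `k ≤ 2 * B * X` and one factor `X` cancels from the
first; when `X ≤ D` there is nothing to show. -/
theorem quadratic_bound {c B D X k : ℝ} (hc : 0 < c) (hB : 0 ≤ B) (hD : 0 ≤ D)
    (h1 : c * X ^ 2 ≤ D * (X + k)) (h2 : k ≤ B * (X + D)) :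
    X ≤ ((1 + 2 * B) / c + 1) * D := by
  rcases le_total X D with h | h
  · have : 0 ≤ (1 + 2 * B) / c * D := by positivity
    linarith
  · rcases eq_or_lt_of_le (hD.trans h) with h0 | h0
    · rw [← h0]
      positivity
    · have h3 : c * X ^ 2 ≤ (D * (1 + 2 * B)) * X := by
        refine h1.trans ?_
        have : X + k ≤ (1 + 2 * B) * X := by nlinarith
        calc D * (X + k) ≤ D * ((1 + 2 * B) * X) := mul_le_mul_of_nonneg_left this hD
          _ = _ := by ring
      have h4 : c * X ≤ D * (1 + 2 * B) := by
        refine le_of_mul_le_mul_right ?_ h0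
        linarith
      have h5 : X ≤ (1 + 2 * B) / c * D := by
        rw [div_mul_eq_mul_div, le_div_iff₀ hc]
        linarith
      linarith

/-- Stability of the saddle point problem whose multiplier is a constant. -/
theorem saddle_bound {I : ℝ → ℝ} (hI : ContinuousOn I (Icc 0 L)) {c K : ℝ} (hc : 0 < c)
    (hcI : ∀ x ∈ Icc 0 L, c ≤ I x) (hK : 0 ≤ K) (hIK : ∀ x ∈ Icc 0 L, |I x| ≤ K)
    {S : Submodule ℝ (L2 L)} {ξ : L2 L} (hξ : ξ ∈ S) (hξ0 : inner ℝ ξ (one L) = 0)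
    {κ b B D : ℝ} (hB : 0 ≤ B) (hD : 0 ≤ D) (hb : 0 ≤ b)
    (h1 : ∀ H ∈ S, inner ℝ H (one L) = 0 →
      |inner ℝ (mulL L I ξ) H + κ * inner ℝ (J L H) (one L)| ≤ D * ‖H‖)
    (h2 : |inner ℝ (J L ξ) (one L) - b * κ| ≤ D)
    (h3 : (∃ H ∈ S, inner ℝ H (one L) = 0 ∧ ‖H‖ ≤ B ∧ inner ℝ (J L H) (one L) = 1) ∨
      |κ| ≤ B * D) :
    ‖ξ‖ ≤ ((1 + 2 * (B * (K + 1))) / c + 1) * D ∧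
      |κ| ≤ B * (K + 1) * (((1 + 2 * (B * (K + 1))) / c + 1) + 1) * D := by
  -- Testing `h1` with the inf-sup function isolates `κ`. In the second alternative `κ` is already
  -- small.
  have hκ : |κ| ≤ B * (K + 1) * (‖ξ‖ + D) := by
    rcases h3 with ⟨H, hH, hH0, hHB, hH1⟩ | h3
    · have h4 := h1 H hH hH0
      rw [hH1, mul_one] at h4
      have h5 : |inner ℝ (mulL L I ξ) H| ≤ K * ‖ξ‖ * ‖H‖ :=
        (abs_inner_le _ _).trans
          (mul_le_mul_of_nonneg_right (norm_mulL_le hI hIK ξ) (norm_nonneg _))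
      have h6 : |κ| ≤ (K * ‖ξ‖ + D) * ‖H‖ := by
        have : κ = (inner ℝ (mulL L I ξ) H + κ) - inner ℝ (mulL L I ξ) H := by ring
        rw [this]
        refine (abs_sub _ _).trans ?_
        linarith
      have h7 : (K * ‖ξ‖ + D) * ‖H‖ ≤ (K * ‖ξ‖ + D) * B :=
        mul_le_mul_of_nonneg_left hHB (by positivity)
      have h8 : 0 ≤ B * ‖ξ‖ := by positivity
      have h9 : 0 ≤ B * K * D := by positivity
      nlinarith
    · have h8 : 0 ≤ B * (K + 1) * ‖ξ‖ := by positivity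
      have h9 : 0 ≤ B * K * D := by positivity
      nlinarith
  -- Energy argument: test `h1` with `ξ` itself and write `κ (Jξ, 1) = κ ((Jξ, 1) - b κ) + b κ²`.
  -- Only the sign of `b` is used, so the bounds do not degenerate as `b` tends to `0`.
  have hE : c * ‖ξ‖ ^ 2 ≤ D * (‖ξ‖ + |κ|) := by
    have h4 := (abs_le.1 (h1 ξ hξ hξ0)).2
    have h5 := le_inner_mulL_self hI hcI ξ
    have h6 : κ * (inner ℝ (J L ξ) (one L) - b * κ) ≥ -(|κ| * D) := by
      have := abs_le.1 ((abs_mul κ (inner ℝ (J L ξ) (one L) - b * κ)).le.trans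
        (mul_le_mul_of_nonneg_left h2 (abs_nonneg κ)))
      exact this.1
    have h7 : 0 ≤ b * κ ^ 2 := by positivity
    nlinarith
  have hX := quadratic_bound hc (by positivity) hD hE hκ
  refine ⟨hX, hκ.trans ?_⟩
  have : ‖ξ‖ + D ≤ (((1 + 2 * (B * (K + 1))) / c + 1) + 1) * D := by linarith
  calc B * (K + 1) * (‖ξ‖ + D) ≤ B * (K + 1) * ((((1 + 2 * (B * (K + 1))) / c + 1) + 1) * D) :=
        mul_le_mul_of_nonneg_left this (by positivity)
    _ = _ := by ring

/-! ### Quasi-optimality of the static discrete solution. -/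

section Error

variable {I : ℝ → ℝ} {c K Ka Λ : ℝ}

theorem mulL_sub (hI : ContinuousOn I (Icc 0 L)) (f g : L2 L) :
    mulL L I (f - g) = mulL L I f - mulL L I g := (mulLin hI).map_sub f g

set_option maxHeartbeats 1000000 in
/-- Quasi-optimality of the discrete solution, uniformly in `lam`. -/
theorem static_error (hL : 0 < L) (hc : 0 < c) (hK : 0 ≤ K) (hKa : 0 ≤ Ka) (hΛ : 0 ≤ Λ)
    {B : ℝ} (hB : 0 ≤ B) :
    ∃ C : ℝ, 0 ≤ C ∧ ∀ (I a : ℝ → ℝ) (lam : ℝ), ContinuousOn I (Icc 0 L) →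
      ContinuousOn a (Icc 0 L) → (∀ x ∈ Icc 0 L, c ≤ I x) → (∀ x ∈ Icc 0 L, |I x| ≤ K) →
      (∀ x ∈ Icc 0 L, 0 ≤ a x) → (∀ x ∈ Icc 0 L, |a x| ≤ Ka) → 0 ≤ lam → lam ≤ Λ →
      ∀ (S : Submodule ℝ (L2 L)), one L ∈ S →
      ∀ (q Θ W γ Θh Wh γh : L2 L), IsStaticSolution L I a lam q ⊤ Θ W γ →
      IsStaticSolution L I a lam q S Θh Wh γh → ∀ δ, 0 ≤ δ →
      (∃ p ∈ S, ‖Θ - p‖ ≤ δ) → (∃ p ∈ S, ‖W - p‖ ≤ δ) → (∃ p ∈ S, ‖γ - p‖ ≤ δ) →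
      ((∃ H ∈ S, inner ℝ H (one L) = 0 ∧ ‖H‖ ≤ B ∧ inner ℝ (J L H) (one L) = 1) ∨
        ‖γh - γ‖ ≤ B * δ) →
      ‖Θ - Θh‖ ≤ C * δ ∧ ‖W - Wh‖ ≤ C * δ ∧ ‖γ - γh‖ ≤ C * δ := by
  -- `K + 2 * L` is the consistency error of the moment equation, the next two terms that of the
  -- shear equation, and the final `1` makes `1 ≤ D₁`. In `B₁`, the quotient by `√L` converts the
  -- bound on `γh - γ` into one on `κ`.
  set D₁ : ℝ := K + 2 * L + L * √L + 2 * Λ * Ka * √L + 1 with hD₁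
  set B₁ : ℝ := B + (B + 2) / √L with hB₁
  have hsL : 0 < √L := Real.sqrt_pos.2 hL
  have hD₁0 : 1 ≤ D₁ := by
    have : 0 ≤ K + 2 * L + L * √L + 2 * Λ * Ka * √L := by positivity
    linarith
  have hB₁0 : 0 ≤ B₁ := by positivity
  set X₁ : ℝ := ((1 + 2 * (B₁ * (K + 1))) / c + 1) * D₁ with hX₁
  set X₂ : ℝ := B₁ * (K + 1) * (((1 + 2 * (B₁ * (K + 1))) / c + 1) + 1) * D₁ with hX₂
  have hX₁0 : 0 ≤ X₁ := by positivity
  have hX₂0 : 0 ≤ X₂ := by positivity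
  set C₁ : ℝ := X₁ + 1 with hC₁
  set C₂ : ℝ := X₂ * √L + 2 with hC₂
  set C₃ : ℝ := L * C₁ + Λ * Ka * C₂ + 2 with hC₃
  have hC₁0 : 0 ≤ C₁ := by positivity
  have hC₂0 : 0 ≤ C₂ := by positivity
  have hC₃0 : 0 ≤ C₃ := by positivity
  refine ⟨C₁ + C₂ + C₃, by positivity, ?_⟩
  intro I a lam hI ha hcI hIK ha0 haK hlam hlamΛ S h1S q Θ W γ Θh Wh γh hex hdi δ hδ
    ⟨tI, htI, htIδ⟩ ⟨wI, hwI, hwIδ⟩ ⟨g, hg, hgδ⟩ hinf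
  -- the difference of the shear forces, up to a constant
  have hd0S : meanFree (γh - g) ∈ S := meanFree_mem h1S (S.sub_mem hdi.mem_γ hg)
  have hd0m := inner_meanFree_one hL (γh - g)
  set κ : ℝ := inner ℝ (γh - g) (one L) / L with hκ
  set ρ : L2 L := γh - γ - κ • one L with hρ
  -- Both solutions satisfy the force equation with the same load, so `γh - γ` is orthogonal to the
  -- mean-zero part of `S`. Hence `γh - γ` is small up to the constant `κ`, whatever happens to the
  -- other unknowns.
  have hd0 : ‖meanFree (γh - g)‖ ≤ δ := by
    have h1 := inner_meanFree_self hL (γh - g)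
    have h2 := hex.force _ Submodule.mem_top hd0m
    have h3 := hdi.force _ hd0S hd0m
    have h4 : ‖meanFree (γh - g)‖ ^ 2 = inner ℝ (γ - g) (meanFree (γh - g)) := by
      rw [← h1, inner_sub_left, inner_sub_left]
      linarith
    have h5 := real_inner_le_norm (γ - g) (meanFree (γh - g))
    refine le_of_sq_le_mul_self hδ (h4.le.trans (h5.trans ?_))
    exact mul_le_mul_of_nonneg_right hgδ (norm_nonneg _)
  have hρn : ‖ρ‖ ≤ 2 * δ := by
    have h1 : ρ = meanFree (γh - g) - (γ - g) := by rw [hρ, meanFree]; abel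
    rw [h1]
    refine (norm_sub_le _ _).trans ?_
    linarith
  have hγ : γh - γ = κ • one L + ρ := by rw [hρ]; abel
  -- the approximation of the rotation
  set ΘI := meanFree tI with hΘI
  have hΘIS : ΘI ∈ S := meanFree_mem h1S htI
  have hΘIm : inner ℝ ΘI (one L) = 0 := inner_meanFree_one hL tI
  have hτ : ‖Θ - ΘI‖ ≤ δ := by
    have : Θ - ΘI = meanFree (Θ - tI) := by rw [meanFree_sub, meanFree_eq_self hex.mean_Θ]
    rw [this]
    exact (norm_meanFree_le hL _).trans htIδ
  set ξ := Θh - ΘI with hξ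
  have hξS : ξ ∈ S := S.sub_mem hdi.mem_Θ hΘIS
  have hξm : inner ℝ ξ (one L) = 0 := by rw [hξ, inner_sub_left, hdi.mean_Θ, hΘIm, sub_zero]
  have hmom : ∀ H ∈ S, inner ℝ H (one L) = 0 →
      |inner ℝ (mulL L I ξ) H + κ * inner ℝ (J L H) (one L)| ≤ (D₁ * δ) * ‖H‖ := by
    intro H hH hHm
    have h1 := hex.moment H Submodule.mem_top hHm
    have h2 := hdi.moment H hH hHm
    have h3 : inner ℝ (γh - γ) (J L H) = κ * inner ℝ (J L H) (one L) + inner ℝ ρ (J L H) := by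
      rw [hγ, inner_add_left, real_inner_smul_left, real_inner_comm (one L)]
    have h4 : inner ℝ (mulL L I ξ) H + κ * inner ℝ (J L H) (one L)
        = inner ℝ (mulL L I (Θ - ΘI)) H - inner ℝ ρ (J L H) := by
      rw [inner_sub_left] at h3
      rw [hξ, mulL_sub hI, mulL_sub hI, inner_sub_left, inner_sub_left]
      linarith
    rw [h4]
    refine (abs_sub _ _).trans ?_
    have h5 : |inner ℝ (mulL L I (Θ - ΘI)) H| ≤ K * δ * ‖H‖ := by
      refine (abs_inner_le _ _).trans (mul_le_mul_of_nonneg_right ?_ (norm_nonneg _))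
      exact (norm_mulL_le hI hIK _).trans (mul_le_mul_of_nonneg_left hτ hK)
    have h6 : |inner ℝ ρ (J L H)| ≤ (2 * δ) * (L * ‖H‖) :=
      (abs_inner_le _ _).trans (mul_le_mul hρn (norm_J_le hL.le H) (norm_nonneg _) (by positivity))
    have h7 : 0 ≤ (L * √L + 2 * Λ * Ka * √L + 1) * δ * ‖H‖ := by positivity
    have h8 : D₁ * δ * ‖H‖ = K * δ * ‖H‖ + (2 * δ) * (L * ‖H‖)
        + (L * √L + 2 * Λ * Ka * √L + 1) * δ * ‖H‖ := by rw [hD₁]; ring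
    linarith
  -- With the test function `1` the unknowns `W` and `Wh` drop out, since they have mean zero.
  -- Together with `hmom` this is a closed saddle point problem for `ξ` and `κ`.
  have hshe : |inner ℝ (J L ξ) (one L) - lam * inner ℝ (mulL L a (one L)) (one L) * κ|
      ≤ D₁ * δ := by
    have h1 := hex.shear (one L) Submodule.mem_top
    have h2 := hdi.shear (one L) h1S
    rw [inner_sub_left, hex.mean_W, sub_zero] at h1
    rw [inner_sub_left, hdi.mean_W, sub_zero] at h2
    have h3 : inner ℝ (mulL L a γh) (one L) - inner ℝ (mulL L a γ) (one L)
        = κ * inner ℝ (mulL L a (one L)) (one L) + inner ℝ (mulL L a ρ) (one L) := by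
      rw [← inner_sub_left, ← mulL_sub ha, hγ, mulL_add ha, mulL_smul ha, inner_add_left,
        real_inner_smul_left]
    have h4 : inner ℝ (J L ξ) (one L) - lam * inner ℝ (mulL L a (one L)) (one L) * κ
        = inner ℝ (J L (Θ - ΘI)) (one L) + lam * inner ℝ (mulL L a ρ) (one L) := by
      rw [hξ, map_sub, map_sub, inner_sub_left, inner_sub_left, h1, h2]
      linear_combination lam * h3
    rw [h4]
    refine (abs_add_le _ _).trans ?_
    have h5 : |inner ℝ (J L (Θ - ΘI)) (one L)| ≤ (L * δ) * √L := by
      refine (abs_inner_le _ _).trans ?_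
      rw [norm_one_eq hL.le]
      refine mul_le_mul_of_nonneg_right ?_ hsL.le
      exact (norm_J_le hL.le _).trans (mul_le_mul_of_nonneg_left hτ hL.le)
    have h6 : |lam * inner ℝ (mulL L a ρ) (one L)| ≤ Λ * ((Ka * (2 * δ)) * √L) := by
      rw [abs_mul, abs_of_nonneg hlam]
      refine mul_le_mul hlamΛ ?_ (abs_nonneg _) hΛ
      refine (abs_inner_le _ _).trans ?_
      rw [norm_one_eq hL.le]
      refine mul_le_mul_of_nonneg_right ?_ hsL.le
      exact (norm_mulL_le ha haK _).trans (mul_le_mul_of_nonneg_left hρn hKa)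
    have h7 : 0 ≤ (K + 2 * L + 1) * δ := by positivity
    have h8 : D₁ * δ = (L * δ) * √L + Λ * ((Ka * (2 * δ)) * √L) + (K + 2 * L + 1) * δ := by
      rw [hD₁]; ring
    linarith
  have hb : 0 ≤ lam * inner ℝ (mulL L a (one L)) (one L) := by
    have := le_inner_mulL_self ha ha0 (one L)
    rw [zero_mul] at this
    positivity
  have hinf' : (∃ H ∈ S, inner ℝ H (one L) = 0 ∧ ‖H‖ ≤ B₁ ∧ inner ℝ (J L H) (one L) = 1) ∨
      |κ| ≤ B₁ * (D₁ * δ) := by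
    rcases hinf with ⟨H, h1, h2, h3, h4⟩ | h
    · refine Or.inl ⟨H, h1, h2, h3.trans ?_, h4⟩
      rw [hB₁]
      have : 0 ≤ (B + 2) / √L := by positivity
      linarith
    · right
      have h1 : |κ| * √L ≤ (B + 2) * δ := by
        have : κ • one L = (γh - γ) - ρ := by rw [hρ]; abel
        rw [← norm_one_eq hL.le, ← Real.norm_eq_abs, ← norm_smul, this]
        refine (norm_sub_le _ _).trans ?_
        linarith
      have h2 : |κ| ≤ (B + 2) / √L * δ := by
        rw [div_mul_eq_mul_div, le_div_iff₀ hsL]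
        exact h1
      have h3 : (B + 2) / √L * δ ≤ B₁ * δ :=
        mul_le_mul_of_nonneg_right (by rw [hB₁]; linarith) hδ
      have h4 : B₁ * δ ≤ B₁ * (D₁ * δ) :=
        mul_le_mul_of_nonneg_left (le_mul_of_one_le_left hδ hD₁0) hB₁0
      linarith
  obtain ⟨hξb, hκb⟩ := saddle_bound hI hc hcI hK hIK hξS hξm hB₁0 (by positivity) hb hmom hshe
    hinf'
  have hξb' : ‖ξ‖ ≤ X₁ * δ := hξb.trans (le_of_eq (by rw [hX₁]; ring))
  have hκb' : |κ| ≤ X₂ * δ := hκb.trans (le_of_eq (by rw [hX₂]; ring))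
  have hΘe : ‖Θ - Θh‖ ≤ C₁ * δ := by
    have : Θ - Θh = (Θ - ΘI) - ξ := by rw [hξ]; abel
    rw [this]
    refine (norm_sub_le _ _).trans ?_
    rw [hC₁]
    linarith
  have hγe : ‖γ - γh‖ ≤ C₂ * δ := by
    rw [norm_sub_rev, hγ]
    refine (norm_add_le _ _).trans ?_
    rw [norm_smul, norm_one_eq hL.le, Real.norm_eq_abs, hC₂]
    have := mul_le_mul_of_nonneg_right hκb' hsL.le
    linarith
  have hWe : ‖W - Wh‖ ≤ C₃ * δ := by
    -- The shear equation is tested with all of `S`, so `wI` need not have mean zero.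
    set ζ := Wh - wI with hζ
    have hζS : ζ ∈ S := S.sub_mem hdi.mem_W hwI
    have h1 := hex.shear ζ Submodule.mem_top
    have h2 := hdi.shear ζ hζS
    have h3 : ‖ζ‖ ^ 2 = inner ℝ (J L (Θh - Θ)) ζ - lam * inner ℝ (mulL L a (γh - γ)) ζ
        + inner ℝ (W - wI) ζ := by
      rw [inner_sub_left] at h1 h2
      rw [← real_inner_self_eq_norm_sq]
      conv_lhs => rw [hζ, ← hζ, inner_sub_left]
      rw [map_sub, mulL_sub ha, inner_sub_left, inner_sub_left, inner_sub_left]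
      linarith
    have h4 : inner ℝ (J L (Θh - Θ)) ζ ≤ (L * (C₁ * δ)) * ‖ζ‖ := by
      refine (real_inner_le_norm _ _).trans (mul_le_mul_of_nonneg_right ?_ (norm_nonneg _))
      rw [norm_sub_rev] at hΘe
      exact (norm_J_le hL.le _).trans (mul_le_mul_of_nonneg_left hΘe hL.le)
    have h5 : -(lam * inner ℝ (mulL L a (γh - γ)) ζ) ≤ (Λ * (Ka * (C₂ * δ))) * ‖ζ‖ := by
      refine (neg_le_abs _).trans ?_
      rw [abs_mul, abs_of_nonneg hlam, mul_assoc]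
      refine mul_le_mul hlamΛ ?_ (abs_nonneg _) hΛ
      refine (abs_inner_le _ _).trans (mul_le_mul_of_nonneg_right ?_ (norm_nonneg _))
      rw [norm_sub_rev] at hγe
      exact (norm_mulL_le ha haK _).trans (mul_le_mul_of_nonneg_left hγe hKa)
    have h6 : inner ℝ (W - wI) ζ ≤ δ * ‖ζ‖ :=
      (real_inner_le_norm _ _).trans (mul_le_mul_of_nonneg_right hwIδ (norm_nonneg _))
    have h7 : ‖ζ‖ ≤ L * (C₁ * δ) + Λ * (Ka * (C₂ * δ)) + δ := by
      refine le_of_sq_le_mul_self (by positivity) ?_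
      rw [h3]
      linarith
    have : W - Wh = (W - wI) - ζ := by rw [hζ]; abel
    rw [this]
    refine (norm_sub_le _ _).trans ?_
    have h8 : C₃ * δ = L * (C₁ * δ) + Λ * (Ka * (C₂ * δ)) + 2 * δ := by rw [hC₃]; ring
    linarith
  have e1 : 0 ≤ C₁ * δ := by positivity
  have e2 : 0 ≤ C₂ * δ := by positivity
  have e3 : 0 ≤ C₃ * δ := by positivity
  have e4 : (C₁ + C₂ + C₃) * δ = C₁ * δ + C₂ * δ + C₃ * δ := by ring
  exact ⟨by linarith, by linarith, by linarith⟩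

end Error

end Static

section Regularity

variable {L : ℝ}

/-! ### Regularity of the exact solution -/

theorem IsWeakDeriv.exists_eq_abs_le (hL : 0 < L) {u g : L2 L} (h : IsWeakDeriv L u g) {N : ℝ}
    (hu : ‖u‖ ≤ N) (hg : ‖g‖ ≤ N) :
    ∃ c : ℝ, u = J L g + c • one L ∧ |c| ≤ (1 + L) / √L * N := by
  obtain ⟨c, hc⟩ := h.exists_eq hL
  refine ⟨c, hc, ?_⟩
  have hsL : 0 < √L := Real.sqrt_pos.2 hL
  rw [div_mul_eq_mul_div, le_div_iff₀ hsL, ← norm_one_eq hL.le, ← Real.norm_eq_abs, ← norm_smul]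
  have h1 : c • one L = u - J L g := by rw [hc]; abel
  rw [h1]
  refine (norm_sub_le _ _).trans ?_
  have h2 := (norm_J_le hL.le g).trans (mul_le_mul_of_nonneg_left hg hL.le)
  linarith

/-- The Sobolev embedding of `H^(k+1)` in `C^k`, by induction: each member of the chain is the
primitive of the next one plus a controlled constant. -/
theorem exists_hasSmoothRep_of_chain (hL : 0 < L) (k : ℕ) : ∃ C : ℝ, 0 ≤ C ∧
    ∀ (u : ℕ → L2 L) (N : ℝ), (∀ j ≤ k, IsWeakDeriv L (u j) (u (j + 1))) →
      (∀ j ≤ k + 1, ‖u j‖ ≤ N) → HasSmoothRep L k (C * N) (u 0) := by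
  induction k with
  | zero =>
    refine ⟨√L + (1 + L) / √L, by positivity, fun u N hu hN => ?_⟩
    obtain ⟨c, hc, hcN⟩ := (hu 0 le_rfl).exists_eq_abs_le hL (hN 0 (by omega)) (hN 1 (by omega))
    rw [hc]
    refine ((hasSmoothRep_J_zero hL _).add hL (hasSmoothRep_smul_one hL c 0)).mono ?_
    have := mul_le_mul_of_nonneg_left (hN 1 (by omega)) (Real.sqrt_nonneg L)
    rw [add_mul]
    exact add_le_add this hcN
  | succ k ih =>
    obtain ⟨C, hC, h⟩ := ih
    refine ⟨(L + 1) * C + (1 + L) / √L, by positivity, fun u N hu hN => ?_⟩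
    obtain ⟨c, hc, hcN⟩ :=
      (hu 0 (Nat.zero_le _)).exists_eq_abs_le hL (hN 0 (by omega)) (hN 1 (by omega))
    have h1 := h (fun j => u (j + 1)) N (fun j hj => hu (j + 1) (by omega))
      (fun j hj => hN (j + 1) (by omega))
    rw [hc]
    refine ((h1.J hL).add hL (hasSmoothRep_smul_one hL c (k + 1))).mono ?_
    have h2 : ((L + 1) * C + (1 + L) / √L) * N = (L + 1) * (C * N) + (1 + L) / √L * N := by ring
    linarith

theorem norm_component_le {r : ℕ} (q : Hk L r) (j : Fin (r + 1)) : ‖q.1 j‖ ≤ ‖q‖ :=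
  PiLp.norm_apply_le q.1 j

theorem exists_hasSmoothRep_fn (hL : 0 < L) {r : ℕ} (hr : 1 ≤ r) : ∃ C : ℝ, 0 ≤ C ∧
    ∀ q : Hk L r, HasSmoothRep L (r - 1) (C * ‖q‖) (fn q) := by
  obtain ⟨C, hC, h⟩ := exists_hasSmoothRep_of_chain hL (r - 1)
  refine ⟨C, hC, fun q => ?_⟩
  -- The value `0` beyond order `r` is never reached: the chain of order `r - 1` reads the indices
  -- `0, …, r` only.
  have := h (fun j => if hj : j < r + 1 then q.1 ⟨j, hj⟩ else 0) ‖q‖ ?_ ?_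
  · simp only [Nat.zero_lt_succ, dif_pos] at this
    exact this
  · intro j hj
    have h1 : j < r + 1 := by omega
    have h2 : j + 1 < r + 1 := by omega
    simp only [h1, h2, dif_pos]
    exact q.2 ⟨j, by omega⟩
  · intro j hj
    have h1 : j < r + 1 := by omega
    simp only [h1, dif_pos]
    exact norm_component_le q _

/-- `meanFree f` is itself an admissible `V`, and pairing it with `f` gives the square of its norm.
-/
theorem eq_smul_one_of_forall_inner_eq_zero (hL : 0 < L) {f : L2 L}
    (h : ∀ V : L2 L, inner ℝ V (one L) = 0 → inner ℝ f V = 0) :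
    f = (inner ℝ f (one L) / L) • one L := by
  have h1 := h _ (inner_meanFree_one hL f)
  rw [inner_meanFree_self hL, sq_eq_zero_iff, norm_eq_zero, meanFree, sub_eq_zero] at h1
  exact h1

theorem coeFn_J_one : J L (one L) =ᵐ[dom L] fun x => x := by
  refine (coeFn_J _).trans ?_
  rw [prim_congr coeFn_one]
  filter_upwards [ae_restrict_mem measurableSet_Ioo] with x hx
  rw [prim_eq_intervalIntegral (Ioo_subset_Icc_self hx)]
  simp

theorem norm_meanFree_J_one_pos (hL : 0 < L) : 0 < ‖meanFree (J L (one L))‖ := by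
  refine norm_pos_iff.2 fun h => ?_
  rw [meanFree, sub_eq_zero] at h
  set c := inner ℝ (J L (one L)) (one L) / L
  have h1 : (fun x : ℝ => x) =ᵐ[dom L] fun _ => c := by
    refine coeFn_J_one.symm.trans ?_
    rw [h]
    filter_upwards [Lp.coeFn_smul c (one L), coeFn_one] with x h1 h2
    rw [h1, Pi.smul_apply, h2, smul_eq_mul, mul_one]
  have h2 := eqOn_Icc_of_ae_eq hL continuousOn_id continuousOn_const h1
  have h3 := h2 (left_mem_Icc.2 hL.le)
  have h4 := h2 (right_mem_Icc.2 hL.le)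
  simp only [id] at h3 h4
  linarith

/-- `J L (one L)` is the function `x`, so the inf-sup condition asks for a bounded mean-zero `H`
with first moment `-1`. -/
theorem inner_J_one_of_mean_zero {H : L2 L} (hH : inner ℝ H (one L) = 0) :
    inner ℝ (J L H) (one L) = -inner ℝ H (J L (one L)) := by
  have := inner_J_add H (one L)
  rw [hH, zero_mul] at this
  linarith

/-- The inf-sup condition for a space that contains the linear functions. -/
theorem exists_infSup_of_mem (hL : 0 < L) {S : Submodule ℝ (L2 L)} (h1 : one L ∈ S)
    (hJ : J L (one L) ∈ S) : ∃ H ∈ S, inner ℝ H (one L) = 0 ∧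
      ‖H‖ ≤ ‖meanFree (J L (one L))‖⁻¹ ∧ inner ℝ (J L H) (one L) = 1 := by
  have hp := norm_meanFree_J_one_pos hL
  set N := ‖meanFree (J L (one L))‖ with hN
  have hm : inner ℝ ((-(N ^ 2)⁻¹) • meanFree (J L (one L))) (one L) = 0 := by
    rw [real_inner_smul_left, inner_meanFree_one hL, mul_zero]
  refine ⟨(-(N ^ 2)⁻¹) • meanFree (J L (one L)), S.smul_mem _ (meanFree_mem h1 hJ), hm, ?_, ?_⟩
  · rw [norm_smul, norm_neg, norm_inv, norm_pow, ← hN, Real.norm_of_nonneg hp.le]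
    refine le_of_eq ?_
    field_simp
  · rw [inner_J_one_of_mean_zero hm, real_inner_smul_left, real_inner_comm,
      inner_meanFree_self hL, ← hN]
    field_simp

theorem mulL_inv_mulL {I : ℝ → ℝ} (hI : ContinuousOn I (Icc 0 L))
    (hi : ContinuousOn (fun x => (I x)⁻¹) (Icc 0 L)) (h0 : ∀ x ∈ Icc 0 L, I x ≠ 0) (f : L2 L) :
    mulL L (fun x => (I x)⁻¹) (mulL L I f) = f := by
  refine Lp.ext ?_
  filter_upwards [coeFn_mulL hI f, coeFn_mulL hi (mulL L I f),
    ae_restrict_mem measurableSet_Ioo] with x h1 h2 hx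
  rw [h2, h1, inv_mul_cancel_left₀ (h0 x (Ioo_subset_Icc_self hx))]

theorem HasSmoothRep.norm_le (hL : 0 < L) {n : ℕ} {K : ℝ} {u : L2 L} (h : HasSmoothRep L n K u) :
    ‖u‖ ≤ √L * K := by
  obtain ⟨f, hf, huf⟩ := h
  refine norm_le_of_ae_bound hL.le (hf.nonneg hL) ?_
  filter_upwards [huf, ae_restrict_mem measurableSet_Ioo] with x hx hm
  rw [hx]
  exact hf.abs_le (Ioo_subset_Icc_self hm)

set_option maxHeartbeats 1000000 in
/-- Regularity of the exact solution, uniformly in `lam`. -/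
theorem exists_regularity (hL : 0 < L) {r : ℕ} (hr : 1 ≤ r) {c K Ki Ka Λ : ℝ} (hc : 0 < c)
    (hK : 0 ≤ K) (hKi : 0 ≤ Ki) (hKa : 0 ≤ Ka) (hΛ : 0 ≤ Λ) :
    ∃ C : ℝ, 0 ≤ C ∧ ∀ (I a : ℝ → ℝ) (lam : ℝ), SmoothBound L r K I →
      SmoothBound L r Ki (fun x => (I x)⁻¹) → SmoothBound L r Ka a →
      (∀ x ∈ Icc 0 L, c ≤ I x) → (∀ x ∈ Icc 0 L, 0 ≤ a x) → 0 ≤ lam → lam ≤ Λ →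
      ∀ (q : Hk L r) (Θ W γ : L2 L), IsStaticSolution L I a lam (fn q) ⊤ Θ W γ →
      HasSmoothRep L r (C * ‖q‖) Θ ∧ HasSmoothRep L r (C * ‖q‖) W ∧
        HasSmoothRep L r (C * ‖q‖) γ := by
  obtain ⟨C₀, hC₀, hrep⟩ := exists_hasSmoothRep_fn hL hr
  have hsL : 0 < √L := Real.sqrt_pos.2 hL
  set B : ℝ := ‖meanFree (J L (one L))‖⁻¹ with hB
  have hB0 : 0 ≤ B := inv_nonneg.2 (norm_nonneg _)
  set D : ℝ := L * L + Λ * (Ka * L * √L) with hD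
  have hD0 : 0 ≤ D := by positivity
  set X₁ : ℝ := ((1 + 2 * (B * (K + 1))) / c + 1) * D with hX₁
  set X₂ : ℝ := B * (K + 1) * (((1 + 2 * (B * (K + 1))) / c + 1) + 1) * D with hX₂
  have hX₁0 : 0 ≤ X₁ := by positivity
  have hX₂0 : 0 ≤ X₂ := by positivity
  set G : ℝ := (L + 1) * C₀ + X₂ with hG
  have hG0 : 0 ≤ G := by positivity
  set Y : ℝ := (K * X₁ + L * (√L * G)) / √L with hY
  have hY0 : 0 ≤ Y := by positivity
  set T : ℝ := 2 ^ r * (Ki * ((L + 1) * G + Y)) with hT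
  have hT0 : 0 ≤ T := by positivity
  set Z : ℝ := (L + 1) * T + 2 ^ r * (Λ * (2 ^ r * (Ka * G))) with hZ
  have hZ0 : 0 ≤ Z := by positivity
  refine ⟨G + T + Z, by positivity, ?_⟩
  intro I a lam hI hi ha hcI ha0 hlam hlamΛ q Θ W γ hs
  have hIc := hI.continuousOn
  have hac := ha.continuousOn
  have hIK : ∀ x ∈ Icc 0 L, |I x| ≤ K := fun x hx => hI.abs_le hx
  have haK : ∀ x ∈ Icc 0 L, |a x| ≤ Ka := fun x hx => ha.abs_le hx
  have hq : ‖fn q‖ ≤ ‖q‖ := norm_component_le q 0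
  have hq0 := norm_nonneg q
  -- the shear force
  obtain ⟨κ, hκ⟩ : ∃ κ : ℝ, γ = J L (fn q) + κ • one L := by
    refine ⟨_, eq_add_of_sub_eq' (eq_smul_one_of_forall_inner_eq_zero hL fun V hV => ?_)⟩
    have h1 := hs.force V Submodule.mem_top hV
    have h2 := inner_J_add (fn q) V
    rw [hV, mul_zero] at h2
    rw [inner_sub_left]
    linarith
  have hJq : ‖J L (fn q)‖ ≤ L * ‖q‖ :=
    (norm_J_le hL.le _).trans (mul_le_mul_of_nonneg_left hq hL.le)
  have hb : 0 ≤ lam * inner ℝ (mulL L a (one L)) (one L) := by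
    have := le_inner_mulL_self hac ha0 (one L)
    rw [zero_mul] at this
    positivity
  -- With `γ = J q + κ`, the pair `(Θ, κ)` solves the same kind of saddle point problem as the
  -- discretisation error, now with data coming from `J q`.
  have hmom : ∀ H ∈ (⊤ : Submodule ℝ (L2 L)), inner ℝ H (one L) = 0 →
      |inner ℝ (mulL L I Θ) H + κ * inner ℝ (J L H) (one L)| ≤ (D * ‖q‖) * ‖H‖ := by
    intro H hH hHm
    have h1 := hs.moment H hH hHm
    rw [hκ, inner_add_left, real_inner_smul_left, real_inner_comm] at h1
    have h2 : inner ℝ (mulL L I Θ) H + κ * inner ℝ (J L H) (one L)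
        = -inner ℝ (J L (fn q)) (J L H) := by
      have e1 := real_inner_comm (J L H) (one L)
      have e2 := real_inner_comm (J L H) (J L (fn q))
      have e3 := real_inner_comm H (mulL L I Θ)
      rw [e1] at h1
      linarith
    rw [h2, abs_neg]
    refine (abs_inner_le _ _).trans ?_
    have h3 := mul_le_mul hJq (norm_J_le hL.le H) (norm_nonneg _) (by positivity)
    have h4 : 0 ≤ Λ * (Ka * L * √L) * ‖q‖ * ‖H‖ := by positivity
    have h5 : D * ‖q‖ * ‖H‖ = L * ‖q‖ * (L * ‖H‖) + Λ * (Ka * L * √L) * ‖q‖ * ‖H‖ := by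
      rw [hD]; ring
    linarith
  have hshe : |inner ℝ (J L Θ) (one L) - lam * inner ℝ (mulL L a (one L)) (one L) * κ|
      ≤ D * ‖q‖ := by
    have h1 := hs.shear (one L) Submodule.mem_top
    rw [inner_sub_left, hs.mean_W, sub_zero, hκ, mulL_add hac, mulL_smul hac, inner_add_left,
      real_inner_smul_left] at h1
    have h2 : inner ℝ (J L Θ) (one L) - lam * inner ℝ (mulL L a (one L)) (one L) * κ
        = lam * inner ℝ (mulL L a (J L (fn q))) (one L) := by
      rw [h1]; ring
    rw [h2, abs_mul, abs_of_nonneg hlam]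
    have h3 : |inner ℝ (mulL L a (J L (fn q))) (one L)| ≤ (Ka * (L * ‖q‖)) * √L := by
      refine (abs_inner_le _ _).trans ?_
      rw [norm_one_eq hL.le]
      refine mul_le_mul_of_nonneg_right ?_ hsL.le
      exact (norm_mulL_le hac haK _).trans (mul_le_mul_of_nonneg_left hJq hKa)
    have h4 := mul_le_mul hlamΛ h3 (abs_nonneg _) hΛ
    have h5 : 0 ≤ L * L * ‖q‖ := by positivity
    have h6 : D * ‖q‖ = Λ * ((Ka * (L * ‖q‖)) * √L) + L * L * ‖q‖ := by rw [hD]; ring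
    linarith
  obtain ⟨hΘb, hκb⟩ := saddle_bound hIc hc hcI hK hIK (S := ⊤) Submodule.mem_top hs.mean_Θ hB0
    (by positivity) hb hmom hshe
    (Or.inl (exists_infSup_of_mem hL Submodule.mem_top Submodule.mem_top))
  have hΘb' : ‖Θ‖ ≤ X₁ * ‖q‖ := hΘb.trans (le_of_eq (by rw [hX₁]; ring))
  have hκb' : |κ| ≤ X₂ * ‖q‖ := hκb.trans (le_of_eq (by rw [hX₂]; ring))
  have hγr : HasSmoothRep L r (G * ‖q‖) γ := by
    have h1 := (hrep q).J hL
    rw [Nat.sub_add_cancel hr] at h1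
    rw [hκ]
    refine (h1.add hL (hasSmoothRep_smul_one hL κ r)).mono ?_
    have h2 : G * ‖q‖ = (L + 1) * (C₀ * ‖q‖) + X₂ * ‖q‖ := by rw [hG]; ring
    linarith
  -- the rotation
  obtain ⟨y, hy⟩ : ∃ y : ℝ, mulL L I Θ = J L γ + y • one L := by
    refine ⟨_, eq_add_of_sub_eq' (eq_smul_one_of_forall_inner_eq_zero hL fun V hV => ?_)⟩
    have h1 := hs.moment V Submodule.mem_top hV
    have h2 := inner_J_add γ V
    rw [hV, mul_zero] at h2
    rw [inner_sub_left]
    linarith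
  have hyb : |y| ≤ Y * ‖q‖ := by
    rw [hY, div_mul_eq_mul_div, le_div_iff₀ hsL, ← norm_one_eq hL.le, ← Real.norm_eq_abs,
      ← norm_smul]
    have h1 : y • one L = mulL L I Θ - J L γ := by rw [hy]; abel
    rw [h1]
    refine (norm_sub_le _ _).trans ?_
    have h2 := (norm_mulL_le hIc hIK Θ).trans (mul_le_mul_of_nonneg_left hΘb' hK)
    have h3 := (norm_J_le hL.le γ).trans (mul_le_mul_of_nonneg_left (hγr.norm_le hL) hL.le)
    rw [norm_one_eq hL.le]
    refine (add_le_add h2 h3).trans (le_of_eq ?_)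
    ring
  -- `J L γ` has `r + 1` bounded derivatives, but division by `I`, which has only `r`, limits `Θ` to
  -- order `r`.
  have hΘr : HasSmoothRep L r (T * ‖q‖) Θ := by
    rw [← mulL_inv_mulL hIc hi.continuousOn (fun x hx => (hc.trans_le (hcI x hx)).ne') Θ, hy]
    refine ((((hγr.J hL).of_le r.le_succ).add hL (hasSmoothRep_smul_one hL y r)).mulL hL hi).mono
      ?_
    have h1 : T * ‖q‖ = 2 ^ r * (Ki * ((L + 1) * (G * ‖q‖) + Y * ‖q‖)) := by rw [hT]; ring
    rw [h1]
    gcongr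
  -- the slope of the displacement
  have hW : W = J L Θ + (-lam) • mulL L a γ := by
    have h1 : J L Θ - W - lam • mulL L a γ = 0 := by
      rw [← inner_self_eq_zero (𝕜 := ℝ)]
      have h2 := hs.shear (J L Θ - W - lam • mulL L a γ) Submodule.mem_top
      rw [inner_sub_left, real_inner_smul_left]
      linarith
    have h2 : W = J L Θ - lam • mulL L a γ - (J L Θ - W - lam • mulL L a γ) := by abel
    rw [h1, sub_zero] at h2
    rw [h2]
    module
  have hWr : HasSmoothRep L r (Z * ‖q‖) W := by
    rw [hW]
    refine (((hΘr.J hL).of_le r.le_succ).add hL ((hγr.mulL hL ha).smul hL (-lam))).mono ?_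
    have h1 : Z * ‖q‖ = (L + 1) * (T * ‖q‖) + 2 ^ r * (Λ * (2 ^ r * (Ka * (G * ‖q‖)))) := by
      rw [hZ]; ring
    rw [h1, abs_neg, abs_of_nonneg hlam]
    gcongr
  have e1 : 0 ≤ G * ‖q‖ := by positivity
  have e2 : 0 ≤ T * ‖q‖ := by positivity
  have e3 : 0 ≤ Z * ‖q‖ := by positivity
  have e4 : (G + T + Z) * ‖q‖ = G * ‖q‖ + T * ‖q‖ + Z * ‖q‖ := by ring
  exact ⟨hΘr.mono (by linarith), hWr.mono (by linarith), hγr.mono (by linarith)⟩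

end Regularity

section InfSup

variable {L : ℝ} {n : ℕ} {x : Fin (n + 1) → ℝ}

/-! ### The inf-sup condition of the discrete spaces -/

theorem piecewisePoly_mono {m m' : ℕ} (h : m ≤ m') :
    piecewisePoly L x m ≤ piecewisePoly L x m' := by
  intro f hf i
  obtain ⟨p, hp, hfp⟩ := hf i
  exact ⟨p, hp.trans h, hfp⟩

theorem one_mem_piecewisePoly (m : ℕ) : one L ∈ piecewisePoly L x m := by
  intro i
  refine ⟨1, by simp, ?_⟩
  filter_upwards [coeFn_one (L := L)] with y hy _
  rw [hy, Polynomial.eval_one]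

theorem J_one_mem_piecewisePoly {m : ℕ} (hm : 1 ≤ m) : J L (one L) ∈ piecewisePoly L x m := by
  intro i
  refine ⟨Polynomial.X, Polynomial.natDegree_X_le.trans hm, ?_⟩
  filter_upwards [coeFn_J_one (L := L)] with y hy _
  rw [hy, Polynomial.eval_X]

theorem integral_dom_split {s : ℝ} (hs : s ∈ Icc 0 L) {H f : ℝ → ℝ} {α β : ℝ}
    (hf : Continuous f) (hH : ∀ᵐ y ∂(dom L), H y = if y < s then α else β) :
    ∫ y, H y * f y ∂(dom L) = α * (∫ y in (0 : ℝ)..s, f y) + β * ∫ y in s..L, f y := by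
  have h0 : ∫ y, H y * f y ∂(dom L) = ∫ y in (0 : ℝ)..L, (if y < s then α else β) * f y := by
    rw [intervalIntegral.integral_of_le (hs.1.trans hs.2), integral_Ioc_eq_integral_Ioo]
    exact integral_congr_ae (hH.mono fun y hy => by simp only [hy])
  have hm : Measurable fun y : ℝ => if y < s then α else β :=
    Measurable.ite measurableSet_Iio measurable_const measurable_const
  have hint : ∀ c d, IntervalIntegrable (fun y => (if y < s then α else β) * f y) volume c d := by
    intro c d
    have hb : ∀ y : ℝ, ‖if y < s then α else β‖ ≤ |α| + |β| := fun y => by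
      have := abs_nonneg α
      have := abs_nonneg β
      split_ifs <;> rw [Real.norm_eq_abs] <;> linarith
    have hi := hf.intervalIntegrable (μ := volume) c d
    exact ⟨hi.1.bdd_mul hm.aestronglyMeasurable (Eventually.of_forall hb),
      hi.2.bdd_mul hm.aestronglyMeasurable (Eventually.of_forall hb)⟩
  rw [h0, ← intervalIntegral.integral_add_adjacent_intervals (hint 0 s) (hint s L)]
  congr 1
  · rw [← intervalIntegral.integral_const_mul]
    refine intervalIntegral.integral_congr_ae ?_
    have hne : ∀ᵐ y : ℝ, y ≠ s := by simp [ae_iff, measure_singleton]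
    filter_upwards [hne] with y hy hm
    rw [uIoc_of_le hs.1] at hm
    rw [if_pos (lt_of_le_of_ne hm.2 hy)]
  · rw [← intervalIntegral.integral_const_mul]
    refine intervalIntegral.integral_congr fun y hy => ?_
    rw [uIcc_of_le hs.2] at hy
    simp only [if_neg (not_lt.2 hy.1)]

theorem IsMesh.ae_element_eq (hx : IsMesh L x) (k : Fin (n + 1)) {H : ℝ → ℝ} {α β : ℝ}
    (hH : ∀ᵐ y ∂(dom L), ∀ i : Fin n, y ∈ Ioo (x i.castSucc) (x i.succ) →
      H y = if i.castSucc < k then α else β) :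
    ∀ᵐ y ∂(dom L), H y = if y < x k then α else β := by
  filter_upwards [hH, hx.ae_exists_mem] with y hy ⟨i, hi⟩
  rw [hy i hi]
  by_cases h : i.castSucc < k
  · have h1 : x i.succ ≤ x k := hx.strictMono.monotone (Fin.castSucc_lt_iff_succ_le.1 h)
    rw [if_pos h, if_pos (hi.2.trans_le h1)]
  · have h1 : x k ≤ x i.castSucc := hx.strictMono.monotone (not_lt.1 h)
    rw [if_neg h, if_neg (not_lt.2 (h1.trans hi.1.le))]

/-- The inf-sup condition if some node is away from the boundary. -/
theorem exists_infSup_of_node (hL : 0 < L) (hx : IsMesh L x) {k : Fin (n + 1)}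
    (hk : L / 4 ≤ x k) (hk' : x k ≤ 3 * L / 4) (m : ℕ) :
    ∃ H ∈ piecewisePoly L x m, inner ℝ H (one L) = 0 ∧
      ‖H‖ ≤ √L * (8 / L ^ 2) ∧ inner ℝ (J L H) (one L) = 1 := by
  set s := x k with hs
  have hs0 : 0 < s := by linarith
  have hsL : 0 < L - s := by linarith
  -- `α` and `β` solve `α s + β (L - s) = 0` and `α s² / 2 + β (L² - s²) / 2 = -1`: mean zero and
  -- first moment `-1`. As `s` stays away from both ends, they are at most `8 / L ^ 2` in absolute
  -- value.
  set α : ℝ := 2 / (L * s) with hα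
  set β : ℝ := -(2 / (L * (L - s))) with hβ
  obtain ⟨H, hH, hHP⟩ := exists_piecewisePoly hx (m := 0)
    (fun i : Fin n => Polynomial.C (if i.castSucc < k then α else β)) (fun i => by simp)
  have hae := hx.ae_element_eq k (H := H) (α := α) (β := β) (hHP.mono fun y hy i hi => by
    rw [hy i hi, Polynomial.eval_C])
  have hmem : s ∈ Icc 0 L := ⟨hs0.le, by linarith⟩
  have hm : inner ℝ H (one L) = 0 := by
    have h1 := integral_dom_split hmem (continuous_const (y := (1 : ℝ))) hae
    simp only [mul_one, intervalIntegral.integral_const, smul_eq_mul, sub_zero] at h1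
    rw [inner_one, h1, hα, hβ]
    field_simp
    ring
  refine ⟨H, piecewisePoly_mono (Nat.zero_le m) hH, hm, ?_, ?_⟩
  · refine norm_le_of_ae_bound hL.le (by positivity) ?_
    filter_upwards [hae] with y hy
    have h1 : 2 / (L * s) ≤ 8 / L ^ 2 := by
      rw [div_le_div_iff₀ (by positivity) (by positivity)]
      nlinarith
    have h2 : 2 / (L * (L - s)) ≤ 8 / L ^ 2 := by
      rw [div_le_div_iff₀ (by positivity) (by positivity)]
      nlinarith
    rw [hy]
    split_ifs
    · rw [hα, abs_of_nonneg (by positivity)]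
      exact h1
    · rw [hβ, abs_neg, abs_of_nonneg (by positivity)]
      exact h2
  · have h1 := integral_dom_split hmem continuous_id hae
    have h2 : inner ℝ H (J L (one L)) = ∫ y, H y * id y ∂(dom L) := by
      rw [inner_eq_integral]
      refine integral_congr_ae ?_
      filter_upwards [coeFn_J_one (L := L)] with y hy
      rw [hy, id]
    rw [inner_J_one_of_mean_zero hm, h2, h1]
    simp only [id, integral_id, hα, hβ]
    field_simp
    ring

/-- Without a node in the middle half of the domain, one element has to jump over it. -/
theorem exists_node_or_half_le_meshSize (hL : 0 < L) (hx : IsMesh L x) :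
    (∃ k, L / 4 ≤ x k ∧ x k ≤ 3 * L / 4) ∨ L / 2 ≤ meshSize x := by
  by_contra! h
  obtain ⟨h1, h2⟩ := h
  have hall : ∀ k : Fin (n + 1), x k < L / 4 := by
    intro k
    induction k using Fin.induction with
    | zero => rw [hx.first]; linarith
    | succ i ih =>
      by_contra hge
      have h3 := h1 _ (not_lt.1 hge)
      have h4 := le_meshSize x i
      linarith
  have := hall (Fin.last n)
  rw [hx.last] at this
  linarith

/-! ### Piecewise constant shear forces on coarse meshes -/

theorem exists_element_indicator (hx : IsMesh L x) (i : Fin n) :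
    ∃ e ∈ piecewisePoly L x 0, ∀ f : L2 L,
      inner ℝ f e = ∫ y in Ioo (x i.castSucc) (x i.succ), f y := by
  obtain ⟨e, he, heP⟩ := exists_piecewisePoly hx (m := 0)
    (fun j : Fin n => Polynomial.C (if j = i then 1 else 0)) (fun _ => (Polynomial.natDegree_C _).le)
  refine ⟨e, he, fun f => ?_⟩
  have hsub : Ioo (x i.castSucc) (x i.succ) ⊆ Ioo 0 L :=
    Ioo_subset_Ioo (hx.nonneg _) (hx.le_length _)
  have h1 : inner ℝ f e
      = ∫ y, (Ioo (x i.castSucc) (x i.succ)).indicator (fun y => f y) y ∂(dom L) := by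
    rw [inner_eq_integral]
    refine integral_congr_ae ?_
    filter_upwards [heP, hx.ae_exists_mem] with y hy ⟨j, hj⟩
    rw [hy j hj, Polynomial.eval_C]
    by_cases hji : j = i
    · subst hji
      rw [if_pos rfl, mul_one, indicator_of_mem hj]
    · rw [if_neg hji, mul_zero, indicator_of_notMem fun hi => hji (hx.eq_of_mem hj hi)]
  rw [h1, integral_indicator measurableSet_Ioo, Measure.restrict_restrict measurableSet_Ioo,
    inter_eq_left.2 hsub]

theorem setIntegral_element_one (hx : IsMesh L x) (i : Fin n) :
    ∫ y in Ioo (x i.castSucc) (x i.succ), one L y = x i.succ - x i.castSucc := by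
  have h1 := (ae_restrict_iff' measurableSet_Ioo).1 (coeFn_one (L := L))
  have h2 : ∫ y in Ioo (x i.castSucc) (x i.succ), one L y
      = ∫ _ in Ioo (x i.castSucc) (x i.succ), (1 : ℝ) := by
    refine setIntegral_congr_ae measurableSet_Ioo ?_
    filter_upwards [h1] with y hy hm
    exact hy ⟨(hx.nonneg _).trans_lt hm.1, hm.2.trans_le (hx.le_length _)⟩
  rw [h2]
  simp [Measure.real, (hx.castSucc_lt_succ i).le]

/-- A function that is orthogonal to the piecewise constants of mean zero has the same mean on
all elements. -/
theorem mul_setIntegral_eq (hx : IsMesh L x) {f : L2 L}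
    (hf : ∀ H ∈ piecewisePoly L x 0, inner ℝ H (one L) = 0 → inner ℝ f H = 0) (i j : Fin n) :
    (x j.succ - x j.castSucc) * ∫ y in Ioo (x i.castSucc) (x i.succ), f y
      = (x i.succ - x i.castSucc) * ∫ y in Ioo (x j.castSucc) (x j.succ), f y := by
  obtain ⟨e, he, hei⟩ := exists_element_indicator hx i
  obtain ⟨e', he', hej⟩ := exists_element_indicator hx j
  have h := hf ((x j.succ - x j.castSucc) • e - (x i.succ - x i.castSucc) • e')
    (Submodule.sub_mem _ (Submodule.smul_mem _ _ he) (Submodule.smul_mem _ _ he')) (by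
      rw [real_inner_comm, inner_sub_right, real_inner_smul_right, real_inner_smul_right, hei, hej,
        setIntegral_element_one hx, setIntegral_element_one hx]
      ring)
  rw [inner_sub_right, real_inner_smul_right, real_inner_smul_right, hei, hej] at h
  linarith

theorem exists_element_values {f : L2 L} (hf : f ∈ piecewisePoly L x 0) :
    ∃ g : Fin n → ℝ, ∀ᵐ y ∂(dom L), ∀ i, y ∈ Ioo (x i.castSucc) (x i.succ) → f y = g i := by
  choose p hp hfp using hf
  refine ⟨fun i => (p i).coeff 0, ?_⟩
  filter_upwards [ae_all_iff.2 hfp] with y hy i hi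
  rw [hy i hi]
  conv_lhs => rw [Polynomial.eq_C_of_natDegree_le_zero (hp i), Polynomial.eval_C]

theorem setIntegral_element_congr (hx : IsMesh L x) {f g : ℝ → ℝ} (i : Fin n)
    (h : ∀ᵐ y ∂(dom L), y ∈ Ioo (x i.castSucc) (x i.succ) → f y = g y) :
    ∫ y in Ioo (x i.castSucc) (x i.succ), f y = ∫ y in Ioo (x i.castSucc) (x i.succ), g y := by
  have h1 := (ae_restrict_iff' measurableSet_Ioo).1 h
  refine setIntegral_congr_ae measurableSet_Ioo ?_
  filter_upwards [h1] with y hy hm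
  exact hy ⟨(hx.nonneg _).trans_lt hm.1, hm.2.trans_le (hx.le_length _)⟩ hm

theorem setIntegral_element_const (hx : IsMesh L x) (i : Fin n) (c : ℝ) :
    ∫ _ in Ioo (x i.castSucc) (x i.succ), c = (x i.succ - x i.castSucc) * c := by
  simp [Measure.real, (hx.castSucc_lt_succ i).le]

theorem monotone_prim {f : ℝ → ℝ} (hf : Integrable f (dom L)) (h0 : ∀ᵐ y ∂(dom L), 0 ≤ f y) :
    Monotone (prim L f) := by
  intro y z hyz
  have hI : ∀ c d : ℝ, IntervalIntegrable f (dom L) c d := fun c d => hf.intervalIntegrable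
  have h1 : prim L f z - prim L f y = ∫ t in y..z, f t ∂(dom L) :=
    intervalIntegral.integral_interval_sub_left (hI _ _) (hI _ _)
  have h2 : 0 ≤ ∫ t in y..z, f t ∂(dom L) :=
    intervalIntegral.integral_nonneg_of_ae hyz h0
  linarith

/-- A rotation with piecewise constant derivative, driven by a positive shear force, has
nonpositive mean. -/
theorem inner_J_one_nonpos_of_pos (hx : IsMesh L x) {I : ℝ → ℝ}
    (hI : ContinuousOn I (Icc 0 L)) (hI0 : ∀ y ∈ Icc 0 L, 0 < I y) {Θ γ : L2 L}
    (hΘ : Θ ∈ piecewisePoly L x 0) (hΘ0 : inner ℝ Θ (one L) = 0)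
    (hγ : ∀ᵐ y ∂(dom L), 0 ≤ γ y)
    (hmom : ∀ H ∈ piecewisePoly L x 0, inner ℝ H (one L) = 0 →
      inner ℝ (mulL L I Θ) H + inner ℝ γ (J L H) = 0) :
    inner ℝ (J L Θ) (one L) ≤ 0 := by
  obtain ⟨t, ht⟩ := exists_element_values hΘ
  have hmono := monotone_prim (integrable_coeFn γ) hγ
  have hcont : Continuous (prim L γ) := continuous_prim (integrable_coeFn γ)
  have hIi : ∀ i : Fin n, IntegrableOn I (Ioo (x i.castSucc) (x i.succ)) := fun i =>
    ((hI.mono (hx.element_subset i)).integrableOn_Icc).mono_set Ioo_subset_Icc_self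
  have hα : ∀ i : Fin n, 0 < ∫ y in Ioo (x i.castSucc) (x i.succ), I y := by
    intro i
    rw [← integral_Ioc_eq_integral_Ioo, ← intervalIntegral.integral_of_le
      (hx.castSucc_lt_succ i).le]
    refine intervalIntegral.intervalIntegral_pos_of_pos_on ?_ (fun y hy =>
      hI0 y (hx.element_subset i (Ioo_subset_Icc_self hy))) (hx.castSucc_lt_succ i)
    refine ContinuousOn.intervalIntegrable ?_
    rw [uIcc_of_le (hx.castSucc_lt_succ i).le]
    exact hI.mono (hx.element_subset i)
  have hPi : ∀ i : Fin n, IntegrableOn (prim L γ) (Ioo (x i.castSucc) (x i.succ)) := fun i =>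
    (hcont.continuousOn.integrableOn_Icc).mono_set Ioo_subset_Icc_self
  -- the sign of `Θ` changes at most once, from negative to positive
  have hsign : ∀ i j : Fin n, i < j → 0 < t i → 0 < t j := by
    intro i j hij hi
    have horth : ∀ H ∈ piecewisePoly L x 0, inner ℝ H (one L) = 0 →
        inner ℝ (mulL L I Θ - J L γ) H = 0 := by
      intro H hH hHm
      have h1 := hmom H hH hHm
      have h2 := inner_J_add γ H
      rw [hHm, mul_zero] at h2
      rw [inner_sub_left]
      linarith
    have hval : ∀ i : Fin n, ∫ y in Ioo (x i.castSucc) (x i.succ), (mulL L I Θ - J L γ : L2 L) y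
        = t i * (∫ y in Ioo (x i.castSucc) (x i.succ), I y)
          - ∫ y in Ioo (x i.castSucc) (x i.succ), prim L γ y := by
      intro i
      rw [← integral_const_mul, ← integral_sub ((hIi i).const_mul _) (hPi i)]
      refine setIntegral_element_congr hx i ?_
      filter_upwards [Lp.coeFn_sub (mulL L I Θ) (J L γ), coeFn_mulL hI Θ, coeFn_J γ, ht]
        with y h1 h2 h3 h4 hy
      rw [h1, Pi.sub_apply, h2, h3, h4 i hy, mul_comm]
    -- The mean of `I Θ - J γ` is the same on all elements. Since `γ ≥ 0`, the primitive `J γ`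
    -- increases, so the mean of `I Θ` does not decrease from left to right, and with `I > 0` the
    -- sign of `Θ` follows.
    have hkey := mul_setIntegral_eq hx horth i j
    rw [hval, hval] at hkey
    have hij' : x i.succ ≤ x j.castSucc := hx.strictMono.monotone hij
    have hβi : ∫ y in Ioo (x i.castSucc) (x i.succ), prim L γ y
        ≤ (x i.succ - x i.castSucc) * prim L γ (x i.succ) := by
      rw [← setIntegral_element_const hx]
      exact setIntegral_mono_on (hPi i) (by simp) measurableSet_Ioo
        fun y hy => hmono hy.2.le
    have hβj : (x j.succ - x j.castSucc) * prim L γ (x i.succ)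
        ≤ ∫ y in Ioo (x j.castSucc) (x j.succ), prim L γ y := by
      rw [← setIntegral_element_const hx]
      exact setIntegral_mono_on (by simp) (hPi j) measurableSet_Ioo
        fun y hy => hmono (hij'.trans hy.1.le)
    have hhi := sub_pos.2 (hx.castSucc_lt_succ i)
    have hhj := sub_pos.2 (hx.castSucc_lt_succ j)
    have e1 := mul_le_mul_of_nonneg_left hβi hhj.le
    have e2 := mul_le_mul_of_nonneg_left hβj hhi.le
    have e3 : 0 < (x j.succ - x j.castSucc) * (t i * ∫ y in Ioo (x i.castSucc) (x i.succ), I y) :=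
      mul_pos hhj (mul_pos hi (hα i))
    have e4 : 0 < (x i.succ - x i.castSucc) * (t j * ∫ y in Ioo (x j.castSucc) (x j.succ), I y) := by
      linarith
    exact (pos_iff_pos_of_mul_pos (pos_of_mul_pos_right e4 hhi.le)).2 (hα j)
  -- `s` is where `Θ` turns positive, or `L` if it never does. Since `Θ` has mean zero, integrating
  -- shows that its first moment is nonnegative, which is the claim up to sign.
  obtain ⟨s, hs⟩ : ∃ s : ℝ, ∀ᵐ y ∂(dom L), 0 ≤ Θ y * (y - s) := by
    by_cases hex : ∃ i, 0 < t i
    · obtain ⟨i, hi, hmin⟩ : ∃ i, 0 < t i ∧ ∀ j, 0 < t j → i ≤ j := by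
        obtain ⟨i, hi, hle⟩ := Finset.exists_minimal (s := Finset.univ.filter fun i => 0 < t i)
          (by obtain ⟨i, hi⟩ := hex; exact ⟨i, by simpa using hi⟩)
        refine ⟨i, by simpa using hi, fun j hj => ?_⟩
        by_contra hlt
        exact hlt (hle (by simpa using hj) (not_le.1 hlt).le)
      refine ⟨x i.castSucc, ?_⟩
      filter_upwards [ht, hx.ae_exists_mem] with y hy ⟨j, hj⟩
      rw [hy j hj]
      rcases lt_or_ge j i with hji | hji
      · have h1 : t j ≤ 0 := by
          by_contra h
          exact absurd (hmin j (not_le.1 h)) (not_le.2 hji)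
        have h2 : x j.succ ≤ x i.castSucc := hx.strictMono.monotone hji
        exact mul_nonneg_of_nonpos_of_nonpos h1 (by linarith [hj.2])
      · have h1 : 0 < t j := by
          rcases eq_or_lt_of_le hji with h | h
          · rwa [← h]
          · exact hsign i j h hi
        have h2 : x i.castSucc ≤ x j.castSucc :=
          hx.strictMono.monotone (Fin.castSucc_le_castSucc_iff.2 hji)
        exact mul_nonneg h1.le (by linarith [hj.1])
    · refine ⟨L, ?_⟩
      push Not at hex
      filter_upwards [ht, hx.ae_exists_mem, ae_restrict_mem measurableSet_Ioo]
        with y hy ⟨j, hj⟩ hm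
      rw [hy j hj]
      exact mul_nonneg_of_nonpos_of_nonpos (hex j) (by linarith [hm.2])
  have h1 : inner ℝ Θ (J L (one L) - s • one L) = ∫ y, Θ y * (y - s) ∂(dom L) := by
    rw [inner_eq_integral]
    refine integral_congr_ae ?_
    filter_upwards [Lp.coeFn_sub (J L (one L)) (s • one L), Lp.coeFn_smul s (one L), coeFn_one,
      coeFn_J_one (L := L)] with y e1 e2 e3 e4
    rw [e1, Pi.sub_apply, e2, Pi.smul_apply, e3, e4, smul_eq_mul, mul_one]
  have h2 := integral_nonneg_of_ae hs
  rw [← h1, inner_sub_right, real_inner_smul_right, hΘ0, mul_zero, sub_zero] at h2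
  rw [inner_J_one_of_mean_zero hΘ0]
  linarith

/-- If all values of `γ` were positive, `(J Θ, 1)` would be nonpositive by
`inner_J_one_nonpos_of_pos`, yet equal to `lam * (a γ, 1) > 0`. Only the sign of `lam` enters, so no
constant depends on it. -/
theorem exists_nonpos_value (hL : 0 < L) (hx : IsMesh L x) {I a : ℝ → ℝ}
    (hI : ContinuousOn I (Icc 0 L)) (hI0 : ∀ y ∈ Icc 0 L, 0 < I y)
    (ha : ContinuousOn a (Icc 0 L)) (ha0 : ∀ y ∈ Icc 0 L, 0 < a y) {lam : ℝ} (hlam : 0 < lam)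
    {Θ γ : L2 L} (hΘ : Θ ∈ piecewisePoly L x 0) (hΘ0 : inner ℝ Θ (one L) = 0)
    (hmom : ∀ H ∈ piecewisePoly L x 0, inner ℝ H (one L) = 0 →
      inner ℝ (mulL L I Θ) H + inner ℝ γ (J L H) = 0)
    (hshe : inner ℝ (J L Θ) (one L) = lam * inner ℝ (mulL L a γ) (one L)) {g : Fin n → ℝ}
    (hg : ∀ᵐ y ∂(dom L), ∀ i, y ∈ Ioo (x i.castSucc) (x i.succ) → γ y = g i) :
    ∃ i, g i ≤ 0 := by
  by_contra! hpos
  have hγpos : ∀ᵐ y ∂(dom L), 0 < γ y := by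
    filter_upwards [hg, hx.ae_exists_mem] with y hy ⟨i, hi⟩
    rw [hy i hi]
    exact hpos i
  have h1 := inner_J_one_nonpos_of_pos hx hI hI0 hΘ hΘ0 (hγpos.mono fun y hy => hy.le) hmom
  rw [hshe, inner_one] at h1
  have hap : ∀ᵐ y ∂(dom L), 0 < mulL L a γ y := by
    filter_upwards [hγpos, coeFn_mulL ha γ, ae_restrict_mem measurableSet_Ioo] with y e1 e2 e3
    rw [e2]
    exact mul_pos (ha0 y (Ioo_subset_Icc_self e3)) e1
  have h2 : 0 ≤ ∫ y, mulL L a γ y ∂(dom L) := integral_nonneg_of_ae (hap.mono fun y hy => hy.le)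
  have h3 : ∫ y, mulL L a γ y ∂(dom L) = 0 := by nlinarith
  rw [integral_eq_zero_iff_of_nonneg_ae (hap.mono fun y hy => hy.le) (integrable_coeFn _)] at h3
  have h4 : ∀ᵐ y ∂(dom L), False := by
    filter_upwards [hap, h3] with y e1 e2
    rw [e2] at e1
    exact lt_irrefl _ e1
  have hne : NeBot (ae (dom L)) := by
    rw [ae_neBot]
    intro h0
    have := congrArg (fun μ => μ univ) h0
    simp [dom] at this
    linarith
  exact h4.exists.elim fun _ h => h

/-- Without any condition on the mesh, the piecewise constant shear force is controlled by the
exact one. -/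
theorem norm_discrete_shear_sub_le (hL : 0 < L) (hx : IsMesh L x) {I a : ℝ → ℝ}
    (hI : ContinuousOn I (Icc 0 L)) (hI0 : ∀ y ∈ Icc 0 L, 0 < I y)
    (ha : ContinuousOn a (Icc 0 L)) (ha0 : ∀ y ∈ Icc 0 L, 0 < a y) {lam : ℝ} (hlam : 0 < lam)
    {q Θ W γ Θh Wh γh : L2 L} (hex : IsStaticSolution L I a lam q ⊤ Θ W γ)
    (hdi : IsStaticSolution L I a lam q (piecewisePoly L x 0) Θh Wh γh) {N : ℝ} (hN : 0 ≤ N)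
    (hγN : ∀ᵐ y ∂(dom L), |γ y| ≤ N) : ‖γh - γ‖ ≤ √L * (3 * N) := by
  obtain ⟨g, hg⟩ := exists_element_values hdi.mem_γ
  have hshe := hdi.shear (one L) (one_mem_piecewisePoly 0)
  rw [inner_sub_left, hdi.mean_W, sub_zero] at hshe
  obtain ⟨i, hi⟩ := exists_nonpos_value hL hx hI hI0 ha ha0 hlam hdi.mem_Θ hdi.mean_Θ hdi.moment
    hshe hg
  have hnegI : mulL L I (-Θh) = -mulL L I Θh := (mulLin hI).map_neg Θh
  have hnega : mulL L a (-γh) = -mulL L a γh := (mulLin ha).map_neg γh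
  -- By linearity the same holds for the opposite signs: some value of `γh` is nonnegative.
  obtain ⟨j, hj⟩ := exists_nonpos_value hL hx hI hI0 ha ha0 hlam (Θ := -Θh) (γ := -γh)
    (g := fun i => -g i) (Submodule.neg_mem _ hdi.mem_Θ)
    (by rw [inner_neg_left, hdi.mean_Θ, neg_zero])
    (fun H hH hHm => by
      have := hdi.moment H hH hHm
      rw [hnegI, inner_neg_left, inner_neg_left]
      linarith)
    (by rw [map_neg, hnega, inner_neg_left, inner_neg_left, hshe]; ring)
    (by
      filter_upwards [hg, Lp.coeFn_neg γh] with y h1 h2 i hi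
      rw [h2, Pi.neg_apply, h1 i hi])
  -- `γh` and the elementwise means of `γ` differ by a single constant, so `γh` oscillates by at
  -- most `2 * N`.
  have hdiff : ∀ k l : Fin n, g k - g l ≤ 2 * N := by
    intro k l
    have horth : ∀ H ∈ piecewisePoly L x 0, inner ℝ H (one L) = 0 →
        inner ℝ (γh - γ) H = 0 := by
      intro H hH hHm
      have h1 := hex.force H Submodule.mem_top hHm
      have h2 := hdi.force H hH hHm
      rw [inner_sub_left]
      linarith
    have hγi : ∀ k : Fin n, IntegrableOn γ (Ioo (x k.castSucc) (x k.succ)) := fun k =>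
      IntegrableOn.mono_set (integrable_coeFn γ : IntegrableOn γ (Ioo 0 L) volume)
        (Ioo_subset_Ioo (hx.nonneg _) (hx.le_length _))
    have hval : ∀ k : Fin n, ∫ y in Ioo (x k.castSucc) (x k.succ), (γh - γ : L2 L) y
        = (x k.succ - x k.castSucc) * g k - ∫ y in Ioo (x k.castSucc) (x k.succ), γ y := by
      intro k
      rw [← setIntegral_element_const hx, ← integral_sub (by simp) (hγi k)]
      refine setIntegral_element_congr hx k ?_
      filter_upwards [Lp.coeFn_sub γh γ, hg] with y h1 h2 hy
      rw [h1, Pi.sub_apply, h2 k hy]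
    have hbd : ∀ k : Fin n, |∫ y in Ioo (x k.castSucc) (x k.succ), γ y|
        ≤ (x k.succ - x k.castSucc) * N := by
      intro k
      rw [← setIntegral_element_const hx, ← Real.norm_eq_abs]
      refine norm_integral_le_of_norm_le (integrable_const _) ?_
      have hsub : Ioo (x k.castSucc) (x k.succ) ⊆ Ioo 0 L :=
        Ioo_subset_Ioo (hx.nonneg _) (hx.le_length _)
      exact ae_restrict_of_ae_restrict_of_subset hsub hγN
    have hkey := mul_setIntegral_eq hx horth k l
    rw [hval, hval] at hkey
    have hhk := sub_pos.2 (hx.castSucc_lt_succ k)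
    have hhl := sub_pos.2 (hx.castSucc_lt_succ l)
    have e1 := mul_le_mul_of_nonneg_left (abs_le.1 (hbd k)).2 hhl.le
    have e2 := mul_le_mul_of_nonneg_left (abs_le.1 (hbd l)).1 hhk.le
    have e3 : (x k.succ - x k.castSucc) * (x l.succ - x l.castSucc) * (g k - g l)
        ≤ (x k.succ - x k.castSucc) * (x l.succ - x l.castSucc) * (2 * N) := by
      linarith
    exact le_of_mul_le_mul_left e3 (mul_pos hhk hhl)
  -- With values of both signs and oscillation at most `2 * N`, `γh` is bounded by `2 * N`; `γ` adds
  -- another `N`.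
  refine norm_le_of_ae_bound hL.le (by positivity) ?_
  filter_upwards [hg, hx.ae_exists_mem, hγN, Lp.coeFn_sub γh γ] with y h1 ⟨k, hk⟩ h3 h4
  rw [h4, Pi.sub_apply, h1 k hk]
  have e1 := hdiff k i
  have e2 := hdiff j k
  have h3' := abs_le.1 h3
  rw [abs_le]
  constructor <;> linarith

end InfSup

section StaticError

variable {L : ℝ} {n : ℕ} {x : Fin (n + 1) → ℝ}

/-! ### The error of the static problem -/

/-- The static mixed problem with load `q`, tested against `V × V × Q`. -/
structure IsStaticMixed (L : ℝ) (I A : ℝ → ℝ) (lam : ℝ) (q : L2 L) (V : Submodule ℝ (Hk L 1))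
    (Q : Submodule ℝ (L2 L)) (θ w : Hk L 1) (γ : L2 L) : Prop where
  mem : θ ∈ V ∧ w ∈ V ∧ γ ∈ Q
  equilibrium : ∀ η ∈ V, ∀ v ∈ V,
    formA L I θ η + formB L η v γ = ∫ x, q x * (fn v) x ∂(dom L)
  shear : ∀ ψ ∈ Q, formB L θ w ψ - lam * formC L A γ ψ = 0

theorem formA_eq {I : ℝ → ℝ} (hI : ContinuousOn I (Icc 0 L)) (θ η : Hk L 1) :
    formA L I θ η = inner ℝ (mulL L I (der θ)) (der η) := (inner_mulL hI _ _).symm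

theorem formB_eq (η v : Hk L 1) (γ : L2 L) : formB L η v γ = inner ℝ γ (fn η - der v) := by
  rw [inner_eq_integral]
  refine integral_congr_ae ?_
  filter_upwards [Lp.coeFn_sub (fn η) (der v)] with y hy
  rw [hy, Pi.sub_apply]

theorem formC_eq {A : ℝ → ℝ} (hA : ContinuousOn (fun x => (A x)⁻¹) (Icc 0 L)) (γ ψ : L2 L) :
    formC L A γ ψ = inner ℝ (mulL L (fun x => (A x)⁻¹) γ) ψ := by
  rw [inner_mulL hA]
  refine integral_congr_ae (Eventually.of_forall fun y => ?_)
  simp only [div_eq_mul_inv, mul_comm (γ y)]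

/-- Both problems pass through here: the only input is that differentiation maps `V` onto the
mean-zero part of `S`. The choices `v = 0` and `η = 0` split the equilibrium equation. -/
theorem IsStaticMixed.isStaticSolution (hL : 0 < L) {I A : ℝ → ℝ} {lam : ℝ} {q : L2 L}
    {V : Submodule ℝ (Hk L 1)} {S : Submodule ℝ (L2 L)} {θ w : Hk L 1} {γ : L2 L}
    (hI : ContinuousOn I (Icc 0 L)) (hA : ContinuousOn (fun x => (A x)⁻¹) (Icc 0 L))
    (hV : ∀ v ∈ V, v ∈ H01 L ∧ der v ∈ S)
    (hS : ∀ g ∈ S, inner ℝ g (one L) = 0 → ∃ v ∈ V, der v = g ∧ fn v = J L g)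
    (h : IsStaticMixed L I A lam q V S θ w γ) :
    IsStaticSolution L I (fun x => (A x)⁻¹) lam q S (der θ) (der w) γ := by
  obtain ⟨hθ, hw, hγ⟩ := h.mem
  have hz : der (0 : Hk L 1) = 0 := rfl
  have hz' : fn (0 : Hk L 1) = 0 := rfl
  have hθ' := (mem_H01_iff hL θ).1 (hV θ hθ).1
  have hw' := (mem_H01_iff hL w).1 (hV w hw).1
  refine ⟨(hV θ hθ).2, (hV w hw).2, hγ, hθ'.2, hw'.2, fun H hH hHm => ?_, fun g hg hgm => ?_,
    fun ψ hψ => ?_⟩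
  · obtain ⟨η, hη, h1, h2⟩ := hS H hH hHm
    have h3 := h.equilibrium η hη 0 V.zero_mem
    rwa [formA_eq hI, formB_eq, hz, h1, h2, sub_zero, ← inner_eq_integral, hz',
      inner_zero_right] at h3
  · obtain ⟨v, hv, h1, h2⟩ := hS g hg hgm
    have h3 := h.equilibrium 0 V.zero_mem v hv
    rwa [formA_eq hI, formB_eq, hz, hz', h1, ← inner_eq_integral, h2, inner_zero_right, zero_add,
      zero_sub, inner_neg_right] at h3
  · have h3 := h.shear ψ hψ
    rw [formB_eq, formC_eq hA, hθ'.1, real_inner_comm] at h3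
    linarith

theorem IsStaticMixed.isStaticSolution_top (hL : 0 < L) {I A : ℝ → ℝ} {lam : ℝ} {q : L2 L}
    {θ w : Hk L 1} {γ : L2 L} (hI : ContinuousOn I (Icc 0 L))
    (hA : ContinuousOn (fun x => (A x)⁻¹) (Icc 0 L))
    (h : IsStaticMixed L I A lam q (H01 L) ⊤ θ w γ) :
    IsStaticSolution L I (fun x => (A x)⁻¹) lam q ⊤ (der θ) (der w) γ :=
  h.isStaticSolution hL hI hA (fun _ hv => ⟨hv, Submodule.mem_top⟩)
    fun _ _ hg => exists_mem_H01 hL hg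

theorem IsStaticMixed.isStaticSolution_Qh (hL : 0 < L) (hx : IsMesh L x) {r : ℕ} (hr : 1 ≤ r)
    {I A : ℝ → ℝ} {lam : ℝ} {q : L2 L}
    {θ w : Hk L 1} {γ : L2 L} (hI : ContinuousOn I (Icc 0 L))
    (hA : ContinuousOn (fun x => (A x)⁻¹) (Icc 0 L))
    (h : IsStaticMixed L I A lam q (Vh L x r) (Qh L x r) θ w γ) :
    IsStaticSolution L I (fun x => (A x)⁻¹) lam q (Qh L x r) (der θ) (der w) γ := by
  refine IsStaticMixed.isStaticSolution (V := Vh L x r) hL hI hA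
    (fun v hv => ⟨hv.1, der_mem_of_mem_Vh hx hv⟩) (fun g hg hgm => ?_) h
  obtain ⟨u, hu, h1, h2⟩ := exists_mem_H01 hL hgm
  exact ⟨u, mem_Vh_of_der_mem hL hx hr hu (h1 ▸ hg), h1, h2⟩

theorem normH_le_add (η v : Hk L 1) : normH η v ≤ ‖der η‖ + ‖der v‖ := by
  refine Real.sqrt_le_iff.2 ⟨by positivity, ?_⟩
  have := mul_nonneg (norm_nonneg (der η)) (norm_nonneg (der v))
  nlinarith

theorem der_sub (u v : Hk L 1) : der (u - v) = der u - der v := rfl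

/-- The error estimate for the static problem, uniform in `lam`. -/
theorem exists_static_estimate (hL : 0 < L) {r : ℕ} (hr : 1 ≤ r) (M : ℝ) {c cA Λ : ℝ}
    (hc : 0 < c) (hcA : 0 < cA) (hΛ : 0 ≤ Λ) :
    ∃ C : ℝ, 0 ≤ C ∧ ∀ (I A : ℝ → ℝ) (lam : ℝ), 0 < lam → lam ≤ Λ →
      (∀ x ∈ Icc 0 L, c ≤ I x) → (∀ x ∈ Icc 0 L, cA ≤ A x) →
      SmoothBound L r M I → SmoothBound L r M A →
      ∀ (n : ℕ) (x : Fin (n + 1) → ℝ), IsMesh L x →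
      ∀ (q : Hk L r) (θ w θh wh : Hk L 1) (γ γh : L2 L),
      IsStaticMixed L I A lam (fn q) (H01 L) ⊤ θ w γ →
      IsStaticMixed L I A lam (fn q) (Vh L x r) (Qh L x r) θh wh γh →
      normH (θ - θh) (w - wh) ≤ C * meshSize x ^ r * ‖q‖ ∧
        ‖γ - γh‖ ≤ C * meshSize x ^ r * ‖q‖ := by
  obtain ⟨Ki, hKi, hinv⟩ := exists_smoothBound_inv hL r M c hc
  obtain ⟨Ka, hKa, hinvA⟩ := exists_smoothBound_inv hL r M cA hcA
  obtain ⟨C₁, hC₁, hreg⟩ := exists_regularity hL hr (K := |M|) hc (abs_nonneg M) hKi hKa hΛ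
  -- One term per case: `r ≥ 2`; `r = 1` with a node in the middle half; `r = 1` with `meshSize x ≥
  -- L / 2`, where `6 / L * (L / 2) = 3` absorbs the factor of `norm_discrete_shear_sub_le`.
  set B : ℝ := ‖meanFree (J L (one L))‖⁻¹ + √L * (8 / L ^ 2) + 6 / L with hB
  have hB1 : 0 ≤ ‖meanFree (J L (one L))‖⁻¹ := by positivity
  have hB2 : 0 ≤ √L * (8 / L ^ 2) := by positivity
  have hB3 : 0 ≤ 6 / L := by positivity
  have hB0 : 0 ≤ B := by positivity
  obtain ⟨C₂, hC₂, herr⟩ := static_error hL hc (abs_nonneg M) hKa hΛ hB0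
  refine ⟨2 * (C₂ * (√L * C₁)), by positivity, ?_⟩
  intro I A lam hlam hlamΛ hcI hcA' hIs hAs n x hx q θ w θh wh γ γh hex hdi
  have hIM : SmoothBound L r |M| I := hIs.mono (le_abs_self M)
  have hi := hinv I hIs hcI
  have ha := hinvA A hAs hcA'
  have ha0 : ∀ y ∈ Icc 0 L, 0 < (A y)⁻¹ := fun y hy => inv_pos.2 (hcA.trans_le (hcA' y hy))
  have hI0 : ∀ y ∈ Icc 0 L, 0 < I y := fun y hy => hc.trans_le (hcI y hy)
  have hex' := hex.isStaticSolution_top hL hIs.continuousOn ha.continuousOn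
  have hdi' := hdi.isStaticSolution_Qh hL hx hr hIs.continuousOn ha.continuousOn
  obtain ⟨hΘr, hWr, hγr⟩ := hreg I _ lam hIM hi ha hcI (fun y hy => (ha0 y hy).le) hlam.le hlamΛ
    q _ _ _ hex'
  have hh := hx.meshSize_nonneg
  have hq := norm_nonneg q
  set δ : ℝ := √L * (C₁ * ‖q‖ * meshSize x ^ r) with hδ
  have hδ0 : 0 ≤ δ := by positivity
  have hinf : (∃ H ∈ Qh L x r, inner ℝ H (one L) = 0 ∧ ‖H‖ ≤ B ∧ inner ℝ (J L H) (one L) = 1) ∨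
      ‖γh - γ‖ ≤ B * δ := by
    rcases Nat.lt_or_ge 1 r with h2 | h2
    · obtain ⟨H, e1, e2, e3, e4⟩ := exists_infSup_of_mem hL (S := Qh L x r)
        (one_mem_piecewisePoly _) (J_one_mem_piecewisePoly (by omega))
      exact Or.inl ⟨H, e1, e2, by linarith, e4⟩
    · obtain rfl : r = 1 := by omega
      rcases exists_node_or_half_le_meshSize hL hx with ⟨k, hk, hk'⟩ | hhalf
      · obtain ⟨H, e1, e2, e3, e4⟩ := exists_infSup_of_node hL hx hk hk' (1 - 1)
        exact Or.inl ⟨H, e1, e2, by linarith, e4⟩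
      · right
        have hγN : ∀ᵐ y ∂(dom L), |γ y| ≤ C₁ * ‖q‖ := by
          obtain ⟨f, hf, hγf⟩ := hγr
          filter_upwards [hγf, ae_restrict_mem measurableSet_Ioo] with y e1 e2
          rw [e1]
          exact hf.abs_le (Ioo_subset_Icc_self e2)
        refine (norm_discrete_shear_sub_le hL hx hIs.continuousOn hI0 ha.continuousOn ha0 hlam
          hex' hdi' (by positivity) hγN).trans ?_
        have e1 : 3 ≤ B * meshSize x := by
          have : 6 / L * (L / 2) ≤ B * meshSize x :=
            mul_le_mul (by linarith) hhalf (by positivity) hB0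
          have e2 : 6 / L * (L / 2) = 3 := by field_simp; norm_num
          linarith
        have e2 : B * δ = √L * ((B * meshSize x) * (C₁ * ‖q‖)) := by rw [hδ]; ring
        rw [e2]
        have e3 : 0 ≤ C₁ * ‖q‖ := by positivity
        gcongr
  obtain ⟨e1, e2, e3⟩ := herr I _ lam hIs.continuousOn ha.continuousOn hcI
    (fun y hy => hIM.abs_le hy) (fun y hy => (ha0 y hy).le) (fun y hy => ha.abs_le hy) hlam.le
    hlamΛ (Qh L x r) (one_mem_piecewisePoly _) _ _ _ _ _ _ _ hex' hdi' δ hδ0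
    (exists_mem_Qh_approx hL hx hr hΘr) (exists_mem_Qh_approx hL hx hr hWr)
    (exists_mem_Qh_approx hL hx hr hγr) hinf
  have e4 : 2 * (C₂ * (√L * C₁)) * meshSize x ^ r * ‖q‖ = 2 * (C₂ * δ) := by rw [hδ]; ring
  have e5 : 0 ≤ C₂ * δ := by positivity
  rw [e4]
  refine ⟨(normH_le_add _ _).trans ?_, by linarith⟩
  rw [der_sub, der_sub]
  linarith

end StaticError

section Time

/-! ### Volterra equations on `[0, T]` -/

section Volterra

variable {T : ℝ}

theorem intervalIntegrable_of_mem {X : Type*} [NormedAddCommGroup X] {f : ℝ → X}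
    (hf : IntegrableOn f (Icc 0 T)) {t : ℝ} (ht : t ∈ Icc 0 T) : IntervalIntegrable f volume 0 t :=
  (intervalIntegrable_iff_integrableOn_Icc_of_le ht.1).2 (hf.mono_set (Icc_subset_Icc_right ht.2))

/-- Gronwall's inequality for integrable functions. -/
theorem integral_le_of_volterra_le (hT : 0 ≤ T) {u f : ℝ → ℝ} {K : ℝ} (hK : 0 ≤ K)
    (hu : IntegrableOn u (Icc 0 T)) (hf : IntegrableOn f (Icc 0 T)) (hu0 : ∀ t, 0 ≤ u t)
    (hf0 : ∀ t, 0 ≤ f t)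
    (h : ∀ᵐ t ∂(volume.restrict (Icc 0 T)), u t ≤ f t + K * ∫ s in (0 : ℝ)..t, u s) :
    ∫ t in Icc 0 T, u t ≤ Real.exp (K * T) * ∫ t in Icc 0 T, f t := by
  set F := ∫ t in Icc 0 T, f t with hF
  have hF0 : 0 ≤ F := integral_nonneg hf0
  -- Extension by zero makes the primitive `N` continuous on the whole line.
  set v : ℝ → ℝ := (Icc 0 T).indicator u with hv
  have hvi : Integrable v := hu.integrable_indicator measurableSet_Icc
  have hv0 : ∀ t, 0 ≤ v t := fun t => indicator_nonneg (fun s _ => hu0 s) t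
  set N : ℝ → ℝ := fun t => ∫ s in (0 : ℝ)..t, v s with hN
  have hNc : Continuous N := hvi.continuous_primitive 0
  have hNu : ∀ t ∈ Icc 0 T, N t = ∫ s in (0 : ℝ)..t, u s := by
    intro t ht
    refine intervalIntegral.integral_congr fun s hs => ?_
    rw [uIcc_of_le ht.1] at hs
    have hm : s ∈ Icc 0 T := ⟨hs.1, hs.2.trans ht.2⟩
    exact indicator_of_mem hm _
  have hN0 : ∀ t, 0 ≤ t → 0 ≤ N t := fun t ht =>
    intervalIntegral.integral_nonneg ht fun s _ => hv0 s
  -- `u` is only integrable. Integrating the inequality once gives `N ≤ F + K P` with `P' = N`, to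
  -- which the differential form of Gronwall's inequality applies.
  set P : ℝ → ℝ := fun t => ∫ s in (0 : ℝ)..t, N s with hP
  have hP0 : ∀ t, 0 ≤ t → 0 ≤ P t := fun t ht =>
    intervalIntegral.integral_nonneg ht fun s hs => hN0 s hs.1
  have hPd : ∀ t, HasDerivAt P (N t) t := fun t =>
    intervalIntegral.integral_hasDerivAt_right (hNc.intervalIntegrable _ _)
      (hNc.stronglyMeasurableAtFilter _ _) hNc.continuousAt
  have hNle : ∀ t ∈ Icc 0 T, N t ≤ F + K * P t := by
    intro t ht
    have h1 : ∫ s in (0 : ℝ)..t, u s ≤ ∫ s in (0 : ℝ)..t, (f s + K * N s) := by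
      refine intervalIntegral.integral_mono_ae_restrict ht.1 (intervalIntegrable_of_mem hu ht)
        ((intervalIntegrable_of_mem hf ht).add ((hNc.intervalIntegrable _ _).const_mul K)) ?_
      filter_upwards [ae_restrict_of_ae_restrict_of_subset (Icc_subset_Icc_right ht.2) h,
        ae_restrict_mem measurableSet_Icc] with s hs hm
      rw [hNu s ⟨hm.1, hm.2.trans ht.2⟩]
      exact hs
    rw [intervalIntegral.integral_add (intervalIntegrable_of_mem hf ht)
      ((hNc.intervalIntegrable _ _).const_mul K), intervalIntegral.integral_const_mul] at h1
    have h2 : ∫ s in (0 : ℝ)..t, f s ≤ F := by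
      rw [intervalIntegral.integral_of_le ht.1, ← integral_Icc_eq_integral_Ioc]
      exact setIntegral_mono_set hf (Eventually.of_forall hf0)
        (Icc_subset_Icc_right ht.2).eventuallyLE
    rw [hNu t ht]
    linarith
  have hgr := norm_le_gronwallBound_of_norm_deriv_right_le (f := P) (f' := N) (δ := 0) (K := K)
    (ε := F) (a := 0) (b := T) (fun t _ => (hPd t).continuousAt.continuousWithinAt)
    (fun t _ => (hPd t).hasDerivWithinAt) (by simp [hP]) (fun t ht => by
      rw [Real.norm_of_nonneg (hN0 t ht.1), Real.norm_of_nonneg (hP0 t ht.1)]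
      linarith [hNle t ⟨ht.1, ht.2.le⟩]) T ⟨hT, le_rfl⟩
  rw [Real.norm_of_nonneg (hP0 T hT), sub_zero] at hgr
  have h3 : F + K * gronwallBound 0 K F T = Real.exp (K * T) * F := by
    rcases eq_or_ne K 0 with h0 | h0
    · simp [h0]
    · rw [gronwallBound_of_K_ne_0 h0]
      field_simp
      ring
  rw [integral_Icc_eq_integral_Ioc, ← intervalIntegral.integral_of_le hT, ← hNu T ⟨hT, le_rfl⟩,
    ← h3]
  exact (hNle T ⟨hT, le_rfl⟩).trans (by gcongr)

variable {X : Type*} [NormedAddCommGroup X] [NormedSpace ℝ X]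

/-- The Volterra operator with convolution kernel `k`. -/
def volterra (k : ℝ → ℝ) (u : ℝ → X) (t : ℝ) : X := ∫ s in (0 : ℝ)..t, k (t - s) • u s

theorem aestronglyMeasurable_volterra {k : ℝ → ℝ} (hk : Continuous k) {u : ℝ → X}
    (hu : AEStronglyMeasurable u (volume.restrict (Icc 0 T))) :
    AEStronglyMeasurable (volterra k u) (volume.restrict (Icc 0 T)) := by
  have h1 : AEStronglyMeasurable (fun p : ℝ × ℝ => {p : ℝ × ℝ | p.2 ≤ p.1}.indicator
      (fun p => k (p.1 - p.2) • u p.2) p)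
      ((volume.restrict (Icc 0 T)).prod (volume.restrict (Icc 0 T))) := by
    refine AEStronglyMeasurable.indicator ?_ (measurableSet_le measurable_snd measurable_fst)
    exact (hk.comp (continuous_fst.sub continuous_snd)).aestronglyMeasurable.smul hu.comp_snd
  refine h1.integral_prod_right'.congr ?_
  filter_upwards [ae_restrict_mem measurableSet_Icc] with t ht
  rw [volterra, intervalIntegral.integral_of_le ht.1, ← integral_Icc_eq_integral_Ioc]
  have h2 : (fun s => {p : ℝ × ℝ | p.2 ≤ p.1}.indicator (fun p => k (p.1 - p.2) • u p.2) (t, s))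
      = (Iic t).indicator fun s => k (t - s) • u s := by
    funext s
    by_cases hs : s ≤ t <;> simp [indicator, hs]
  rw [h2, integral_indicator measurableSet_Iic, Measure.restrict_restrict measurableSet_Iic]
  congr 2
  ext s
  simp only [mem_inter_iff, mem_Iic, mem_Icc]
  exact ⟨fun h => ⟨h.2.1, h.1⟩, fun h => ⟨h.2, h.1, h.2.trans ht.2⟩⟩

theorem norm_volterra_le {k : ℝ → ℝ} {K : ℝ} (hK : 0 ≤ K) (hkK : ∀ s, |k s| ≤ K) {u : ℝ → X}
    {b : ℝ → ℝ} {t : ℝ} (ht : 0 ≤ t) (hb : IntervalIntegrable b volume 0 t)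
    (hub : ∀ s ∈ Icc 0 t, ‖u s‖ ≤ b s) : ‖volterra k u t‖ ≤ K * ∫ s in (0 : ℝ)..t, b s := by
  rw [← intervalIntegral.integral_const_mul]
  refine intervalIntegral.norm_integral_le_of_norm_le ht ?_ (hb.const_mul K)
  refine Eventually.of_forall fun s hs => ?_
  rw [norm_smul, Real.norm_eq_abs]
  exact mul_le_mul (hkK _) (hub s ⟨hs.1.le, hs.2⟩) (norm_nonneg _) hK

theorem intervalIntegrable_kernel_smul {k : ℝ → ℝ} (hk : Continuous k) {K : ℝ}
    (hkK : ∀ s, |k s| ≤ K) {f : ℝ → X} (hf : IntegrableOn f (Icc 0 T)) {t : ℝ} (ht : t ∈ Icc 0 T) :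
    IntervalIntegrable (fun s => k (t - s) • f s) volume 0 t := by
  rw [intervalIntegrable_iff_integrableOn_Icc_of_le ht.1]
  exact Integrable.bdd_smul (φ := fun s => k (t - s)) (hf.mono_set (Icc_subset_Icc_right ht.2)) K
    (hk.comp (continuous_const.sub continuous_id)).aestronglyMeasurable
    (Eventually.of_forall fun s => hkK _)

theorem integral_pow_div_factorial (n : ℕ) (c t : ℝ) :
    ∫ s in (0 : ℝ)..t, c * (s ^ n / n.factorial) = c * (t ^ (n + 1) / (n + 1).factorial) := by
  rw [intervalIntegral.integral_const_mul, intervalIntegral.integral_div, integral_pow,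
    Nat.factorial_succ]
  push_cast
  field_simp
  simp

/-- Existence for the Volterra equation of the second kind, by the Neumann series. -/
theorem exists_volterra_solution [CompleteSpace X] {k : ℝ → ℝ} (hk : Continuous k) {K : ℝ}
    (hK : 0 ≤ K) (hkK : ∀ s, |k s| ≤ K) {q : ℝ → X} (hq : IntegrableOn q (Icc 0 T)) :
    ∃ p : ℝ → X, IntegrableOn p (Icc 0 T) ∧ ∀ t ∈ Icc 0 T, p t = q t + volterra k p t := by
  -- The series starts at the first iterate: `q` has no pointwise bound, whereas its image is
  -- bounded by `K` times the `L¹` norm of `q`. The term `q` is added at the end.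
  set u : ℕ → ℝ → X := fun n => (volterra k)^[n + 1] q with hu
  have hus : ∀ n, u (n + 1) = volterra k (u n) := fun n => by
    simp only [hu, Function.iterate_succ_apply' _ (n + 1)]
  have hu0 : u 0 = volterra k q := rfl
  set Nq := ∫ t in Icc 0 T, ‖q t‖ with hNq
  have hNq0 : 0 ≤ Nq := integral_nonneg fun _ => norm_nonneg _
  have hmeas : ∀ n, AEStronglyMeasurable (u n) (volume.restrict (Icc 0 T)) := by
    intro n
    induction n with
    | zero => exact aestronglyMeasurable_volterra hk hq.aestronglyMeasurable
    | succ n ih => rw [hus]; exact aestronglyMeasurable_volterra hk ih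
  have hbd : ∀ n, ∀ t ∈ Icc 0 T, ‖u n t‖ ≤ K ^ (n + 1) * Nq * (t ^ n / n.factorial) := by
    intro n
    induction n with
    | zero =>
      intro t ht
      have h1 := norm_volterra_le hK hkK ht.1 (intervalIntegrable_of_mem hq ht).norm
        (fun s _ => le_refl ‖q s‖)
      have h2 : ∫ s in (0 : ℝ)..t, ‖q s‖ ≤ Nq := by
        rw [intervalIntegral.integral_of_le ht.1, ← integral_Icc_eq_integral_Ioc]
        exact setIntegral_mono_set hq.norm (Eventually.of_forall fun _ => norm_nonneg _)
          (Icc_subset_Icc_right ht.2).eventuallyLE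
      rw [hu0]
      refine h1.trans ?_
      simp only [zero_add, pow_one, pow_zero, Nat.factorial_zero, Nat.cast_one, div_one, mul_one]
      gcongr
    | succ n ih =>
      intro t ht
      have h1 := norm_volterra_le (u := u n) hK hkK ht.1
        (b := fun s => K ^ (n + 1) * Nq * (s ^ n / n.factorial))
        (Continuous.intervalIntegrable (by fun_prop) _ _)
        (fun s hs => ih s ⟨hs.1, hs.2.trans ht.2⟩)
      rw [integral_pow_div_factorial] at h1
      rw [hus]
      refine h1.trans (le_of_eq ?_)
      ring
  set c : ℕ → ℝ := fun n => K ^ (n + 1) * Nq * (T ^ n / n.factorial) with hc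
  have hcs : Summable c := by
    have h1 := (Real.summable_pow_div_factorial (K * T)).mul_left (K * Nq)
    refine h1.congr fun n => ?_
    simp only [hc, mul_pow]
    ring
  have hbc : ∀ n, ∀ t ∈ Icc 0 T, ‖u n t‖ ≤ c n := by
    intro n t ht
    refine (hbd n t ht).trans ?_
    have h0 := ht.1
    have h1 := ht.2
    simp only [hc]
    gcongr
  have hsum : ∀ t ∈ Icc 0 T, Summable fun n => u n t := fun t ht =>
    Summable.of_norm_bounded hcs fun n => hbc n t ht
  set S : ℝ → X := fun t => ∑' n, u n t with hS
  have hSm : AEStronglyMeasurable S (volume.restrict (Icc 0 T)) := by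
    refine aestronglyMeasurable_of_tendsto_ae atTop
      (f := fun (m : ℕ) t => ∑ n ∈ Finset.range m, u n t) (fun m => ?_) ?_
    · exact Finset.aestronglyMeasurable_fun_sum _ fun n _ => hmeas n
    · filter_upwards [ae_restrict_mem measurableSet_Icc] with t ht
      exact (hsum t ht).hasSum.tendsto_sum_nat
  have hSi : IntegrableOn S (Icc 0 T) := by
    refine Integrable.of_bound hSm (∑' n, c n) ?_
    filter_upwards [ae_restrict_mem measurableSet_Icc] with t ht
    exact tsum_of_norm_bounded hcs.hasSum fun n => hbc n t ht
  refine ⟨fun t => q t + S t, hq.add hSi, fun t ht => ?_⟩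
  have h1 : volterra k (fun t => q t + S t) t = u 0 t + volterra k S t := by
    simp only [volterra, smul_add]
    rw [intervalIntegral.integral_add (intervalIntegrable_kernel_smul hk hkK hq ht)
      (intervalIntegrable_kernel_smul hk hkK hSi ht)]
    rfl
  have h2 : HasSum (fun n => u (n + 1) t) (volterra k S t) := by
    simp only [hus]
    refine intervalIntegral.hasSum_integral_of_dominated_convergence (fun n _ => K * c n)
      (fun n => ?_) (fun n => ?_) ?_ (by simp) ?_
    · refine AEStronglyMeasurable.smul
        (hk.comp (continuous_const.sub continuous_id)).aestronglyMeasurable ?_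
      rw [uIoc_of_le ht.1]
      exact (hmeas n).mono_set ((Ioc_subset_Icc_self).trans (Icc_subset_Icc_right ht.2))
    · refine Eventually.of_forall fun s hs => ?_
      rw [uIoc_of_le ht.1] at hs
      rw [norm_smul]
      exact mul_le_mul (hkK _) (hbc n s ⟨hs.1.le, hs.2.trans ht.2⟩) (norm_nonneg _) hK
    · exact Eventually.of_forall fun s _ => hcs.mul_left K
    · refine Eventually.of_forall fun s hs => ?_
      rw [uIoc_of_le ht.1] at hs
      exact (hsum s ⟨hs.1.le, hs.2.trans ht.2⟩).hasSum.const_smul _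
  rw [h1, hS]
  simp only
  rw [(hsum t ht).tsum_eq_zero_add, h2.tsum_eq]

end Volterra

end Time

section Reduction

variable {L T : ℝ}

/-! ### Reduction of the viscoelastic problem to the static one -/

/-- Each condition on a weak derivative equates two continuous functionals. The resulting
completeness is needed for Bochner integrals and the Neumann series with values in `H^k(Ω)`. -/
theorem isClosed_Hk (L : ℝ) (k : ℕ) :
    IsClosed (Hk L k : Set (PiLp 2 fun _ : Fin (k + 1) => L2 L)) := by
  have hc : ∀ (j : Fin (k + 1)) {ψ : ℝ → ℝ}, Continuous ψ → HasCompactSupport ψ →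
      Continuous fun u : PiLp 2 (fun _ : Fin (k + 1) => L2 L) => ∫ x, u j x * ψ x ∂(dom L) := by
    intro j ψ hψ hcψ
    have hm : MemLp ψ 2 (dom L) := hψ.memLp_of_hasCompactSupport hcψ
    have h1 : (fun u : PiLp 2 (fun _ : Fin (k + 1) => L2 L) => ∫ x, u j x * ψ x ∂(dom L))
        = fun u => inner ℝ (u j) (hm.toLp ψ) := by
      funext u
      rw [inner_eq_integral]
      refine integral_congr_ae ?_
      filter_upwards [hm.coeFn_toLp] with x hx
      rw [hx]
    rw [h1]
    exact (PiLp.continuous_apply 2 _ j).inner continuous_const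
  change IsClosed {u : PiLp 2 (fun _ : Fin (k + 1) => L2 L) | ∀ j : Fin k, ∀ φ : ℝ → ℝ,
    ContDiff ℝ ∞ φ → HasCompactSupport φ → tsupport φ ⊆ Ioo 0 L →
    ∫ x, u j.castSucc x * deriv φ x ∂(dom L) = - ∫ x, u j.succ x * φ x ∂(dom L)}
  simp only [ofPred_forall]
  refine isClosed_iInter fun j => isClosed_iInter fun φ => isClosed_iInter fun hφ =>
    isClosed_iInter fun hcφ => isClosed_iInter fun _ => ?_
  exact isClosed_eq (hc _ (hφ.continuous_deriv (by simp)) hcφ.deriv)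
    (hc _ hφ.continuous hcφ).neg

instance (L : ℝ) (k : ℕ) : CompleteSpace (Hk L k) := (isClosed_Hk L k).completeSpace_coe

/-- The inclusion of `H^k(Ω)` in `L²(Ω)`, as a continuous linear map. -/
def fnCLM (L : ℝ) (k : ℕ) : Hk L k →L[ℝ] L2 L :=
  (PiLp.proj 2 (fun _ : Fin (k + 1) => L2 L) 0).comp (Hk L k).subtypeL

/-- The weak derivative, as a continuous linear map. -/
def derCLM (L : ℝ) : Hk L 1 →L[ℝ] L2 L :=
  (PiLp.proj 2 (fun _ : Fin 2 => L2 L) 1).comp (Hk L 1).subtypeL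

theorem mulL_comm_inner {a : ℝ → ℝ} (ha : ContinuousOn a (Icc 0 L)) (f g : L2 L) :
    inner ℝ (mulL L a f) g = inner ℝ (mulL L a g) f := by
  rw [inner_mulL ha, inner_mulL ha]
  congr 1
  funext x
  ring

variable {E I A : ℝ → ℝ} {lam : ℝ} {V : Submodule ℝ (Hk L 1)} {Q : Submodule ℝ (L2 L)}
  {θ w : ℝ → Hk L 1} {γ : ℝ → L2 L}

/-- With the coefficient moved to the fixed test function, the forms are continuous linear
functionals of the solution. -/
theorem integrableOn_forms (hI : ContinuousOn I (Icc 0 L)) (hθ : IntegrableOn θ (Icc 0 T))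
    (hγ : IntegrableOn γ (Icc 0 T)) (η v : Hk L 1) :
    IntegrableOn (fun t => formA L I (θ t) η + formB L η v (γ t)) (Icc 0 T) := by
  have h1 : ∀ t, formA L I (θ t) η + formB L η v (γ t)
      = ((innerSL ℝ (mulL L I (der η))).comp (derCLM L)) (θ t)
        + innerSL ℝ (fn η - der v) (γ t) := by
    intro t
    rw [formA_eq hI, formB_eq, mulL_comm_inner hI, real_inner_comm (fn η - der v)]
    rfl
  simp only [h1]
  exact (ContinuousLinearMap.integrable_comp _ hθ).add (ContinuousLinearMap.integrable_comp _ hγ)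

/-- At almost every time the solution solves the static problem whose load is the solution of the
Volterra equation. -/
theorem IsMixedSolution.ae_isStaticMixed (hT : 0 ≤ T) (hI : ContinuousOn I (Icc 0 L))
    {k : ℝ → ℝ} (hk : Continuous k) {K : ℝ} (hK : 0 ≤ K) (hkK : ∀ s, |k s| ≤ K)
    (hkE : ∀ s ∈ Icc 0 T, derivWithin E (Icc 0 T) s / E 0 = k s) {r : ℕ} {q p : ℝ → Hk L r}
    (hp : IntegrableOn p (Icc 0 T)) (hpq : ∀ t ∈ Icc 0 T, p t = q t + volterra k p t)
    (h : IsMixedSolution L T E I A lam (fun t => fn (q t)) V Q θ w γ) :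
    ∀ᵐ t ∂(volume.restrict (Icc 0 T)),
      IsStaticMixed L I A lam (fn (p t)) V Q (θ t) (w t) (γ t) := by
  have hki : ∀ {f : ℝ → ℝ} {t : ℝ}, t ∈ Icc 0 T → IntegrableOn f (Icc 0 T) →
      IntervalIntegrable (fun s => k (t - s) * f s) volume 0 t := by
    intro f t ht hf
    exact intervalIntegrable_kernel_smul hk hkK hf ht
  set F : Hk L 1 → Hk L 1 → ℝ → ℝ := fun η v t => formA L I (θ t) η + formB L η v (γ t) with hF
  set G : Hk L 1 → ℝ → ℝ := fun v t => inner ℝ (fn v) (fn (p t)) with hG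
  have hFi : ∀ η v, IntegrableOn (F η v) (Icc 0 T) := fun η v =>
    integrableOn_forms hI h.integrable_θ h.integrable_γ η v
  have hGi : ∀ v, IntegrableOn (G v) (Icc 0 T) := fun v =>
    ContinuousLinearMap.integrable_comp ((innerSL ℝ (fn v)).comp (fnCLM L r)) hp
  have hGeq : ∀ v, ∀ t ∈ Icc 0 T, G v t = inner ℝ (fn v) (fn (q t))
      + ∫ s in (0 : ℝ)..t, k (t - s) * G v s := by
    intro v t ht
    have hint := intervalIntegrable_kernel_smul hk hkK hp ht
    have h1 := ((innerSL ℝ (fn v)).comp (fnCLM L r)).intervalIntegral_comp_comm hint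
    have h2 : G v t = ((innerSL ℝ (fn v)).comp (fnCLM L r)) (p t) := rfl
    rw [h2, hpq t ht, map_add, volterra, ← h1]
    simp only [map_smul, smul_eq_mul]
    rfl
  -- Subtracting the Volterra equation of `p`, tested with `v`, removes the load and leaves a
  -- homogeneous equation.
  have hgeq : ∀ᵐ t ∂(volume.restrict (Icc 0 T)), ∀ η ∈ V, ∀ v ∈ V,
      F η v t - G v t = ∫ s in (0 : ℝ)..t, k (t - s) * (F η v s - G v s) := by
    filter_upwards [h.equilibrium, ae_restrict_mem measurableSet_Icc] with t ht htm η hη v hv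
    have h1 := ht η hη v hv
    have h2 : ∫ s in (0 : ℝ)..t, kern T E t s * (formA L I (θ s) η + formB L η v (γ s))
        = ∫ s in (0 : ℝ)..t, k (t - s) * F η v s := by
      refine intervalIntegral.integral_congr fun s hs => ?_
      rw [uIcc_of_le htm.1] at hs
      simp only [kern, hF]
      rw [hkE (t - s) ⟨by linarith [hs.2], by linarith [hs.1, htm.2]⟩]
    rw [h2, ← inner_eq_integral, real_inner_comm] at h1
    simp only [mul_sub]
    rw [intervalIntegral.integral_sub (hki htm (hFi η v)) (hki htm (hGi v)), hGeq v t htm]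
    change F η v t = _ at h1
    rw [h1]
    ring
  have hzero : ∀ η ∈ V, ∀ v ∈ V,
      ∀ᵐ t ∂(volume.restrict (Icc 0 T)), F η v t - G v t = 0 := by
    intro η hη v hv
    have hgi : IntegrableOn (fun t => F η v t - G v t) (Icc 0 T) := (hFi η v).sub (hGi v)
    have h1 := integral_le_of_volterra_le hT hK hgi.abs (integrableOn_zero)
      (fun t => abs_nonneg _) (fun t => le_refl (0 : ℝ)) (by
        filter_upwards [hgeq, ae_restrict_mem measurableSet_Icc] with t ht htm
        rw [zero_add, ht η hη v hv]
        exact norm_volterra_le (X := ℝ) hK hkK htm.1 (intervalIntegrable_of_mem hgi htm).abs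
          fun s _ => le_refl |F η v s - G v s|)
    rw [integral_zero, mul_zero] at h1
    have h2 : ∫ t in Icc 0 T, |F η v t - G v t| = 0 :=
      le_antisymm h1 (integral_nonneg fun _ => abs_nonneg _)
    rw [integral_eq_zero_iff_of_nonneg (fun _ => abs_nonneg _) hgi.abs] at h2
    filter_upwards [h2] with t ht
    exact abs_eq_zero.1 ht
  filter_upwards [hgeq, h.mem, h.shear, ae_restrict_mem measurableSet_Icc] with t ht hm hs htm
  refine ⟨hm, fun η hη v hv => ?_, hs⟩
  -- The null set in `hzero` depends on the test functions, while that of `hgeq` does not. At a time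
  -- `t` where `hgeq` holds, the integral ignores null sets in `s`, so the identity follows for all
  -- `η` and `v` at once.
  have h1 : ∫ s in (0 : ℝ)..t, k (t - s) * (F η v s - G v s) = 0 := by
    rw [intervalIntegral.integral_of_le htm.1]
    refine integral_eq_zero_of_ae ?_
    filter_upwards [ae_restrict_of_ae_restrict_of_subset
      (Ioc_subset_Icc_self.trans (Icc_subset_Icc_right htm.2)) (hzero η hη v hv)] with s hs
    rw [hs, mul_zero]
    rfl
  have h2 := ht η hη v hv
  rw [h1, sub_eq_zero] at h2
  rw [← inner_eq_integral, real_inner_comm]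
  exact h2

/-- Extending the kernel by its end values makes it bounded and continuous on the line, so that `k
(t - s)` needs no side conditions on `t - s`. -/
theorem exists_kernel_extension (hT : 0 < T) (hE : ContDiffOn ℝ 1 E (Icc 0 T)) :
    ∃ (k : ℝ → ℝ) (K : ℝ), Continuous k ∧ 0 ≤ K ∧ (∀ s, |k s| ≤ K) ∧
      ∀ s ∈ Icc 0 T, derivWithin E (Icc 0 T) s / E 0 = k s := by
  have hc : ContinuousOn (fun s => derivWithin E (Icc 0 T) s / E 0) (Icc 0 T) :=
    (hE.continuousOn_derivWithin (uniqueDiffOn_Icc hT) le_rfl).div_const _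
  obtain ⟨K, hK⟩ := isCompact_Icc.exists_bound_of_continuousOn hc
  refine ⟨IccExtend hT.le ((Icc 0 T).domRestrict fun s => derivWithin E (Icc 0 T) s / E 0), K,
    (continuousOn_iff_continuous_domRestrict.1 hc).Icc_extend',
    (norm_nonneg _).trans (hK 0 ⟨le_rfl, hT.le⟩), fun s => hK _ (projIcc 0 T hT.le s).2,
    fun s hs => ?_⟩
  rw [IccExtend_of_mem hT.le _ hs]
  rfl

end Reduction

end Timoshenko

end

/-! ### The semi-discrete error estimate. -/

theorem proposition3p1
    (L T : ℝ) (hL : 0 < L) (hT : 0 ≤ T) (r : ℕ) (hr : 1 ≤ r)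
    (E : ℝ → ℝ) (hE : ContDiffOn ℝ 1 E (Set.Icc 0 T)) (hE0 : 0 < E 0)
    (ν : ℝ) (hν : -1 < ν) (εmax : ℝ)
    (cE CE cG CG M : ℝ) (hcE : 0 < cE) (hcG : 0 < cG) :
    ∃ C : ℝ, 0 < C ∧
      ∀ (I A : ℝ → ℝ) (ε : ℝ), 0 < ε → ε ≤ εmax →
      (∀ x ∈ Set.Icc 0 L, cE ≤ E 0 * I x ∧ E 0 * I x ≤ CE) →
      (∀ x ∈ Set.Icc 0 L, cG ≤ E 0 / (2 * (1 + ν)) * A x ∧ E 0 / (2 * (1 + ν)) * A x ≤ CG) →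
      Timoshenko.SmoothBound L r M I → Timoshenko.SmoothBound L r M A →
      ∀ (n : ℕ) (x : Fin (n + 1) → ℝ), Timoshenko.IsMesh L x →
      ∀ (qE : ℝ → Timoshenko.Hk L r), MeasureTheory.IntegrableOn qE (Set.Icc 0 T) →
      ∀ (θ w θh wh : ℝ → Timoshenko.Hk L 1) (γ γh : ℝ → Timoshenko.L2 L),
      Timoshenko.IsMixedSolution L T E I A (2 * (1 + ν) * ε ^ 2) (fun t => Timoshenko.fn (qE t))
        (Timoshenko.H01 L) ⊤ θ w γ →
      Timoshenko.IsMixedSolution L T E I A (2 * (1 + ν) * ε ^ 2) (fun t => Timoshenko.fn (qE t))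
        (Timoshenko.Vh L x r) (Timoshenko.Qh L x r) θh wh γh →
      (∫ t in Set.Icc 0 T, Timoshenko.normH (θ t - θh t) (w t - wh t))
          + (∫ t in Set.Icc 0 T, ‖γ t - γh t‖)
        ≤ C * Timoshenko.meshSize x ^ r * ∫ t in Set.Icc 0 T, ‖qE t‖ := by
  rcases hT.eq_or_lt with rfl | hT0
  -- For `T = 0` all time integrals are over a null set; the kernel extension needs a nondegenerate
  -- interval.
  · refine ⟨1, one_pos, ?_⟩
    intros
    simp
  obtain ⟨k, K, hk, hK, hkK, hkE⟩ := Timoshenko.exists_kernel_extension hT0 hE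
  have hν' : 0 < 2 * (1 + ν) := by linarith
  obtain ⟨C, hC, hstat⟩ := Timoshenko.exists_static_estimate hL hr M (c := cE / E 0)
    (cA := cG * (2 * (1 + ν)) / E 0) (Λ := 2 * (1 + ν) * εmax ^ 2) (by positivity) (by positivity)
    (by positivity)
  -- The `2` counts the two error integrals, the exponential is Gronwall's bound for `p`, and the
  -- `1` only ensures that the constant is positive.
  refine ⟨2 * C * Real.exp (K * T) + 1, by positivity, ?_⟩
  intro I A ε hε hεmax hI hA hIs hAs n x hx qE hqE θ w θh wh γ γh hex hdi
  have hcI : ∀ y ∈ Set.Icc 0 L, cE / E 0 ≤ I y := fun y hy => by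
    rw [div_le_iff₀ hE0, mul_comm]
    exact (hI y hy).1
  have hcA : ∀ y ∈ Set.Icc 0 L, cG * (2 * (1 + ν)) / E 0 ≤ A y := fun y hy => by
    have h1 := (hA y hy).1
    rw [div_mul_eq_mul_div, le_div_iff₀ hν'] at h1
    rw [div_le_iff₀ hE0]
    linarith
  have hlam : 0 < 2 * (1 + ν) * ε ^ 2 := by positivity
  have hlamΛ : 2 * (1 + ν) * ε ^ 2 ≤ 2 * (1 + ν) * εmax ^ 2 := by gcongr
  obtain ⟨p, hp, hpq⟩ := Timoshenko.exists_volterra_solution hk hK hkK hqE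
  have hest : ∀ᵐ t ∂(volume.restrict (Icc 0 T)),
      Timoshenko.normH (θ t - θh t) (w t - wh t) ≤ C * Timoshenko.meshSize x ^ r * ‖p t‖ ∧
        ‖γ t - γh t‖ ≤ C * Timoshenko.meshSize x ^ r * ‖p t‖ := by
    filter_upwards [hex.ae_isStaticMixed hT hIs.continuousOn hk hK hkK hkE hp hpq,
      hdi.ae_isStaticMixed hT hIs.continuousOn hk hK hkK hkE hp hpq] with t h1 h2
    exact hstat I A _ hlam hlamΛ hcI hcA hIs hAs n x hx (p t) _ _ _ _ _ _ h1 h2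
  have hpn : IntegrableOn (fun t => C * Timoshenko.meshSize x ^ r * ‖p t‖) (Icc 0 T) :=
    hp.norm.const_mul _
  have h1 : ∫ t in Icc 0 T, Timoshenko.normH (θ t - θh t) (w t - wh t)
      ≤ C * Timoshenko.meshSize x ^ r * ∫ t in Icc 0 T, ‖p t‖ := by
    rw [← integral_const_mul]
    exact integral_mono_of_nonneg (Filter.Eventually.of_forall fun t => Real.sqrt_nonneg _) hpn
      (hest.mono fun t ht => ht.1)
  have h2 : ∫ t in Icc 0 T, ‖γ t - γh t‖
      ≤ C * Timoshenko.meshSize x ^ r * ∫ t in Icc 0 T, ‖p t‖ := by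
    rw [← integral_const_mul]
    exact integral_mono_of_nonneg (Filter.Eventually.of_forall fun t => norm_nonneg _) hpn
      (hest.mono fun t ht => ht.2)
  have h3 : ∫ t in Icc 0 T, ‖p t‖ ≤ Real.exp (K * T) * ∫ t in Icc 0 T, ‖qE t‖ := by
    refine Timoshenko.integral_le_of_volterra_le hT hK hp.norm hqE.norm (fun _ => norm_nonneg _)
      (fun _ => norm_nonneg _) ?_
    filter_upwards [ae_restrict_mem measurableSet_Icc] with t ht
    conv_lhs => rw [hpq t ht]
    refine (norm_add_le _ _).trans (add_le_add le_rfl ?_)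
    exact Timoshenko.norm_volterra_le hK hkK ht.1
      (Timoshenko.intervalIntegrable_of_mem hp ht).norm fun s _ => le_rfl
  have hh : 0 ≤ Timoshenko.meshSize x ^ r := pow_nonneg hx.meshSize_nonneg r
  have hq : 0 ≤ ∫ t in Icc 0 T, ‖qE t‖ := integral_nonneg fun _ => norm_nonneg _
  have h4 := mul_le_mul_of_nonneg_left h3 (mul_nonneg hC hh)
  have h5 := mul_nonneg hh hq
  calc _ ≤ 2 * (C * Timoshenko.meshSize x ^ r * (Real.exp (K * T) * ∫ t in Icc 0 T, ‖qE t‖)) := by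
        linarith
    _ ≤ (2 * C * Real.exp (K * T) + 1) * Timoshenko.meshSize x ^ r * ∫ t in Icc 0 T, ‖qE t‖ := by
        linarith
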